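/- Consider the modified Korteweg--de Vries equation $u_t+(u_{xx}+u^3)_x=0$ on $\mathbb R$, with $$M[f]=\tfrac12\int f^2,\qquad E[f]=\int\big(\tfrac12 f_x^2-\tfrac14 f^4\big),\qquad F[f]=\int\big(\tfrac12 f_{xx}^2-\tfrac52 f^2f_x^2+\tfrac14 f^6\big).$$ A soliton is $R_{c,\kappa}(t,x;x_0)=\kappa Q_c(x-x_0-ct)$ with $c>0$, $\kappa\in\{-1,1\}$, $x_0\in\mathbb R$ and $Q_c(x)=\big(2c/\cosh^2(\sqrt c\,x)\big)^{1/2}$; its velocity is $c$ and its shape parameters are $(a,b)=(0,\sqrt c)$. A breather is $$B_{\alpha,\beta}(t,x;x_1,x_2)=2\sqrt2\,\partial_x\Big[\arctan\Big(\frac{\beta}{\alpha}\,\frac{\sin(\alpha y_1)}{\cosh(\beta y_2)}\Big)\Big],\quad y_1=x+(\alpha^2-3\beta^2)t+x_1,\quad y_2=x+(3\alpha^2-\beta^2)t+x_2,$$ with $\alpha,\beta>0$ and $x_1,x_2\in\mathbb R$; its velocity is $\beta^2-3\alpha^2$ and its shape parameters are $(a,b)=(\alpha,\beta)$. Let $P_1,\dots,P_J$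 be solitons and breathers with velocities $v_1<v_2<\dots<v_J$ and shape parameters $(a_j,b_j)$, and assume $v_2>0$ if $J\ge2$ (so $v_1$ may be nonpositive). Let $0<\nu_1<1$ satisfy $(b_1^2-a_1^2)+\nu_1(a_1^2+b_1^2)>0$, and, if $J\ge2$, let $m_1$ satisfy $\max(0,v_1)<m_1<v_2$ and $m_1(b_1^2-a_1^2)>\tfrac12(\nu_1-1)(a_1^2+b_1^2)^2$. For $2\le j\le J-1$ put $m_j=\tfrac12(v_j+v_{j+1})$. For $\sigma>0$ let $\Psi(x)=\tfrac2\pi\arctan\big(e^{-\sqrt\sigma x/2}\big)$, let $\Phi_j(t,x)=\Psi(x-m_jt)$ for $1\le j\le J-1$, and $\Phi_J\equiv1$. A multi-breather associated to $P_1,\dots,P_J$ is a solution $u\in C([T,\infty),H^2(\mathbb R))$ of the equation, for some $T\in\mathbb R$, with $\|u(t)-\sum_{j=1}^JP_j(t)\|_{H^2}\to0$ as $t\to+\infty$. For such $u$ and $1\le j\le J$ define $$M_j(t)=\tfrac12\int u^2\Phi_j,\quad E_j(t)=\int\big[\tfrac12u_x^2-\tfrac14u^4\big]\Phi_j,\quad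 F_j(t)=\int\big[\tfrac12u_{xx}^2-\tfrac52u^2u_x^2+\tfrac14u^6\big]\Phi_j,$$ $$\mathcal F_j(t)=F_j(t)+2(b_j^2-a_j^2)E_j(t)+\nu(a_j^2+b_j^2)^2M_j(t).$$ Then there is $\nu_0\in(0,1)$ such that for every sufficiently small $\sigma>0$, every sufficiently small $\varpi>0$ (depending on $\sigma$), every multi-breather $u$ associated to $P_1,\dots,P_J$, every $\nu\in[\nu_0,1)$ and every $1\le j\le J$, there are $T_4\ge T$ and $C>0$ such that for all $t\ge T_4$, $$\mathcal F_j(t)-\sum_{i=1}^jF[P_i]-2(b_j^2-a_j^2)\sum_{i=1}^jE[P_i]-\nu(a_j^2+b_j^2)^2\sum_{i=1}^jM[P_i]\le Ce^{-2\varpi t},$$ where $F[P_i]$, $E[P_i]$, $M[P_i]$ are evaluated at $P_i(t)$ (they do not depend on $t$). The smallness thresholds for $\sigma$ and $\varpi$ do not depend on $u$. -/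

import Mathlib

open MeasureTheory Filter Topology
open scoped ContDiff ENNReal

noncomputable section

namespace MKdV

/-! ### Weak derivatives and the Sobolev space `H²(ℝ)` -/

/-- Test functions on the line: smooth with compact support. -/
def IsTestFunction (φ : ℝ → ℝ) : Prop :=
  ContDiff ℝ ∞ φ ∧ HasCompactSupport φ

/-- `g` is a weak derivative of `f` on the line (both locally integrable). -/
def HasWeakDeriv (f g : ℝ → ℝ) : Prop :=
  LocallyIntegrable f ∧ LocallyIntegrable g ∧
    ∀ φ : ℝ → ℝ, IsTestFunction φ → ∫ x, f x * deriv φ x = -∫ x, g x * φ x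

open Classical in
/-- The weak derivative of `f` (unique up to a null set), and `0` if there is none. -/
def weakDeriv (f : ℝ → ℝ) : ℝ → ℝ :=
  if h : ∃ g, HasWeakDeriv f g then h.choose else 0

/-- Membership in `H²(ℝ)`: `f`, `f'`, `f''` are square integrable, in the weak sense. -/
def MemH2 (f : ℝ → ℝ) : Prop :=
  MemLp f 2 ∧ ∃ g h : ℝ → ℝ, HasWeakDeriv f g ∧ HasWeakDeriv g h ∧ MemLp g 2 ∧ MemLp h 2

/-- The `H²(ℝ)` norm `(‖f‖² + ‖f'‖² + ‖f''‖²)^{1/2}` with `L²` norms on the right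
(used for elements of `H²(ℝ)` only). -/
def h2Norm (f : ℝ → ℝ) : ℝ≥0∞ :=
  (eLpNorm f 2 volume ^ 2 + eLpNorm (weakDeriv f) 2 volume ^ 2 +
    eLpNorm (weakDeriv (weakDeriv f)) 2 volume ^ 2) ^ (1 / 2 : ℝ)

/-! ### The equation and its conserved quantities -/

/-- `u ∈ C([T, ∞), H²(ℝ))` is a solution of `u_t + (u_xx + u³)_x = 0`. The equation holds in the
sense of distributions in `x` for every time `t > T`: for each test function `φ`,
`d/dt ∫ u φ = ∫ (u_xx + u³) φ_x`. For functions in `C([T, ∞), H²(ℝ))` this is the same as the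
equation in the sense of distributions on `(T, ∞) × ℝ`. -/
structure IsH2Solution (T : ℝ) (u : ℝ → ℝ → ℝ) : Prop where
  mem : ∀ t, T ≤ t → MemH2 (u t)
  continuous : ∀ t, T ≤ t →
    Tendsto (fun s => h2Norm (fun x => u s x - u t x)) (𝓝[Set.Ici T] t) (𝓝 0)
  equation : ∀ t, T < t → ∀ φ : ℝ → ℝ, IsTestFunction φ →
    HasDerivAt (fun s => ∫ x, u s x * φ x)
      (∫ x, (weakDeriv (weakDeriv (u t)) x + u t x ^ 3) * deriv φ x) t

/-- The mass `½ ∫ f² Φ`, localized by the weight `Φ`. -/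
def localMass (Φ f : ℝ → ℝ) : ℝ :=
  1 / 2 * ∫ x, f x ^ 2 * Φ x

/-- The energy `∫ (½ f_x² - ¼ f⁴) Φ`, localized by the weight `Φ`. -/
def localEnergy (Φ f : ℝ → ℝ) : ℝ :=
  ∫ x, (1 / 2 * weakDeriv f x ^ 2 - 1 / 4 * f x ^ 4) * Φ x

/-- The second energy `∫ (½ f_xx² - (5/2) f² f_x² + ¼ f⁶) Φ`, localized by the weight `Φ`. -/
def localSecondEnergy (Φ f : ℝ → ℝ) : ℝ :=
  ∫ x, (1 / 2 * weakDeriv (weakDeriv f) x ^ 2 - 5 / 2 * f x ^ 2 * weakDeriv f x ^ 2 +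
    1 / 4 * f x ^ 6) * Φ x

/-- The mass `M[f]`. -/
def mass (f : ℝ → ℝ) : ℝ := localMass (fun _ => 1) f

/-- The energy `E[f]`. -/
def energy (f : ℝ → ℝ) : ℝ := localEnergy (fun _ => 1) f

/-- The second energy `F[f]`. -/
def secondEnergy (f : ℝ → ℝ) : ℝ := localSecondEnergy (fun _ => 1) f

/-! ### Solitons, breathers, multi-breathers -/

/-- The ground state `Q_c(x) = (2c / cosh²(√c x))^{1/2}`. -/
def groundState (c x : ℝ) : ℝ :=
  Real.sqrt (2 * c / Real.cosh (Real.sqrt c * x) ^ 2)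

/-- The soliton `R_{c,κ}(t, x; x₀)`. -/
def solitonProfile (c κ x₀ t x : ℝ) : ℝ :=
  κ * groundState c (x - x₀ - c * t)

/-- The breather `B_{α,β}(t, x; x₁, x₂)`. -/
def breatherProfile (α β x₁ x₂ t x : ℝ) : ℝ :=
  2 * Real.sqrt 2 * deriv (fun z : ℝ => Real.arctan (β / α *
    (Real.sin (α * (z + (α ^ 2 - 3 * β ^ 2) * t + x₁)) /
      Real.cosh (β * (z + (3 * α ^ 2 - β ^ 2) * t + x₂))))) x

/-- The basic objects: solitons and breathers, with their parameters. -/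
inductive Wave : Type
  | soliton (c κ x₀ : ℝ) (hc : 0 < c) (hκ : κ = 1 ∨ κ = -1) : Wave
  | breather (α β x₁ x₂ : ℝ) (hα : 0 < α) (hβ : 0 < β) : Wave

namespace Wave

/-- The object as a function of `(t, x)`. -/
def profile : Wave → ℝ → ℝ → ℝ
  | soliton c κ x₀ _ _ => solitonProfile c κ x₀
  | breather α β x₁ x₂ _ _ => breatherProfile α β x₁ x₂

/-- The velocity: `c` for a soliton, `β² - 3α²` for a breather. -/
def velocity : Wave → ℝ
  | soliton c _ _ _ _ => c
  | breather α β _ _ _ _ => β ^ 2 - 3 * α ^ 2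

/-- The first shape parameter: `0` for a soliton, `α` for a breather. -/
def a : Wave → ℝ
  | soliton _ _ _ _ _ => 0
  | breather α _ _ _ _ _ => α

/-- The second shape parameter: `√c` for a soliton, `β` for a breather. -/
def b : Wave → ℝ
  | soliton c _ _ _ _ => Real.sqrt c
  | breather _ β _ _ _ _ => β

end Wave

/-- The sum `P₁ + ⋯ + P_J` at time `t`. The objects are numbered `1, …, J`. -/
def sumProfile (J : ℕ) (P : ℕ → Wave) (t x : ℝ) : ℝ :=
  ∑ i ∈ Finset.Icc 1 J, (P i).profile t x

/-- `u ∈ C([T, ∞), H²(ℝ))` is a solution of the equation with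
`‖u(t) - (P₁ + ⋯ + P_J)(t)‖_{H²} → 0` as `t → ∞`. -/
structure IsMultiBreather (J : ℕ) (P : ℕ → Wave) (T : ℝ) (u : ℝ → ℝ → ℝ) : Prop where
  solution : IsH2Solution T u
  tendsto : Tendsto (fun t => h2Norm (fun x => u t x - sumProfile J P t x)) atTop (𝓝 0)

/-! ### Cut-off functions and the localized functionals -/

/-- `Ψ(x) = (2/π) arctan(exp(-√σ x / 2))`. -/
def cutoffShape (σ x : ℝ) : ℝ :=
  2 / Real.pi * Real.arctan (Real.exp (-Real.sqrt σ * x / 2))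

/-- The velocity `m_j` of the cut-off (used for `1 ≤ j ≤ J - 1`): the chosen `m₁` for `j = 1`, and
the mean of the velocities of `P_j` and `P_{j+1}` for `j ≥ 2`. -/
def cutoffVelocity (P : ℕ → Wave) (m₁ : ℝ) (j : ℕ) : ℝ :=
  if j = 1 then m₁ else ((P j).velocity + (P (j + 1)).velocity) / 2

/-- The cut-off `Φ_j(t, x) = Ψ(x - m_j t)` for `j < J`, and `Φ_J = 1`. -/
def cutoff (J : ℕ) (P : ℕ → Wave) (m₁ σ : ℝ) (j : ℕ) (t x : ℝ) : ℝ :=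
  if j = J then 1 else cutoffShape σ (x - cutoffVelocity P m₁ j * t)

/-- The weakened localized functional
`𝓕_j(t) = F_j(t) + 2 (b_j² - a_j²) E_j(t) + ν (a_j² + b_j²)² M_j(t)` of `u`. -/
def weakFunctional (J : ℕ) (P : ℕ → Wave) (m₁ σ ν : ℝ) (u : ℝ → ℝ → ℝ) (j : ℕ) (t : ℝ) : ℝ :=
  localSecondEnergy (cutoff J P m₁ σ j t) (u t) +
    2 * ((P j).b ^ 2 - (P j).a ^ 2) * localEnergy (cutoff J P m₁ σ j t) (u t) +
    ν * ((P j).a ^ 2 + (P j).b ^ 2) ^ 2 * localMass (cutoff J P m₁ σ j t) (u t)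

end MKdV

end

/-! Fix `j` and write A = 2(b_j² - a_j²), D = ν(a_j² + b_j²)². The functional is the integral I(t)
of `dens A D` against a decreasing weight P(x - m t), with P' = -p, whose speed m = m_j > 0 lies
strictly between v_j and v_{j+1}. Two facts give the bound. First, I is almost nondecreasing: I(t) ≤
I(t') + C e^{-lt} for t ≤ t' (`exists_integral_dens_le`). Second, I(t) - S(t) → 0, where S is the
sum of the functionals of P_1, …, P_j: in the frame of a wave the weight tends to 1 or 0, and waves
of different velocities decouple (`tendsto_integral_dens_sum`). It remains to let t' → ∞.
Conservation of the functionals along a wave is not needed for this: each wave is periodic in time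
up to translation, so S is a finite sum of continuous periodic functions, and t' = t + r can be
taken with r arbitrarily large and S(t + r) arbitrarily close to S(t) (`exists_recurrence`).

Monotonicity rests on `flux_identity`. Up to exact derivatives and commutators, the time derivative
of I is the integral of 3/2 (w_xxx + μ w_x)² p, plus a diagonal quadratic form in (w, w_x, w_xx)
weighted by p, minus a quadratic form weighted by p'', plus terms at least cubic. The parameter μ is
free. It matters for the first wave, where A may be negative: the square then lends 3μ to the
coefficient of w_xx² and takes 3/2 μ² from that of w_x². With μ = ν₁(a² + b²) the hypotheses on ν₁
and m₁ say precisely that both coefficients stay positive for ν close to 1. For j ≥ 2 the velocity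
is positive, hence b_j > a_j and μ = 0 suffices (`exists_coercive_cutoff`). Since |p''| ≤ (σ/4) p, a
small σ makes the form in p'' harmless. In the cubic terms one factor is u or u_x, which is at most
δ + g with δ small and g a sum of exponentials centred at the waves; the part in δ is absorbed by
coercivity and g p is at most M e^{-lt}, because the transition of the cut-off separates linearly
from every wave.

The solution is only in H², so the computation is made for w = u * ρ_ε. The commutators of
mollification with the cubic term are O(ε) in L² (`exists_l2sq_comm_le`). The only product that this
does not settle pairs such a commutator with w_xxx, which may grow like 1/ε; but ε ‖w_xxx‖ tends to
0, uniformly on compact time intervals, and the product vanishes in the limit. For j = J the weight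
is the constant 1, p vanishes, and the same argument applies with no coercivity. -/

namespace MKdV

/-! ### Test functions and convolution -/

/-- The convolution `∫ f(y) g(x - y) dy` of real functions on the line. -/
noncomputable def conv (f g : ℝ → ℝ) (x : ℝ) : ℝ := ∫ y, f y * g (x - y)

theorem conv_eq_convolution (f g : ℝ → ℝ) :
    conv f g = convolution f g (ContinuousLinearMap.lsmul ℝ ℝ) volume := by
  ext x
  simp [conv, convolution_def]

theorem IsTestFunction.deriv {φ : ℝ → ℝ} (h : IsTestFunction φ) : IsTestFunction (deriv φ) :=
  ⟨(contDiff_infty_iff_deriv.1 h.1).2, h.2.deriv⟩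

theorem IsTestFunction.continuous {φ : ℝ → ℝ} (h : IsTestFunction φ) : Continuous φ :=
  h.1.continuous

theorem IsTestFunction.hasDerivAt {φ : ℝ → ℝ} (h : IsTestFunction φ) (x : ℝ) :
    HasDerivAt φ (_root_.deriv φ x) x :=
  ((h.1.differentiable (by simp)) x).hasDerivAt

theorem IsTestFunction.reflect {φ : ℝ → ℝ} (h : IsTestFunction φ) (x : ℝ) :
    IsTestFunction (fun y => φ (x - y)) :=
  ⟨h.1.comp (contDiff_const.sub contDiff_id),
    h.2.comp_homeomorph (Homeomorph.subLeft x)⟩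

theorem IsTestFunction.deriv_reflect {φ : ℝ → ℝ} (h : IsTestFunction φ) (x y : ℝ) :
    _root_.deriv (fun y => φ (x - y)) y = -_root_.deriv φ (x - y) := by
  have := (h.hasDerivAt (x - y)).scomp y ((hasDerivAt_id y).const_sub x)
  simpa [Function.comp_def] using this.deriv

theorem hasDerivAt_conv {f g : ℝ → ℝ} (hf : LocallyIntegrable f) (hg : IsTestFunction g) (x : ℝ) :
    HasDerivAt (conv f g) (conv f (deriv g) x) x := by
  rw [conv_eq_convolution, conv_eq_convolution]
  exact hg.2.hasDerivAt_convolution_right _ hf (hg.1.of_le (by exact_mod_cast le_top)) x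

theorem continuous_conv {f g : ℝ → ℝ} (hf : LocallyIntegrable f) (hg : IsTestFunction g) :
    Continuous (conv f g) :=
  continuous_iff_continuousAt.2 fun x => (hasDerivAt_conv hf hg x).continuousAt

/-- The reflected test function is itself a test function, so the definition of weak derivative
moves the derivative off the mollifier. All derivatives of mollified functions are identified in
this way. -/
theorem HasWeakDeriv.conv_deriv {f f' g : ℝ → ℝ} (h : HasWeakDeriv f f') (hg : IsTestFunction g) :
    conv f (deriv g) = conv f' g := by
  ext x
  have := h.2.2 _ (hg.reflect x)
  simp only [hg.deriv_reflect, mul_neg, integral_neg, neg_inj] at this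
  exact this

theorem integrable_mul_test {f φ : ℝ → ℝ} (hf : LocallyIntegrable f) (hφ : Continuous φ)
    (hc : HasCompactSupport φ) : Integrable (fun x => f x * φ x) := by
  simpa [mul_comm] using! hf.integrable_smul_right_of_hasCompactSupport hφ hc

/-! ### Weak derivatives -/

theorem HasWeakDeriv.congr_left {f f' g : ℝ → ℝ} (h : HasWeakDeriv f g) (hf : f =ᵐ[volume] f') :
    HasWeakDeriv f' g := by
  refine ⟨h.1.congr hf, h.2.1, fun φ hφ => ?_⟩
  rw [← h.2.2 φ hφ]
  exact integral_congr_ae (hf.mono fun x hx => by simp [hx])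

theorem HasWeakDeriv.sub {f g f' g' : ℝ → ℝ} (h : HasWeakDeriv f f') (h' : HasWeakDeriv g g') :
    HasWeakDeriv (fun x => f x - g x) (fun x => f' x - g' x) := by
  refine ⟨h.1.sub h'.1, h.2.1.sub h'.2.1, fun φ hφ => ?_⟩
  have hd := hφ.deriv
  simp only [sub_mul]
  rw [integral_sub (integrable_mul_test h.1 hd.continuous hd.2)
    (integrable_mul_test h'.1 hd.continuous hd.2),
    integral_sub (integrable_mul_test h.2.1 hφ.continuous hφ.2)
    (integrable_mul_test h'.2.1 hφ.continuous hφ.2), h.2.2 φ hφ, h'.2.2 φ hφ]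
  ring

theorem HasWeakDeriv.ae_unique {f g g' : ℝ → ℝ} (h : HasWeakDeriv f g) (h' : HasWeakDeriv f g') :
    g =ᵐ[volume] g' := by
  refine ae_eq_of_integral_contDiff_smul_eq h.2.1 h'.2.1 fun φ h1 h2 => ?_
  have e1 := h.2.2 φ ⟨h1, h2⟩
  have e2 := h'.2.2 φ ⟨h1, h2⟩
  simp only [smul_eq_mul, mul_comm (φ _)]
  linarith

theorem HasWeakDeriv.weakDeriv_ae {f g : ℝ → ℝ} (h : HasWeakDeriv f g) :
    weakDeriv f =ᵐ[volume] g := by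
  have hex : ∃ g, HasWeakDeriv f g := ⟨g, h⟩
  rw [weakDeriv, dif_pos hex]
  exact hex.choose_spec.ae_unique h

/-- The equality is everywhere and not merely almost everywhere: both functions have the same set of
weak derivatives, so the same element is chosen. -/
theorem weakDeriv_congr {f f' : ℝ → ℝ} (h : f =ᵐ[volume] f') : weakDeriv f = weakDeriv f' := by
  have : HasWeakDeriv f = HasWeakDeriv f' := by
    ext g
    exact ⟨fun H => H.congr_left h, fun H => H.congr_left h.symm⟩
  unfold weakDeriv
  rw [this]

/-- A mollifying sequence of bump functions. -/
noncomputable def bumpSeq (n : ℕ) : ContDiffBump (0 : ℝ) :=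
  ⟨1 / (n + 1 : ℝ), 2 / (n + 1 : ℝ), by positivity, by gcongr; norm_num⟩

/-- Mollifications of `f` are smooth with zero derivative, hence constant, and they converge to `f`
almost everywhere. -/
theorem HasWeakDeriv.ae_const_of_zero {f : ℝ → ℝ} (h : HasWeakDeriv f 0) :
    ∃ c, f =ᵐ[volume] fun _ => c := by
  have ht : ∀ᵐ x, Tendsto (fun n => convolution ((bumpSeq n).normed volume) f
      (ContinuousLinearMap.lsmul ℝ ℝ) volume x) atTop (𝓝 (f x)) := by
    refine ContDiffBump.ae_convolution_tendsto_right_of_locallyIntegrable (K := 2) ?_ ?_ h.1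
    · have := (tendsto_one_div_add_atTop_nhds_zero_nat (𝕜 := ℝ)).const_mul 2
      simpa [bumpSeq, div_eq_mul_inv] using this
    · exact Eventually.of_forall fun n => by simp [bumpSeq, div_eq_mul_inv]
  have hconst : ∀ n x, convolution ((bumpSeq n).normed volume) f
      (ContinuousLinearMap.lsmul ℝ ℝ) volume x = conv f ((bumpSeq n).normed volume) 0 := by
    intro n x
    have htest : IsTestFunction ((bumpSeq n).normed volume) :=
      ⟨(bumpSeq n).contDiff_normed, (bumpSeq n).hasCompactSupport_normed⟩
    have e : convolution ((bumpSeq n).normed volume) f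
      (ContinuousLinearMap.lsmul ℝ ℝ) volume x = conv f ((bumpSeq n).normed volume) x := by
      rw [convolution_eq_swap]
      simp [conv, mul_comm]
    rw [e]
    refine is_const_of_deriv_eq_zero
      (fun y => (hasDerivAt_conv h.1 htest y).differentiableAt) (fun y => ?_) _ _
    rw [(hasDerivAt_conv h.1 htest y).deriv, h.conv_deriv htest]
    simp [conv]
  simp only [hconst] at ht
  obtain ⟨x₀, hx₀⟩ := ht.exists
  exact ⟨f x₀, ht.mono fun x hx => tendsto_nhds_unique hx hx₀⟩

/-- Integration by parts of a primitive against a `C¹` function of compact support. -/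
theorem integral_primitive_mul_deriv {b b' ψ ψ' : ℝ → ℝ} (hb' : LocallyIntegrable b')
    (hb : ∀ x y, b y - b x = ∫ t in x..y, b' t) (hψ : ∀ x, HasDerivAt ψ (ψ' x) x)
    (hψ' : Continuous ψ') (hc : HasCompactSupport ψ) :
    ∫ x, b x * ψ' x = -∫ x, b' x * ψ x := by
  have hder : deriv ψ = ψ' := funext fun x => (hψ x).deriv
  have hcont : Continuous ψ := continuous_iff_continuousAt.2 fun x => (hψ x).continuousAt
  have hc' : HasCompactSupport ψ' := hder ▸ hc.deriv
  obtain ⟨R, hR, hRs⟩ : ∃ R : ℝ, 0 < R ∧ ∀ x, R ≤ |x| → ψ x = 0 := by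
    obtain ⟨R, hR⟩ := hc.isCompact.isBounded.subset_closedBall 0
    refine ⟨|R| + 1, by positivity, fun x hx => image_eq_zero_of_notMem_tsupport fun h => ?_⟩
    have := hR h
    simp only [Metric.mem_closedBall, Real.dist_eq, sub_zero] at this
    linarith [le_abs_self R]
  have hts : tsupport ψ ⊆ Set.Icc (-R) R := by
    refine closure_minimal (fun x hx => ?_) isClosed_Icc
    by_contra hcon
    refine hx (hRs x ?_)
    by_contra hlt
    exact hcon (abs_le.1 (not_le.1 hlt).le)
  have hii : ∀ x y, IntervalIntegrable b' volume x y := fun x y => (hb'.integrableOn_isCompact isCompact_uIcc).intervalIntegrable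
  -- A primitive of a locally integrable function is absolutely continuous, which is enough for
  -- integration by parts. The interval reaches beyond the support of `ψ`, so the boundary terms
  -- vanish.
  have hAC : AbsolutelyContinuousOnInterval b (-(R + 1)) (R + 1) := by
    have h0 := (hii (-(R + 1)) (R + 1)).absolutelyContinuousOnInterval_intervalIntegral
      (c := 0) (by rw [Set.mem_uIcc]; left; constructor <;> linarith)
    have hfun : b = fun x => b 0 + ∫ t in (0 : ℝ)..x, b' t := by
      ext x; rw [← hb 0 x]; ring
    rw [hfun]
    rw [absolutelyContinuousOnInterval_iff] at h0 ⊢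
    simpa using h0
  have hACψ : AbsolutelyContinuousOnInterval ψ (-(R + 1)) (R + 1) := by
    have : ContDiff ℝ 1 ψ := contDiff_one_iff_deriv.2
      ⟨fun x => (hψ x).differentiableAt, hder ▸ hψ'⟩
    exact this.contDiffOn.absolutelyContinuousOnInterval
  have hibp := hAC.integral_mul_deriv_eq_deriv_mul hACψ
  have hz : ∀ x, R ≤ |x| → ψ x = 0 := hRs
  rw [hz (R + 1) (by rw [abs_of_pos] <;> linarith),
    hz (-(R + 1)) (by rw [abs_neg, abs_of_pos] <;> linarith), hder] at hibp
  have hsub : ∀ {F : ℝ → ℝ}, Function.support F ⊆ Set.Icc (-R) R →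
      ∫ x in -(R + 1)..(R + 1), F x = ∫ x, F x := by
    intro F hF
    refine intervalIntegral.integral_eq_integral_of_support_subset (hF.trans ?_)
    intro x hx
    exact ⟨by linarith [hx.1], by linarith [hx.2]⟩
  have hd : ∀ᵐ x, deriv b x = b' x := by
    have := LocallyIntegrable.ae_hasDerivAt_integral hb'
    filter_upwards [this] with x hx
    have hfun : b = fun x => b 0 + ∫ t in (0 : ℝ)..x, b' t := by
      ext x; rw [← hb 0 x]; ring
    rw [hfun]
    exact ((hx 0).const_add _).deriv
  have e1 : ∫ x in -(R + 1)..(R + 1), b x * ψ' x = ∫ x, b x * ψ' x := by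
    refine hsub fun x hx => ?_
    have : ψ' x ≠ 0 := right_ne_zero_of_mul hx
    rw [← hder] at this
    exact hts (support_deriv_subset this)
  have e2 : ∫ x in -(R + 1)..(R + 1), deriv b x * ψ x = ∫ x, deriv b x * ψ x := by
    refine hsub fun x hx => ?_
    exact hts (subset_tsupport _ (right_ne_zero_of_mul hx))
  have e3 : ∫ x, deriv b x * ψ x = ∫ x, b' x * ψ x :=
    integral_congr_ae (hd.mono fun x hx => by simp [hx])
  rw [e1, e2, e3] at hibp
  linarith

theorem hasWeakDeriv_primitive {b b' : ℝ → ℝ} (hb' : LocallyIntegrable b')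
    (hb : ∀ x y, b y - b x = ∫ t in x..y, b' t) : HasWeakDeriv b b' := by
  have hcont : Continuous b := by
    have hfun : b = fun x => b 0 + ∫ t in (0 : ℝ)..x, b' t := by
      ext x; rw [← hb 0 x]; ring
    rw [hfun]
    exact continuous_const.add (intervalIntegral.continuous_primitive
      (fun x y => (hb'.integrableOn_isCompact isCompact_uIcc).intervalIntegrable) 0)
  refine ⟨hcont.locallyIntegrable, hb', fun φ hφ => ?_⟩
  exact integral_primitive_mul_deriv hb' hb hφ.hasDerivAt hφ.deriv.continuous hφ.2

/-- Subtracting from `f` the integral of `g` leaves a function of zero weak derivative, which is a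
constant. -/
theorem HasWeakDeriv.exists_primitive {f g : ℝ → ℝ} (h : HasWeakDeriv f g) :
    ∃ b : ℝ → ℝ, f =ᵐ[volume] b ∧ ∀ x y, b y - b x = ∫ t in x..y, g t := by
  have hii : ∀ x y, IntervalIntegrable g volume x y := fun x y => (h.2.1.integrableOn_isCompact isCompact_uIcc).intervalIntegrable
  have hb : ∀ x y, (∫ t in (0 : ℝ)..y, g t) - (∫ t in (0 : ℝ)..x, g t) = ∫ t in x..y, g t :=
    fun x y => intervalIntegral.integral_interval_sub_left (hii _ _) (hii _ _)
  have h0 : HasWeakDeriv (fun x => f x - ∫ t in (0 : ℝ)..x, g t) 0 := by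
    have := h.sub (hasWeakDeriv_primitive h.2.1 hb)
    simpa using! this
  obtain ⟨c, hc⟩ := h0.ae_const_of_zero
  refine ⟨fun x => c + ∫ t in (0 : ℝ)..x, g t, hc.mono fun x hx => ?_, fun x y => ?_⟩
  · dsimp at hx ⊢; linarith
  · rw [← hb]; ring

/-! ### Square integrals -/

/-- The square integral `∫ f²`. -/
noncomputable def l2sq (f : ℝ → ℝ) : ℝ := ∫ x, f x ^ 2

theorem l2sq_nonneg (f : ℝ → ℝ) : 0 ≤ l2sq f := integral_nonneg fun _ => sq_nonneg _

theorem l2sq_mono {f g : ℝ → ℝ} (hg : MemLp g 2) (h : ∀ x, |f x| ≤ |g x|) : l2sq f ≤ l2sq g :=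
  integral_mono_of_nonneg (Eventually.of_forall fun _ => sq_nonneg _) hg.integrable_sq
    (Eventually.of_forall fun x => sq_le_sq.2 (h x))

theorem l2sq_const_mul (c : ℝ) (f : ℝ → ℝ) : l2sq (fun x => c * f x) = c ^ 2 * l2sq f := by
  simp [l2sq, mul_pow, integral_const_mul]

theorem l2sq_abs (f : ℝ → ℝ) : l2sq (fun x => |f x|) = l2sq f := by simp [l2sq]

theorem l2sq_add_le {f g : ℝ → ℝ} (hf : MemLp f 2) (hg : MemLp g 2) :
    l2sq (fun x => f x + g x) ≤ 2 * l2sq f + 2 * l2sq g := by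
  unfold l2sq
  rw [← integral_const_mul, ← integral_const_mul,
    ← integral_add (hf.integrable_sq.const_mul 2) (hg.integrable_sq.const_mul 2)]
  refine integral_mono_of_nonneg (Eventually.of_forall fun _ => sq_nonneg _)
    ((hf.integrable_sq.const_mul 2).add (hg.integrable_sq.const_mul 2))
    (Eventually.of_forall fun x => ?_)
  dsimp
  nlinarith [sq_nonneg (f x - g x)]

theorem l2sq_sub_le {f g : ℝ → ℝ} (hf : MemLp f 2) (hg : MemLp g 2) :
    l2sq (fun x => f x - g x) ≤ 2 * l2sq f + 2 * l2sq g := by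
  have := l2sq_add_le hf hg.neg
  simpa [l2sq, sub_eq_add_neg] using this

theorem eLpNorm_two_sq {f : ℝ → ℝ} (hf : MemLp f 2) :
    eLpNorm f 2 volume ^ 2 = ENNReal.ofReal (l2sq f) := by
  rw [eLpNorm_eq_lintegral_rpow_enorm_toReal (by norm_num) (by norm_num),
    l2sq, ofReal_integral_eq_lintegral_ofReal hf.integrable_sq
      (Eventually.of_forall fun _ => sq_nonneg _)]
  rw [← ENNReal.rpow_natCast, ← ENNReal.rpow_mul]
  simp only [ENNReal.toReal_ofNat, Nat.cast_ofNat, one_div, isUnit_iff_ne_zero, ne_eq,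
    OfNat.ofNat_ne_zero, not_false_eq_true, IsUnit.inv_mul_cancel, ENNReal.rpow_one]
  refine lintegral_congr fun x => ?_
  rw [Real.enorm_eq_ofReal_abs, ENNReal.ofReal_rpow_of_nonneg (abs_nonneg _) (by norm_num)]
  norm_num

theorem _root_.MeasureTheory.MemLp.locallyIntegrable_two {f : ℝ → ℝ} (hf : MemLp f 2) :
    LocallyIntegrable f :=
  hf.locallyIntegrable (by norm_num)

/-- Weighted Cauchy–Schwarz inequality. -/
theorem sq_integral_mul_le {f h : ℝ → ℝ} (h0 : ∀ x, 0 ≤ h x) (hh : Integrable h)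
    (hf : Integrable fun x => f x * h x) (hf2 : Integrable fun x => f x ^ 2 * h x) :
    (∫ x, f x * h x) ^ 2 ≤ (∫ x, h x) * ∫ x, f x ^ 2 * h x := by
  -- The integral of (f - l)² h is a nonnegative quadratic polynomial in `l`; its discriminant is
  -- nonpositive.
  have key : ∀ l : ℝ, 0 ≤ (∫ x, h x) * (l * l) + (-2 * ∫ x, f x * h x) * l
      + ∫ x, f x ^ 2 * h x := by
    intro l
    have : 0 ≤ ∫ x, (f x - l) ^ 2 * h x :=
      integral_nonneg fun x => mul_nonneg (sq_nonneg _) (h0 x)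
    have e : ∀ x, (f x - l) ^ 2 * h x = f x ^ 2 * h x - 2 * l * (f x * h x) + l ^ 2 * h x :=
      fun x => by ring
    simp only [e] at this
    rw [integral_add (by exact hf2.sub (hf.const_mul _)) (hh.const_mul _),
      integral_sub hf2 (hf.const_mul _), integral_const_mul, integral_const_mul] at this
    linarith
  have := discrim_le_zero key
  unfold discrim at this
  linarith

theorem sq_integral_mul_le_l2sq {f g : ℝ → ℝ} (hf : MemLp f 2) (hg : MemLp g 2) :
    (∫ x, f x * g x) ^ 2 ≤ l2sq f * l2sq g := by
  have hfg : Integrable fun x => f x * g x := hf.integrable_mul hg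
  have key : ∀ l : ℝ, 0 ≤ l2sq g * (l * l) + (-2 * ∫ x, f x * g x) * l + l2sq f := by
    intro l
    have : 0 ≤ ∫ x, (f x - l * g x) ^ 2 := integral_nonneg fun x => sq_nonneg _
    have e : ∀ x, (f x - l * g x) ^ 2 = f x ^ 2 - 2 * l * (f x * g x) + l ^ 2 * g x ^ 2 :=
      fun x => by ring
    simp only [e] at this
    rw [integral_add (by exact hf.integrable_sq.sub (hfg.const_mul _)) (hg.integrable_sq.const_mul _),
      integral_sub hf.integrable_sq (hfg.const_mul _), integral_const_mul,
      integral_const_mul] at this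
    unfold l2sq
    linarith
  have := discrim_le_zero key
  unfold discrim at this
  linarith

theorem memLp_test {φ : ℝ → ℝ} (h : Continuous φ) (hc : HasCompactSupport φ) :
    MemLp φ 2 := h.memLp_of_hasCompactSupport hc

/-! ### Convolution in `L²` -/

theorem sq_conv_le {f g : ℝ → ℝ} (hf : MemLp f 2) (hg : IsTestFunction g) (x : ℝ) :
    conv f g x ^ 2 ≤ l2sq f * l2sq g := by
  have hr := hg.reflect x
  have := sq_integral_mul_le_l2sq hf (memLp_test hr.continuous hr.2)
  have e : l2sq (fun y => g (x - y)) = l2sq g := by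
    unfold l2sq
    exact integral_sub_left_eq_self (fun y => g y ^ 2) volume x
  rw [e] at this
  exact this

/-- Cauchy–Schwarz for the measure with density |g(x - y)|. Integrated in `x` it becomes Young's
inequality L² * L¹ ⊂ L², which is `l2sq_conv_le`. -/
theorem sq_conv_le_conv {f g : ℝ → ℝ} (hf : MemLp f 2) (hg : IsTestFunction g) (x : ℝ) :
    conv f g x ^ 2 ≤ (∫ y, |g y|) * conv (fun y => f y ^ 2) (fun y => |g y|) x := by
  have hr := hg.reflect x
  have h1 : Integrable fun y => |f y| * |g (x - y)| := by
    simpa [abs_mul] using! (integrable_mul_test hf.locallyIntegrable_two hr.continuous hr.2).abs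
  have hcabs : HasCompactSupport fun y => |g (x - y)| := hr.2.abs
  have := sq_integral_mul_le (f := fun y => |f y|) (h := fun y => |g (x - y)|)
    (fun y => abs_nonneg _) (hr.continuous.abs.integrable_of_hasCompactSupport hcabs) h1
    (by
      simp only [sq_abs]
      exact integrable_mul_test hf.integrable_sq.locallyIntegrable hr.continuous.abs hcabs)
  rw [integral_sub_left_eq_self (fun y => |g y|) volume x] at this
  simp only [sq_abs] at this
  refine le_trans (sq_le_sq.2 ?_) this
  rw [abs_of_nonneg (integral_nonneg fun y => by positivity)]
  refine (abs_integral_le_integral_abs).trans (le_of_eq ?_)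
  simp [abs_mul]

theorem l2sq_conv_le {f g : ℝ → ℝ} (hf : MemLp f 2) (hg : IsTestFunction g) :
    MemLp (conv f g) 2 ∧ l2sq (conv f g) ≤ (∫ y, |g y|) ^ 2 * l2sq f := by
  have hcg : HasCompactSupport fun y => |g y| := hg.2.abs
  have hgi : Integrable fun y => |g y| := hg.continuous.abs.integrable_of_hasCompactSupport hcg
  have hI : Integrable (conv (fun y => f y ^ 2) fun y => |g y|) := by
    rw [conv_eq_convolution]
    exact hf.integrable_sq.integrable_convolution _ hgi
  have hv : ∫ x, conv (fun y => f y ^ 2) (fun y => |g y|) x = l2sq f * ∫ y, |g y| := by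
    rw [conv_eq_convolution, integral_convolution _ hf.integrable_sq hgi]
    simp [l2sq]
  have hb := sq_conv_le_conv hf hg
  have hm : MemLp (conv f g) 2 := by
    rw [memLp_two_iff_integrable_sq
      (continuous_conv hf.locallyIntegrable_two hg).aestronglyMeasurable]
    refine (hI.const_mul (∫ y, |g y|)).mono'
      ((continuous_conv hf.locallyIntegrable_two hg).pow 2).aestronglyMeasurable
      (Eventually.of_forall fun x => ?_)
    rw [Real.norm_eq_abs, abs_of_nonneg (sq_nonneg _)]
    exact hb x
  refine ⟨hm, ?_⟩
  calc l2sq (conv f g) ≤ ∫ x, (∫ y, |g y|) * conv (fun y => f y ^ 2) (fun y => |g y|) x :=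
        integral_mono hm.integrable_sq (hI.const_mul _) hb
    _ = (∫ y, |g y|) ^ 2 * l2sq f := by rw [integral_const_mul, hv]; ring

theorem conv_add_left {f h g : ℝ → ℝ} (hf : LocallyIntegrable f) (hh : LocallyIntegrable h)
    (hg : IsTestFunction g) (x : ℝ) :
    conv (fun y => f y + h y) g x = conv f g x + conv h g x := by
  have hr := hg.reflect x
  unfold conv
  rw [← integral_add (integrable_mul_test hf hr.continuous hr.2)
    (integrable_mul_test hh hr.continuous hr.2)]
  simp only [add_mul]

theorem conv_sub_left {f h g : ℝ → ℝ} (hf : LocallyIntegrable f) (hh : LocallyIntegrable h)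
    (hg : IsTestFunction g) (x : ℝ) :
    conv (fun y => f y - h y) g x = conv f g x - conv h g x := by
  have hr := hg.reflect x
  unfold conv
  rw [← integral_sub (integrable_mul_test hf hr.continuous hr.2)
    (integrable_mul_test hh hr.continuous hr.2)]
  simp only [sub_mul]

/-! ### The mollifier -/

/-- The bump function from which the mollifier is obtained by scaling. -/
noncomputable def unitBump : ContDiffBump (0 : ℝ) := ⟨1 / 2, 1, by norm_num, by norm_num⟩

/-- The mollifier `ε⁻¹ ρ(x / ε)`. -/
noncomputable def moll (ε x : ℝ) : ℝ := ε⁻¹ * unitBump.normed volume (ε⁻¹ * x)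

theorem isTestFunction_moll {ε : ℝ} (hε : 0 < ε) : IsTestFunction (moll ε) := by
  refine ⟨contDiff_const.mul (unitBump.contDiff_normed.comp (contDiff_const.mul contDiff_id)), ?_⟩
  have h : HasCompactSupport fun x : ℝ => unitBump.normed volume (ε⁻¹ * x) :=
    unitBump.hasCompactSupport_normed.comp_homeomorph
      (Homeomorph.mulLeft₀ ε⁻¹ (inv_ne_zero hε.ne'))
  exact h.mul_left

theorem moll_nonneg {ε : ℝ} (hε : 0 < ε) (x : ℝ) : 0 ≤ moll ε x :=
  mul_nonneg (inv_nonneg.2 hε.le) (unitBump.nonneg_normed _)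

theorem integral_moll {ε : ℝ} (hε : 0 < ε) : ∫ x, moll ε x = 1 := by
  unfold moll
  rw [integral_const_mul, Measure.integral_comp_mul_left (fun x => unitBump.normed volume x) ε⁻¹,
    unitBump.integral_normed]
  simp [abs_of_pos hε, hε.ne']

theorem integral_abs_moll {ε : ℝ} (hε : 0 < ε) : ∫ x, |moll ε x| = 1 := by
  simp only [abs_of_nonneg (moll_nonneg hε _), integral_moll hε]

theorem moll_eq_zero {ε x : ℝ} (hε : 0 < ε) (hx : ε ≤ |x|) : moll ε x = 0 := by
  have : unitBump.normed volume (ε⁻¹ * x) = 0 := by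
    refine Function.notMem_support.1 fun h => ?_
    rw [unitBump.support_normed_eq] at h
    simp only [Metric.mem_ball, Real.dist_eq, sub_zero, abs_mul, abs_inv, abs_of_pos hε,
      unitBump] at h
    rw [inv_mul_lt_iff₀ hε] at h
    linarith
  simp [moll, this]

/-- The bump is constant on the inner half of its support, so at scale 2ε the mollifier dominates a
multiple of the uniform density on [-ε, ε]. Uniform averages can thus be replaced by mollifications,
for which L² bounds are available. -/
theorem exists_moll_lower : ∃ c : ℝ, 0 < c ∧ ∀ ε x : ℝ, 0 < ε → |x| ≤ ε →
    c / ε ≤ moll (2 * ε) x := by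
  refine ⟨unitBump.normed volume 0 / 2, ?_, fun ε x hε hx => ?_⟩
  · have : unitBump.normed volume 0 ≠ 0 := by
      rw [← Function.mem_support, unitBump.support_normed_eq]
      simp [unitBump]
    have h2 := unitBump.nonneg_normed (μ := volume) (0 : ℝ)
    positivity
  · have h1 : unitBump.normed volume ((2 * ε)⁻¹ * x) = unitBump.normed volume 0 := by
      unfold ContDiffBump.normed
      rw [unitBump.one_of_mem_closedBall, unitBump.one_of_mem_closedBall]
      · simp [unitBump]
      · simp only [Metric.mem_closedBall, Real.dist_eq, sub_zero, abs_mul, unitBump]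
        rw [abs_of_pos (by positivity), inv_mul_le_iff₀ (by positivity)]
        linarith
    rw [moll, h1]
    apply le_of_eq
    field_simp

theorem deriv_moll {ε : ℝ} (x : ℝ) :
    deriv (moll ε) x = ε⁻¹ * (ε⁻¹ * deriv (unitBump.normed volume) (ε⁻¹ * x)) := by
  unfold moll
  have h := ((((unitBump.contDiff_normed (μ := volume) (n := 1)).differentiable
    (by simp)) (ε⁻¹ * x)).hasDerivAt.comp x ((hasDerivAt_id x).const_mul ε⁻¹)).const_mul ε⁻¹
  simp only [mul_one, Function.comp_def] at h
  rw [h.deriv]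
  ring

theorem integral_abs_deriv_moll {ε : ℝ} (hε : 0 < ε) :
    ∫ x, |deriv (moll ε) x| = ε⁻¹ * ∫ x, |deriv (unitBump.normed volume) x| := by
  simp only [deriv_moll, abs_mul, abs_of_pos (inv_pos.2 hε)]
  rw [integral_const_mul, integral_const_mul,
    Measure.integral_comp_mul_left (fun x => |deriv (unitBump.normed volume) x|) ε⁻¹]
  simp [abs_of_pos hε, hε.ne']

theorem l2sq_conv_moll_le {f : ℝ → ℝ} (hf : MemLp f 2) {ε : ℝ} (hε : 0 < ε) :
    l2sq (conv f (moll ε)) ≤ l2sq f := by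
  have := (l2sq_conv_le hf (isTestFunction_moll hε)).2
  simpa [integral_abs_moll hε] using this

/-- A weighted average against the mollifier is bounded by bounds for the averaged function. -/
theorem abs_conv_moll_le {f : ℝ → ℝ} {ε x B : ℝ} (hε : 0 < ε) (hf : LocallyIntegrable f)
    (hB : ∀ y, |x - y| ≤ ε → |f y| ≤ B) : |conv f (moll ε) x| ≤ B := by
  have ht := isTestFunction_moll hε
  have hr := ht.reflect x
  have hi : Integrable fun y => moll ε (x - y) :=
    hr.continuous.integrable_of_hasCompactSupport hr.2
  have h1 : |conv f (moll ε) x| ≤ ∫ y, B * moll ε (x - y) := by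
    refine (abs_integral_le_integral_abs).trans (integral_mono
      (integrable_mul_test hf hr.continuous hr.2).abs (hi.const_mul B) fun y => ?_)
    dsimp
    rw [abs_mul, abs_of_nonneg (moll_nonneg hε _)]
    by_cases h : |x - y| ≤ ε
    · exact mul_le_mul_of_nonneg_right (hB y h) (moll_nonneg hε _)
    · simp [moll_eq_zero hε (not_le.1 h).le]
  rwa [integral_const_mul, integral_sub_left_eq_self (fun y => moll ε y) volume x,
    integral_moll hε, mul_one] at h1

theorem conv_const_moll {ε : ℝ} (hε : 0 < ε) (c x : ℝ) : conv (fun _ => c) (moll ε) x = c := by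
  unfold conv
  rw [integral_const_mul, integral_sub_left_eq_self (fun y => moll ε y) volume x,
    integral_moll hε, mul_one]

/-- The oscillation of a primitive at scale `ε` is bounded by an average of its derivative. -/
theorem exists_oscillation_bound : ∃ C : ℝ, 0 < C ∧ ∀ (b b' : ℝ → ℝ), LocallyIntegrable b' →
    (∀ x y, b y - b x = ∫ t in x..y, b' t) → ∀ ε x y : ℝ, 0 < ε → |x - y| ≤ ε →
    |b y - b x| ≤ C * ε * conv (fun z => |b' z|) (moll (2 * ε)) x := by
  obtain ⟨c, hc, hl⟩ := exists_moll_lower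
  refine ⟨c⁻¹, inv_pos.2 hc, fun b b' hb' hb ε x y hε hxy => ?_⟩
  have h2 : (0 : ℝ) < 2 * ε := by positivity
  have hr := (isTestFunction_moll h2).reflect x
  have hint : Integrable fun z => |b' z| * moll (2 * ε) (x - z) := by
    have := integrable_mul_test hb' hr.continuous hr.2
    simpa [abs_mul, abs_of_nonneg (moll_nonneg h2 _)] using! this.abs
  rw [hb x y]
  have hsub : Set.uIoc x y ⊆ Set.Icc (x - ε) (x + ε) := by
    intro z hz
    rw [Set.mem_uIoc] at hz
    rw [abs_le] at hxy
    rcases hz with hz | hz <;> constructor <;> linarith [hz.1, hz.2]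
  have hIc : IntegrableOn (fun z => |b' z|) (Set.Icc (x - ε) (x + ε)) :=
    (hb'.integrableOn_isCompact isCompact_Icc).abs
  calc |∫ t in x..y, b' t| ≤ ∫ t in Set.uIoc x y, |b' t| :=
        by simpa using intervalIntegral.norm_integral_le_integral_norm_uIoc (f := b') (μ := volume)
    _ ≤ ∫ t in Set.Icc (x - ε) (x + ε), |b' t| :=
        setIntegral_mono_set hIc (Eventually.of_forall fun _ => abs_nonneg _)
          (Eventually.of_forall hsub)
    _ ≤ ∫ t in Set.Icc (x - ε) (x + ε), c⁻¹ * ε * (|b' t| * moll (2 * ε) (x - t)) := by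
        refine setIntegral_mono_on hIc (hint.const_mul _).integrableOn measurableSet_Icc
          fun t ht => ?_
        have h1 : |x - t| ≤ ε := by rw [abs_le]; constructor <;> linarith [ht.1, ht.2]
        have h3 := hl ε (x - t) hε h1
        rw [div_le_iff₀ hε] at h3
        have h4 : 1 ≤ c⁻¹ * ε * moll (2 * ε) (x - t) := by
          rw [mul_assoc, le_inv_mul_iff₀ hc]; linarith
        calc |b' t| = |b' t| * 1 := (mul_one _).symm
          _ ≤ |b' t| * (c⁻¹ * ε * moll (2 * ε) (x - t)) :=
            mul_le_mul_of_nonneg_left h4 (abs_nonneg _)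
          _ = _ := by ring
    _ ≤ ∫ t, c⁻¹ * ε * (|b' t| * moll (2 * ε) (x - t)) :=
        setIntegral_le_integral (hint.const_mul _) (Eventually.of_forall fun t =>
          mul_nonneg (by positivity) (mul_nonneg (abs_nonneg _) (moll_nonneg h2 _)))
    _ = c⁻¹ * ε * conv (fun z => |b' z|) (moll (2 * ε)) x := by
        rw [integral_const_mul]; rfl

theorem abs_conv_moll_sub_le {b : ℝ → ℝ} {ε x B c : ℝ} (hε : 0 < ε)
    (hb : LocallyIntegrable b) (hB : ∀ y, |x - y| ≤ ε → |b y - c| ≤ B) :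
    |conv b (moll ε) x - c| ≤ B := by
  have := abs_conv_moll_le (f := fun y => b y - c) hε
    (hb.sub (locallyIntegrable_const c)) hB
  rwa [conv_sub_left hb (locallyIntegrable_const c) (isTestFunction_moll hε),
    conv_const_moll hε] at this

theorem IsTestFunction.primitive {g : ℝ → ℝ} (hg : IsTestFunction g) (x y : ℝ) :
    g y - g x = ∫ t in x..y, _root_.deriv g t :=
  (intervalIntegral.integral_deriv_eq_sub (fun z _ => (hg.hasDerivAt z).differentiableAt)
    (hg.deriv.continuous.intervalIntegrable _ _)).symm

theorem IsTestFunction.memLp {g : ℝ → ℝ} (hg : IsTestFunction g) : MemLp g 2 :=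
  memLp_test hg.continuous hg.2

theorem IsTestFunction.hasWeakDeriv {g : ℝ → ℝ} (hg : IsTestFunction g) :
    HasWeakDeriv g (_root_.deriv g) :=
  hasWeakDeriv_primitive hg.deriv.continuous.locallyIntegrable hg.primitive

theorem exists_test_approx {f : ℝ → ℝ} (hf : MemLp f 2) {η : ℝ} (hη : 0 < η) :
    ∃ g, IsTestFunction g ∧ l2sq (fun x => f x - g x) ≤ η := by
  obtain ⟨g, hgc, hgs, hg⟩ := MemLp.exist_eLpNorm_sub_le (p := 2) (by norm_num) (by norm_num) hf
    (Real.sqrt_pos.2 hη)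
  have ht : IsTestFunction g := ⟨hgs, hgc⟩
  refine ⟨g, ht, ?_⟩
  have h1 := eLpNorm_two_sq (hf.sub ht.memLp)
  have h2 : ENNReal.ofReal (l2sq (f - g)) ≤ ENNReal.ofReal η := by
    rw [← h1]
    calc eLpNorm (f - g) 2 volume ^ 2 ≤ ENNReal.ofReal (√η) ^ 2 := by gcongr
      _ = ENNReal.ofReal η := by
        rw [← ENNReal.ofReal_pow (Real.sqrt_nonneg _), Real.sq_sqrt hη.le]
  exact (ENNReal.ofReal_le_ofReal_iff hη.le).1 h2

/-- Approximation by a test function `g`. For `g` the error is at most a multiple of ε times an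
average of |g'|; the remainder is small in L² uniformly in ε, since mollification is a contraction
of L². -/
theorem tendsto_l2sq_conv_moll {f : ℝ → ℝ} (hf : MemLp f 2) :
    Tendsto (fun ε => l2sq (fun x => conv f (moll ε) x - f x)) (𝓝[>] 0) (𝓝 0) := by
  obtain ⟨C, hC, hosc⟩ := exists_oscillation_bound
  rw [Metric.tendsto_nhds]
  intro η hη
  -- The final count is 2 · η/8 for `g` plus 2 · 4 · η/16 for the remainder, below η.
  obtain ⟨g, hg, hgη⟩ := exists_test_approx hf (η := η / 16) (by positivity)
  have hlim : Tendsto (fun ε : ℝ => (C * ε) ^ 2 * l2sq (deriv g)) (𝓝[>] 0) (𝓝 0) := by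
    have : Tendsto (fun ε : ℝ => (C * ε) ^ 2 * l2sq (deriv g)) (𝓝 0)
        (𝓝 ((C * 0) ^ 2 * l2sq (deriv g))) := by
      apply Continuous.tendsto; fun_prop
    simpa using this.mono_left nhdsWithin_le_nhds
  filter_upwards [hlim.eventually_lt_const (show 0 < η / 8 by positivity), self_mem_nhdsWithin]
    with ε hε1 hε
  have hε : 0 < ε := hε
  have hm := isTestFunction_moll hε
  have h2 : (0 : ℝ) < 2 * ε := by positivity
  set r := fun x => f x - g x with hr
  have hrL : MemLp r 2 := hf.sub hg.memLp
  have hgL := hg.memLp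
  have h1 : l2sq (fun x => conv g (moll ε) x - g x) ≤ (C * ε) ^ 2 * l2sq (deriv g) := by
    have hA : MemLp (conv (fun z => |deriv g z|) (moll (2 * ε))) 2 :=
      (l2sq_conv_le hg.deriv.memLp.abs (isTestFunction_moll h2)).1
    calc l2sq (fun x => conv g (moll ε) x - g x)
        ≤ l2sq (fun x => C * ε * conv (fun z => |deriv g z|) (moll (2 * ε)) x) := by
          refine l2sq_mono (hA.const_mul _) fun x => ?_
          refine le_trans ?_ (le_abs_self _)
          exact abs_conv_moll_sub_le hε hg.continuous.locallyIntegrable fun y hy =>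
            hosc g (deriv g) hg.deriv.continuous.locallyIntegrable hg.primitive ε x y hε hy
      _ = (C * ε) ^ 2 * l2sq (conv (fun z => |deriv g z|) (moll (2 * ε))) := l2sq_const_mul _ _
      _ ≤ (C * ε) ^ 2 * l2sq (deriv g) := by
          have := l2sq_conv_moll_le hg.deriv.memLp.abs h2
          rw [show l2sq (|deriv g|) = l2sq (deriv g) from l2sq_abs _] at this
          exact mul_le_mul_of_nonneg_left this (sq_nonneg _)
  have hcr := l2sq_conv_le hrL hm
  have hcg := l2sq_conv_le hgL hm
  have h3 : l2sq (fun x => conv r (moll ε) x - r x) ≤ 4 * (η / 16) := by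
    have a1 := l2sq_sub_le hcr.1 hrL
    have a2 := l2sq_conv_moll_le hrL hε
    linarith
  have hsplit : (fun x => conv f (moll ε) x - f x) =
      fun x => (conv g (moll ε) x - g x) + (conv r (moll ε) x - r x) := by
    ext x
    rw [hr, conv_sub_left hf.locallyIntegrable_two hgL.locallyIntegrable_two hm]
    ring
  have h4 := l2sq_add_le (hcg.1.sub hgL) (hcr.1.sub hrL)
  rw [hsplit, Real.dist_eq, sub_zero, abs_of_nonneg (l2sq_nonneg _)]
  simp only [Pi.sub_apply] at h4
  have e1 : l2sq (conv g (moll ε) - g) = l2sq (fun x => conv g (moll ε) x - g x) := rfl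
  have e2 : l2sq (conv r (moll ε) - r) = l2sq (fun x => conv r (moll ε) x - r x) := rfl
  rw [e1, e2] at h4
  linarith

/-- The `L²` size of `ε (f * ρ_ε')` is controlled by `f`. -/
theorem exists_l2sq_conv_deriv_moll_le : ∃ C : ℝ, 0 < C ∧ ∀ f : ℝ → ℝ, MemLp f 2 →
    ∀ ε : ℝ, 0 < ε → ε ^ 2 * l2sq (conv f (deriv (moll ε))) ≤ C * l2sq f := by
  refine ⟨(∫ x, |deriv (unitBump.normed volume) x|) ^ 2 + 1, by positivity, fun f hf ε hε => ?_⟩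
  have h := (l2sq_conv_le hf (isTestFunction_moll hε).deriv).2
  rw [integral_abs_deriv_moll hε] at h
  have := l2sq_nonneg f
  calc ε ^ 2 * l2sq (conv f (deriv (moll ε)))
      ≤ ε ^ 2 * ((ε⁻¹ * ∫ x, |deriv (unitBump.normed volume) x|) ^ 2 * l2sq f) := by gcongr
    _ = (∫ x, |deriv (unitBump.normed volume) x|) ^ 2 * l2sq f := by field_simp
    _ ≤ _ := by nlinarith

/-- The uniform bound alone would give only O(1). The limit is 0 because on a dense set of test
functions the derivative can be moved off the mollifier. This gain, applied to the second derivative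
of the solution, disposes of the critical commutator term. -/
theorem tendsto_l2sq_conv_deriv_moll {f : ℝ → ℝ} (hf : MemLp f 2) :
    Tendsto (fun ε => ε ^ 2 * l2sq (conv f (deriv (moll ε)))) (𝓝[>] 0) (𝓝 0) := by
  obtain ⟨C, hC, hCb⟩ := exists_l2sq_conv_deriv_moll_le
  rw [Metric.tendsto_nhds]
  intro η hη
  obtain ⟨g, hg, hgη⟩ := exists_test_approx hf (η := η / (8 * C)) (by positivity)
  have hlim : Tendsto (fun ε : ℝ => ε ^ 2 * l2sq (deriv g)) (𝓝[>] 0) (𝓝 0) := by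
    have : Tendsto (fun ε : ℝ => ε ^ 2 * l2sq (deriv g)) (𝓝 0)
        (𝓝 (0 ^ 2 * l2sq (deriv g))) := by
      apply Continuous.tendsto; fun_prop
    simpa using this.mono_left nhdsWithin_le_nhds
  filter_upwards [hlim.eventually_lt_const (show 0 < η / 8 by positivity), self_mem_nhdsWithin]
    with ε hε1 hε
  have hε : 0 < ε := hε
  have hm := isTestFunction_moll hε
  set r := fun x => f x - g x with hr
  have hrL : MemLp r 2 := hf.sub hg.memLp
  have hgL := hg.memLp
  have h1 : l2sq (conv g (deriv (moll ε))) ≤ l2sq (deriv g) := by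
    rw [hg.hasWeakDeriv.conv_deriv hm]
    exact l2sq_conv_moll_le hg.deriv.memLp hε
  have hcr := l2sq_conv_le hrL hm.deriv
  have hcg := l2sq_conv_le hgL hm.deriv
  have hsplit : conv f (deriv (moll ε)) =
      fun x => conv g (deriv (moll ε)) x + conv r (deriv (moll ε)) x := by
    ext x
    rw [hr, conv_sub_left hf.locallyIntegrable_two hgL.locallyIntegrable_two hm.deriv]
    ring
  have h4 := l2sq_add_le hcg.1 hcr.1
  have h5 := hCb r hrL ε hε
  have h6 : C * l2sq r ≤ η / 8 := by
    calc C * l2sq r ≤ C * (η / (8 * C)) := by gcongr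
      _ = η / 8 := by field_simp
  have h0 := l2sq_nonneg (conv f (deriv (moll ε)))
  rw [Real.dist_eq, sub_zero, abs_of_nonneg (by positivity), hsplit]
  have h7 := mul_le_mul_of_nonneg_left h4 (sq_nonneg ε)
  have h8 := mul_le_mul_of_nonneg_left h1 (sq_nonneg ε)
  nlinarith

/-! ### Regular representatives of `H²` functions -/

/-- `f` is a `C¹` function whose derivative `f'` is a primitive of `f''`, all three being square
integrable. -/
structure IsH2Triple (f f' f'' : ℝ → ℝ) : Prop where
  hasDerivAt : ∀ x, HasDerivAt f (f' x) x
  cont : Continuous f'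
  memLp₀ : MemLp f 2
  memLp₁ : MemLp f' 2
  memLp₂ : MemLp f'' 2
  prim : ∀ x y, f' y - f' x = ∫ t in x..y, f'' t

/-- The squared `H²` norm of a regular representative. -/
noncomputable def h2sq (f f' f'' : ℝ → ℝ) : ℝ := l2sq f + l2sq f' + l2sq f''

theorem h2sq_nonneg (f f' f'' : ℝ → ℝ) : 0 ≤ h2sq f f' f'' :=
  add_nonneg (add_nonneg (l2sq_nonneg _) (l2sq_nonneg _)) (l2sq_nonneg _)

theorem l2sq₀_le_h2sq (f f' f'' : ℝ → ℝ) : l2sq f ≤ h2sq f f' f'' := by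
  have := l2sq_nonneg f'; have := l2sq_nonneg f''; unfold h2sq; linarith

theorem l2sq₂_le_h2sq (f f' f'' : ℝ → ℝ) : l2sq f'' ≤ h2sq f f' f'' := by
  have := l2sq_nonneg f; have := l2sq_nonneg f'; unfold h2sq; linarith

/-- The Sobolev embedding of H¹ into bounded functions: b(x) is compared with b(y) for y in [x, x +
1] by Cauchy–Schwarz, and the result is averaged in `y`. -/
theorem sq_le_of_primitive {b b' : ℝ → ℝ} (hb : MemLp b 2) (hb' : MemLp b' 2)
    (h : ∀ x y, b y - b x = ∫ t in x..y, b' t) (x : ℝ) :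
    b x ^ 2 ≤ 2 * l2sq b + 2 * l2sq b' := by
  have hle : x ≤ x + 1 := by linarith
  have key : ∀ y ∈ Set.Icc x (x + 1), b x ^ 2 ≤ 2 * b y ^ 2 + 2 * l2sq b' := by
    intro y hy
    have hi : IntegrableOn (fun t => |b' t|) (Set.Ioc x y) :=
      ((hb'.locallyIntegrable_two.integrableOn_isCompact isCompact_Icc).mono_set
        Set.Ioc_subset_Icc_self).abs
    have h1 : (b y - b x) ^ 2 ≤ l2sq b' := by
      have hm : MemLp ((Set.Ioc x y).indicator fun _ => (1 : ℝ)) 2 :=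
        memLp_indicator_const 2 measurableSet_Ioc 1 (Or.inr (by simp))
      have h2 := sq_integral_mul_le_l2sq hb' hm
      have e1 : ∫ t, b' t * (Set.Ioc x y).indicator (fun _ => (1 : ℝ)) t = b y - b x := by
        rw [h x y, intervalIntegral.integral_of_le hy.1, ← integral_indicator measurableSet_Ioc]
        congr 1
        ext t
        by_cases ht : t ∈ Set.Ioc x y <;> simp [ht]
      have e2 : l2sq ((Set.Ioc x y).indicator fun _ => (1 : ℝ)) = y - x := by
        unfold l2sq
        have : ∀ t, ((Set.Ioc x y).indicator (fun _ => (1 : ℝ)) t) ^ 2 =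
            (Set.Ioc x y).indicator (fun _ => (1 : ℝ)) t := by
          intro t
          by_cases ht : t ∈ Set.Ioc x y <;> simp [ht]
        simp only [this]
        rw [integral_indicator measurableSet_Ioc]
        simp [hy.1]
      rw [e1, e2] at h2
      have := l2sq_nonneg b'
      nlinarith [hy.1, hy.2]
    nlinarith [sq_nonneg (b x - 2 * b y)]
  have hc : ∫ y in x..(x + 1), b x ^ 2 = b x ^ 2 := by simp
  have hb2 : IntervalIntegrable (fun y => 2 * b y ^ 2) volume x (x + 1) :=
    (hb.integrable_sq.const_mul 2).intervalIntegrable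
  have h3 : ∫ y in x..(x + 1), b x ^ 2 ≤ ∫ y in x..(x + 1), (2 * b y ^ 2 + 2 * l2sq b') :=
    intervalIntegral.integral_mono_on hle intervalIntegrable_const
      (hb2.add intervalIntegrable_const) key
  rw [hc, intervalIntegral.integral_add hb2 intervalIntegrable_const,
    intervalIntegral.integral_of_le hle] at h3
  have h4 : ∫ y in Set.Ioc x (x + 1), 2 * b y ^ 2 ≤ ∫ y, 2 * b y ^ 2 :=
    setIntegral_le_integral (hb.integrable_sq.const_mul 2)
      (Eventually.of_forall fun y => by positivity)
  simp only [integral_const_mul] at h3 h4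
  simp only [intervalIntegral.integral_const, add_sub_cancel_left, smul_eq_mul, one_mul] at h3
  unfold l2sq at *
  linarith

namespace IsH2Triple

variable {f f' f'' g g' g'' : ℝ → ℝ}

theorem continuous (h : IsH2Triple f f' f'') : Continuous f :=
  continuous_iff_continuousAt.2 fun x => (h.hasDerivAt x).continuousAt

theorem prim₀ (h : IsH2Triple f f' f'') (x y : ℝ) : f y - f x = ∫ t in x..y, f' t :=
  (intervalIntegral.integral_eq_sub_of_hasDerivAt (fun z _ => h.hasDerivAt z)
    (h.cont.intervalIntegrable _ _)).symm

theorem weak₀ (h : IsH2Triple f f' f'') : HasWeakDeriv f f' :=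
  hasWeakDeriv_primitive h.memLp₁.locallyIntegrable_two h.prim₀

theorem weak₁ (h : IsH2Triple f f' f'') : HasWeakDeriv f' f'' :=
  hasWeakDeriv_primitive h.memLp₂.locallyIntegrable_two h.prim

theorem weakDeriv_ae (h : IsH2Triple f f' f'') : weakDeriv f =ᵐ[volume] f' :=
  h.weak₀.weakDeriv_ae

theorem weakDeriv₂_ae (h : IsH2Triple f f' f'') : weakDeriv (weakDeriv f) =ᵐ[volume] f'' := by
  rw [weakDeriv_congr h.weakDeriv_ae]
  exact h.weak₁.weakDeriv_ae

theorem sq_le (h : IsH2Triple f f' f'') (x : ℝ) : f x ^ 2 ≤ 2 * h2sq f f' f'' := by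
  have := sq_le_of_primitive h.memLp₀ h.memLp₁ h.prim₀ x
  have := l2sq_nonneg f''
  unfold h2sq; linarith

theorem sq_deriv_le (h : IsH2Triple f f' f'') (x : ℝ) : f' x ^ 2 ≤ 2 * h2sq f f' f'' := by
  have := sq_le_of_primitive h.memLp₁ h.memLp₂ h.prim x
  have := l2sq_nonneg f
  unfold h2sq; linarith

theorem abs_le (h : IsH2Triple f f' f'') {B : ℝ} (hB0 : 0 ≤ B) (hB : 2 * h2sq f f' f'' ≤ B ^ 2)
    (x : ℝ) : |f x| ≤ B :=
  abs_le_of_sq_le_sq ((h.sq_le x).trans hB) hB0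

theorem abs_deriv_le (h : IsH2Triple f f' f'') {B : ℝ} (hB0 : 0 ≤ B)
    (hB : 2 * h2sq f f' f'' ≤ B ^ 2) (x : ℝ) : |f' x| ≤ B :=
  abs_le_of_sq_le_sq ((h.sq_deriv_le x).trans hB) hB0

theorem of_hasDerivAt (h1 : ∀ x, HasDerivAt f (f' x) x) (h2 : ∀ x, HasDerivAt f' (f'' x) x)
    (h3 : Continuous f'') (m0 : MemLp f 2) (m1 : MemLp f' 2) (m2 : MemLp f'' 2) :
    IsH2Triple f f' f'' where
  hasDerivAt := h1
  cont := continuous_iff_continuousAt.2 fun x => (h2 x).continuousAt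
  memLp₀ := m0
  memLp₁ := m1
  memLp₂ := m2
  prim _ _ := (intervalIntegral.integral_eq_sub_of_hasDerivAt (fun z _ => h2 z)
    (h3.intervalIntegrable _ _)).symm

theorem intervalIntegrable (h : IsH2Triple f f' f'') (x y : ℝ) :
    IntervalIntegrable f'' volume x y :=
  (h.memLp₂.locallyIntegrable_two.integrableOn_isCompact isCompact_uIcc).intervalIntegrable

theorem add (h : IsH2Triple f f' f'') (k : IsH2Triple g g' g'') :
    IsH2Triple (fun x => f x + g x) (fun x => f' x + g' x) (fun x => f'' x + g'' x) where
  hasDerivAt x := (h.hasDerivAt x).add (k.hasDerivAt x)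
  cont := h.cont.add k.cont
  memLp₀ := h.memLp₀.add k.memLp₀
  memLp₁ := h.memLp₁.add k.memLp₁
  memLp₂ := h.memLp₂.add k.memLp₂
  prim x y := by
    rw [intervalIntegral.integral_add (h.intervalIntegrable x y) (k.intervalIntegrable x y),
      ← h.prim, ← k.prim]
    ring

theorem sub (h : IsH2Triple f f' f'') (k : IsH2Triple g g' g'') :
    IsH2Triple (fun x => f x - g x) (fun x => f' x - g' x) (fun x => f'' x - g'' x) where
  hasDerivAt x := (h.hasDerivAt x).sub (k.hasDerivAt x)
  cont := h.cont.sub k.cont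
  memLp₀ := h.memLp₀.sub k.memLp₀
  memLp₁ := h.memLp₁.sub k.memLp₁
  memLp₂ := h.memLp₂.sub k.memLp₂
  prim x y := by
    rw [intervalIntegral.integral_sub (h.intervalIntegrable x y) (k.intervalIntegrable x y),
      ← h.prim, ← k.prim]
    ring

theorem zero : IsH2Triple (fun _ => 0) (fun _ => 0) (fun _ => 0) :=
  of_hasDerivAt (fun x => hasDerivAt_const x 0) (fun x => hasDerivAt_const x 0) continuous_const
    MemLp.zero MemLp.zero MemLp.zero

theorem sum {ι : Type*} (s : Finset ι) {F F' F'' : ι → ℝ → ℝ}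
    (h : ∀ i ∈ s, IsH2Triple (F i) (F' i) (F'' i)) :
    IsH2Triple (fun x => ∑ i ∈ s, F i x) (fun x => ∑ i ∈ s, F' i x)
      (fun x => ∑ i ∈ s, F'' i x) := by
  classical
  induction s using Finset.induction_on with
  | empty => simpa using zero
  | insert a s ha ih =>
    simp only [Finset.sum_insert ha]
    exact (h a (Finset.mem_insert_self a s)).add
      (ih fun i hi => h i (Finset.mem_insert_of_mem hi))

theorem h2Norm_eq (h : IsH2Triple f f' f'') :
    h2Norm f = ENNReal.ofReal (h2sq f f' f'') ^ (1 / 2 : ℝ) := by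
  unfold h2Norm h2sq
  rw [eLpNorm_congr_ae h.weakDeriv_ae, eLpNorm_congr_ae h.weakDeriv₂_ae,
    eLpNorm_two_sq h.memLp₀, eLpNorm_two_sq h.memLp₁, eLpNorm_two_sq h.memLp₂,
    ← ENNReal.ofReal_add (l2sq_nonneg _) (l2sq_nonneg _),
    ← ENNReal.ofReal_add (add_nonneg (l2sq_nonneg _) (l2sq_nonneg _)) (l2sq_nonneg _)]

end IsH2Triple

theorem h2Norm_congr {f g : ℝ → ℝ} (h : f =ᵐ[volume] g) : h2Norm f = h2Norm g := by
  unfold h2Norm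
  rw [weakDeriv_congr h, eLpNorm_congr_ae h]

theorem tendsto_h2sq {ι : Type*} {l : Filter ι} {F : ι → ℝ → ℝ} {f f' f'' : ι → ℝ → ℝ}
    (h : ∀ᶠ i in l, IsH2Triple (f i) (f' i) (f'' i)) (hF : ∀ᶠ i in l, F i =ᵐ[volume] f i)
    (ht : Tendsto (fun i => h2Norm (F i)) l (𝓝 0)) :
    Tendsto (fun i => h2sq (f i) (f' i) (f'' i)) l (𝓝 0) := by
  have h1 : Tendsto (fun i => ENNReal.ofReal (h2sq (f i) (f' i) (f'' i)) ^ (1 / 2 : ℝ)) l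
      (𝓝 0) := by
    refine ht.congr' ?_
    filter_upwards [h, hF] with i hi hFi
    rw [h2Norm_congr hFi, hi.h2Norm_eq]
  have h2 := (ENNReal.continuous_rpow_const (y := (2 : ℝ))).tendsto 0 |>.comp h1
  simp only [Function.comp_def, ← ENNReal.rpow_mul] at h2
  norm_num at h2
  have h3 := (ENNReal.tendsto_toReal ENNReal.zero_ne_top).comp h2
  simpa [Function.comp_def, ENNReal.toReal_ofReal (h2sq_nonneg _ _ _)] using h3

/-- Two successive primitives, of `k` and then of the continuous representative of `g`, give a
genuinely C¹ representative. Pointwise estimates are made on it from here on. -/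
theorem MemH2.exists_triple {f : ℝ → ℝ} (h : MemH2 f) :
    ∃ u u' u'' : ℝ → ℝ, IsH2Triple u u' u'' ∧ f =ᵐ[volume] u := by
  obtain ⟨hf, g, k, hg, hk, hgL, hkL⟩ := h
  obtain ⟨b, hgb, hb⟩ := hk.exists_primitive
  obtain ⟨a, hfa, ha⟩ := hg.exists_primitive
  have hbc : Continuous b := by
    have hfun : b = fun x => b 0 + ∫ t in (0 : ℝ)..x, k t := by
      ext x; rw [← hb 0 x]; ring
    rw [hfun]
    exact continuous_const.add (intervalIntegral.continuous_primitive
      (fun x y => (hk.2.1.integrableOn_isCompact isCompact_uIcc).intervalIntegrable) 0)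
  have hab : ∀ x y, a y - a x = ∫ t in x..y, b t := fun x y => by
    rw [ha x y]
    exact intervalIntegral.integral_congr_ae (hgb.mono fun x hx _ => hx)
  refine ⟨a, b, k, ⟨fun x => ?_, hbc, hf.ae_eq hfa, hgL.ae_eq hgb, hkL, hb⟩, hfa⟩
  have hfun : a = fun x => a 0 + ∫ t in (0 : ℝ)..x, b t := by
    ext x; rw [← hab 0 x]; ring
  rw [hfun]
  exact (intervalIntegral.integral_hasDerivAt_right (hbc.intervalIntegrable _ _)
    (hbc.stronglyMeasurableAtFilter _ _) hbc.continuousAt).const_add _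

/-! ### The nonlinearity -/

/-- The product `a φ` is a C¹ function of compact support, so the primitive `b` can be tested
against it. -/
theorem hasWeakDeriv_mul {a a' b b' : ℝ → ℝ} (ha : ∀ x, HasDerivAt a (a' x) x)
    (ha' : Continuous a') (hbc : Continuous b) (hb' : LocallyIntegrable b')
    (hb : ∀ x y, b y - b x = ∫ t in x..y, b' t) :
    HasWeakDeriv (fun x => a x * b x) (fun x => a' x * b x + a x * b' x) := by
  have hac : Continuous a := continuous_iff_continuousAt.2 fun x => (ha x).continuousAt
  have hab' : LocallyIntegrable fun x => a x * b' x := by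
    simpa [mul_comm] using! hb'.smul_continuous hac
  refine ⟨(hac.mul hbc).locallyIntegrable, (ha'.mul hbc).locallyIntegrable.add hab',
    fun φ hφ => ?_⟩
  have h1 := integral_primitive_mul_deriv hb' hb (ψ := fun x => a x * φ x)
    (ψ' := fun x => a' x * φ x + a x * deriv φ x) (fun x => (ha x).mul (hφ.hasDerivAt x))
    ((ha'.mul hφ.continuous).add (hac.mul hφ.deriv.continuous)) hφ.2.mul_left
  have i1 : Integrable fun x => a' x * b x * φ x :=
    integrable_mul_test (ha'.mul hbc).locallyIntegrable hφ.continuous hφ.2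
  have i2 : Integrable fun x => a x * b x * deriv φ x :=
    integrable_mul_test (hac.mul hbc).locallyIntegrable hφ.deriv.continuous hφ.deriv.2
  have i3 : Integrable fun x => a x * b' x * φ x := integrable_mul_test hab' hφ.continuous hφ.2
  have e1 : ∫ x, b x * (a' x * φ x + a x * deriv φ x) =
      (∫ x, a' x * b x * φ x) + ∫ x, a x * b x * deriv φ x := by
    rw [← integral_add i1 i2]; congr 1; ext x; ring
  have e2 : ∫ x, b' x * (a x * φ x) = ∫ x, a x * b' x * φ x := by congr 1; ext x; ring
  have e3 : ∫ x, (a' x * b x + a x * b' x) * φ x =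
      (∫ x, a' x * b x * φ x) + ∫ x, a x * b' x * φ x := by
    rw [← integral_add i1 i3]; congr 1; ext x; ring
  rw [e1, e2] at h1
  rw [e3]
  linarith

theorem memLp_bdd_mul {a b : ℝ → ℝ} (ha : AEStronglyMeasurable a) {B : ℝ} (hB : ∀ x, |a x| ≤ B)
    (hb : MemLp b 2) : MemLp (fun x => a x * b x) 2 := by
  refine (hb.const_mul B).mono (ha.mul hb.aestronglyMeasurable) (Eventually.of_forall fun x => ?_)
  have hB0 : 0 ≤ B := (abs_nonneg _).trans (hB x)
  simp only [norm_mul, Real.norm_eq_abs, abs_of_nonneg hB0]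
  exact mul_le_mul_of_nonneg_right (hB x) (abs_nonneg _)

namespace IsH2Triple

variable {u u₁ u₂ : ℝ → ℝ}

theorem exists_bound (h : IsH2Triple u u₁ u₂) :
    ∃ B : ℝ, 0 ≤ B ∧ (∀ x, |u x| ≤ B) ∧ ∀ x, |u₁ x| ≤ B := by
  have h0 := h2sq_nonneg u u₁ u₂
  have hs : 2 * h2sq u u₁ u₂ ≤ (√(2 * h2sq u u₁ u₂)) ^ 2 :=
    (Real.sq_sqrt (by positivity)).ge
  exact ⟨_, Real.sqrt_nonneg _, h.abs_le (Real.sqrt_nonneg _) hs,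
    h.abs_deriv_le (Real.sqrt_nonneg _) hs⟩

theorem memLp_cube (h : IsH2Triple u u₁ u₂) : MemLp (fun x => u x ^ 3) 2 := by
  obtain ⟨B, hB, h0, h1⟩ := h.exists_bound
  have := memLp_bdd_mul (a := fun x => u x ^ 2) (h.continuous.pow 2).aestronglyMeasurable
    (B := B ^ 2) (fun x => by rw [abs_pow]; gcongr; exact h0 x) h.memLp₀
  exact (memLp_congr_ae (Eventually.of_forall fun x => by ring)).1 this

theorem memLp_cube₁ (h : IsH2Triple u u₁ u₂) : MemLp (fun x => 3 * u x ^ 2 * u₁ x) 2 := by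
  obtain ⟨B, hB, h0, h1⟩ := h.exists_bound
  exact memLp_bdd_mul (a := fun x => 3 * u x ^ 2)
    (continuous_const.mul (h.continuous.pow 2)).aestronglyMeasurable
    (B := 3 * B ^ 2) (fun x => by
      rw [abs_mul, abs_pow, abs_of_nonneg (show (0 : ℝ) ≤ 3 by norm_num)]
      gcongr; exact h0 x) h.memLp₁

theorem memLp_cube₂ (h : IsH2Triple u u₁ u₂) :
    MemLp (fun x => 6 * u x * u₁ x * u₁ x + 3 * u x ^ 2 * u₂ x) 2 := by
  obtain ⟨B, hB, h0, h1⟩ := h.exists_bound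
  refine MemLp.add ?_ ?_
  · refine memLp_bdd_mul (a := fun x => 6 * u x * u₁ x)
      ((continuous_const.mul h.continuous).mul h.cont).aestronglyMeasurable
      (B := 6 * B * B) (fun x => ?_) h.memLp₁
    rw [abs_mul, abs_mul, abs_of_nonneg (show (0 : ℝ) ≤ 6 by norm_num)]
    gcongr
    exacts [h0 x, h1 x]
  · exact memLp_bdd_mul (a := fun x => 3 * u x ^ 2)
      (continuous_const.mul (h.continuous.pow 2)).aestronglyMeasurable
      (B := 3 * B ^ 2) (fun x => by
        rw [abs_mul, abs_pow, abs_of_nonneg (show (0 : ℝ) ≤ 3 by norm_num)]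
        gcongr; exact h0 x) h.memLp₂

theorem weak_cube (h : IsH2Triple u u₁ u₂) :
    HasWeakDeriv (fun x => u x ^ 3) (fun x => 3 * u x ^ 2 * u₁ x) := by
  have hc : Continuous fun x => 3 * u x ^ 2 * u₁ x :=
    (continuous_const.mul (h.continuous.pow 2)).mul h.cont
  refine hasWeakDeriv_primitive hc.locallyIntegrable fun x y => ?_
  refine (intervalIntegral.integral_eq_sub_of_hasDerivAt (f := fun z => u z ^ 3)
    (fun z _ => ?_) (hc.intervalIntegrable _ _)).symm
  simpa using (h.hasDerivAt z).fun_pow 3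

theorem weak_cube₁ (h : IsH2Triple u u₁ u₂) :
    HasWeakDeriv (fun x => 3 * u x ^ 2 * u₁ x)
      (fun x => 6 * u x * u₁ x * u₁ x + 3 * u x ^ 2 * u₂ x) := by
  refine hasWeakDeriv_mul (a := fun x => 3 * u x ^ 2) (a' := fun x => 6 * u x * u₁ x)
    (fun x => ?_) ((continuous_const.mul h.continuous).mul h.cont) h.cont
    h.memLp₂.locallyIntegrable_two h.prim
  have := ((h.hasDerivAt x).pow 2).const_mul 3
  convert! this using 1
  simp; ring

end IsH2Triple

/-! ### The localized functional: algebra -/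

/-- The density of the functional `F + A E + D M`. -/
noncomputable def dens (A D w₀ w₁ w₂ : ℝ) : ℝ :=
  1 / 2 * w₂ ^ 2 - 5 / 2 * w₀ ^ 2 * w₁ ^ 2 + 1 / 4 * w₀ ^ 6 +
    A * (1 / 2 * w₁ ^ 2 - 1 / 4 * w₀ ^ 4) + D * (1 / 2 * w₀ ^ 2)

/-- The variation of the density in the direction `(W, W₁, W₂)`. -/
noncomputable def densVar (A D w₀ w₁ w₂ W W₁ W₂ : ℝ) : ℝ :=
  w₂ * W₂ - 5 * w₀ * w₁ ^ 2 * W - 5 * w₀ ^ 2 * w₁ * W₁ + 3 / 2 * w₀ ^ 5 * W +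
    A * (w₁ * W₁ - w₀ ^ 3 * W) + D * (w₀ * W)

theorem abs_mul_mul_le {a b y S η B : ℝ} (ha : |a| ≤ η) (hb : |b| ≤ B) (hy : |y| ≤ S) :
    |a * b * y| ≤ η * B * S := by
  rw [abs_mul, abs_mul]
  have h1 := (abs_nonneg a).trans ha
  have h2 := (abs_nonneg b).trans hb
  exact mul_le_mul (mul_le_mul ha hb (abs_nonneg _) h1) hy (abs_nonneg _) (mul_nonneg h1 h2)

theorem abs_six_le (a b c d e f : ℝ) :
    |a - b + c + d - e - f| ≤ |a| + |b| + |c| + |d| + |e| + |f| := by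
  have h1 := abs_sub (a - b + c + d - e) f
  have h2 := abs_sub (a - b + c + d) e
  have h3 := abs_add_le (a - b + c) d
  have h4 := abs_add_le (a - b) c
  have h5 := abs_sub a b
  linarith

/-- The nonlinear part of the flux is cubic. -/
theorem abs_flux_le {A D m B w₀ w₁ w₂ p p₁ : ℝ} (hB : 1 ≤ B) (h0 : |w₀| ≤ B) (h1 : |w₁| ≤ B)
    (hp : 0 ≤ p) (hp1 : |p₁| ≤ p) :
    |(-15 * w₀ * w₁ ^ 2 * w₂ - 9 * w₀ ^ 2 * w₂ ^ 2 + 45 / 4 * w₀ ^ 4 * w₁ ^ 2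
        - 3 / 2 * w₀ ^ 5 * w₂ - 1 / 4 * w₁ ^ 4 - 9 / 16 * w₀ ^ 8) * p
      - 5 * w₀ ^ 2 * w₁ * w₂ * p₁ + m * (-5 / 2 * w₀ ^ 2 * w₁ ^ 2 + 1 / 4 * w₀ ^ 6) * p
      + A * (w₂ * w₀ ^ 3 + 1 / 2 * w₀ ^ 6 - 3 * w₀ ^ 2 * w₁ ^ 2) * p - A * m * (1 / 4 * w₀ ^ 4) * p
      - D * (3 / 4 * w₀ ^ 4) * p|
    ≤ B ^ 5 * (50 + 4 * |m| + 6 * |A| + |A * m| + |D|) * ((|w₀| + |w₁|) *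
        (w₀ ^ 2 + w₁ ^ 2 + w₂ ^ 2) * p) := by
  set η := |w₀| + |w₁| with hη
  set S := w₀ ^ 2 + w₁ ^ 2 + w₂ ^ 2 with hS
  have e0 : |w₀| ≤ η := by linarith [abs_nonneg w₁]
  have e1 : |w₁| ≤ η := by linarith [abs_nonneg w₀]
  have hη0 : 0 ≤ η := (abs_nonneg _).trans e0
  have hB0 : 0 ≤ B := by linarith
  have q00 : |w₀ ^ 2| ≤ S := by rw [abs_of_nonneg (sq_nonneg _)]; nlinarith
  have q11 : |w₁ ^ 2| ≤ S := by rw [abs_of_nonneg (sq_nonneg _)]; nlinarith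
  have q22 : |w₂ ^ 2| ≤ S := by rw [abs_of_nonneg (sq_nonneg _)]; nlinarith
  have q12 : |w₁ * w₂| ≤ S := by
    rw [abs_le]; constructor <;> nlinarith [sq_nonneg (w₁ + w₂), sq_nonneg (w₁ - w₂)]
  have q02 : |w₀ * w₂| ≤ S := by
    rw [abs_le]; constructor <;> nlinarith [sq_nonneg (w₀ + w₂), sq_nonneg (w₀ - w₂)]
  have hS0 : 0 ≤ S := by positivity
  have b1 : B ≤ B ^ 5 := le_self_pow₀ hB (by norm_num)
  have pw : ∀ n : ℕ, n ≤ 5 → |w₀ ^ n| ≤ B ^ 5 := fun n hn => by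
    rw [abs_pow]; exact (pow_le_pow_left₀ (abs_nonneg _) h0 n).trans (pow_le_pow_right₀ hB hn)
  -- Every monomial is split into three factors: one of `w₀`, `w₁`, bounded by `η`; a power bounded
  -- by `B ^ 5`; and a quadratic expression bounded by `S`.
  have c1 := abs_mul_mul_le e0 (h1.trans b1) q12
  have c2 := abs_mul_mul_le e0 (h0.trans b1) q22
  have c3 := abs_mul_mul_le e0 (pw 3 (by norm_num)) q11
  have c4 := abs_mul_mul_le e0 (pw 3 (by norm_num)) q02
  have c5 := abs_mul_mul_le e1 (h1.trans b1) q11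
  have c6 := abs_mul_mul_le e0 (pw 5 (by norm_num)) q00
  have c7 := abs_mul_mul_le e0 (h0.trans b1) q12
  have c8 := abs_mul_mul_le e0 (h0.trans b1) q11
  have c9 := abs_mul_mul_le e0 (pw 3 (by norm_num)) q00
  have c10 := abs_mul_mul_le e0 (h0.trans b1) q02
  have c11 := abs_mul_mul_le e0 (h0.trans b1) q00
  set X := η * B ^ 5 * S with hX
  have hX0 : 0 ≤ X := by positivity
  have hR : B ^ 5 * (50 + 4 * |m| + 6 * |A| + |A * m| + |D|) * (η * S * p) =
      (44 * X) * p + 5 * X * p + (4 * |m| * X + |A| * (6 * X) + |A * m| * X + |D| * X + X) * p := by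
    rw [hX]; ring
  rw [hR]
  have t1 : |-15 * w₀ * w₁ ^ 2 * w₂ - 9 * w₀ ^ 2 * w₂ ^ 2 + 45 / 4 * w₀ ^ 4 * w₁ ^ 2
        - 3 / 2 * w₀ ^ 5 * w₂ - 1 / 4 * w₁ ^ 4 - 9 / 16 * w₀ ^ 8| ≤ 44 * X := by
    rw [show -15 * w₀ * w₁ ^ 2 * w₂ - 9 * w₀ ^ 2 * w₂ ^ 2 + 45 / 4 * w₀ ^ 4 * w₁ ^ 2
        - 3 / 2 * w₀ ^ 5 * w₂ - 1 / 4 * w₁ ^ 4 - 9 / 16 * w₀ ^ 8 =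
      -15 * (w₀ * w₁ * (w₁ * w₂)) - 9 * (w₀ * w₀ * w₂ ^ 2) + 45 / 4 * (w₀ * w₀ ^ 3 * w₁ ^ 2)
        - 3 / 2 * (w₀ * w₀ ^ 3 * (w₀ * w₂)) - 1 / 4 * (w₁ * w₁ * w₁ ^ 2)
        - 9 / 16 * (w₀ * w₀ ^ 5 * w₀ ^ 2) by ring]
    rw [abs_le] at c1 c2 c3 c4 c5 c6 ⊢
    constructor <;> linarith [c1.1, c1.2, c2.1, c2.2, c3.1, c3.2, c4.1, c4.2, c5.1, c5.2, c6.1,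
      c6.2]
  have t2 : |5 * w₀ ^ 2 * w₁ * w₂| ≤ 5 * X := by
    rw [show 5 * w₀ ^ 2 * w₁ * w₂ = 5 * (w₀ * w₀ * (w₁ * w₂)) by ring, abs_mul]
    rw [show |(5 : ℝ)| = 5 by norm_num]
    linarith
  have t3 : |-5 / 2 * w₀ ^ 2 * w₁ ^ 2 + 1 / 4 * w₀ ^ 6| ≤ 4 * X := by
    rw [show -5 / 2 * w₀ ^ 2 * w₁ ^ 2 + 1 / 4 * w₀ ^ 6 =
      -5 / 2 * (w₀ * w₀ * w₁ ^ 2) + 1 / 4 * (w₀ * w₀ ^ 3 * w₀ ^ 2) by ring]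
    rw [abs_le] at c8 c9 ⊢
    constructor <;> linarith [c8.1, c8.2, c9.1, c9.2]
  have t4 : |w₂ * w₀ ^ 3 + 1 / 2 * w₀ ^ 6 - 3 * w₀ ^ 2 * w₁ ^ 2| ≤ 6 * X := by
    rw [show w₂ * w₀ ^ 3 + 1 / 2 * w₀ ^ 6 - 3 * w₀ ^ 2 * w₁ ^ 2 =
      (w₀ * w₀ * (w₀ * w₂)) + 1 / 2 * (w₀ * w₀ ^ 3 * w₀ ^ 2) - 3 * (w₀ * w₀ * w₁ ^ 2) by ring]
    rw [abs_le] at c8 c9 c10 ⊢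
    constructor <;> linarith [c8.1, c8.2, c9.1, c9.2, c10.1, c10.2]
  have t5 : |1 / 4 * w₀ ^ 4| ≤ X := by
    rw [show 1 / 4 * w₀ ^ 4 = 1 / 4 * (w₀ * w₀ * w₀ ^ 2) by ring]
    rw [abs_le] at c11 ⊢
    constructor <;> linarith [c11.1, c11.2]
  have t6 : |3 / 4 * w₀ ^ 4| ≤ X := by
    rw [show 3 / 4 * w₀ ^ 4 = 3 / 4 * (w₀ * w₀ * w₀ ^ 2) by ring]
    rw [abs_le] at c11 ⊢
    constructor <;> linarith [c11.1, c11.2]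
  have f1 : ∀ {a b : ℝ}, |a| ≤ b → |a * p| ≤ b * p := fun h => by
    rw [abs_mul, abs_of_nonneg hp]; gcongr
  have g2 : |5 * w₀ ^ 2 * w₁ * w₂ * p₁| ≤ 5 * X * p := by rw [abs_mul]; gcongr
  have g1 := f1 t1
  have g3 : |m * (-5 / 2 * w₀ ^ 2 * w₁ ^ 2 + 1 / 4 * w₀ ^ 6) * p| ≤ |m| * (4 * X) * p :=
    f1 (by rw [abs_mul]; gcongr)
  have g4 : |A * (w₂ * w₀ ^ 3 + 1 / 2 * w₀ ^ 6 - 3 * w₀ ^ 2 * w₁ ^ 2) * p| ≤ |A| * (6 * X) * p :=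
    f1 (by rw [abs_mul]; gcongr)
  have g5 : |A * m * (1 / 4 * w₀ ^ 4) * p| ≤ |A * m| * X * p :=
    f1 (by rw [abs_mul (A * m)]; gcongr)
  have g6 : |D * (3 / 4 * w₀ ^ 4) * p| ≤ |D| * X * p := f1 (by rw [abs_mul]; gcongr)
  have hXp : 0 ≤ X * p := by positivity
  refine (abs_six_le _ _ _ _ _ _).trans ?_
  linarith

/-- The commutator terms. -/
theorem abs_comm_le {A D B w₀ w₁ w₂ N₁ N₂ P p : ℝ} (hB : 1 ≤ B) (h0 : |w₀| ≤ B) (h1 : |w₁| ≤ B)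
    (hP : 0 ≤ P) (hP1 : P ≤ 1) (hp : 0 ≤ p) (hp1 : p ≤ 1) :
    |-w₂ * N₂ * p + 5 * w₀ ^ 2 * w₁ * N₁ * p
      - (5 * w₀ ^ 2 * w₂ + 5 * w₀ * w₁ ^ 2 + 3 / 2 * w₀ ^ 5) * N₁ * P
      + A * ((w₂ + w₀ ^ 3) * N₁ * P - w₁ * N₁ * p) - D * (w₀ * N₁ * P)|
    ≤ B ^ 4 * (18 + 3 * |A| + |D|) * ((|w₀| + |w₁| + |w₂|) * (|N₁| + |N₂|)) := by
  set η := |w₀| + |w₁| + |w₂| with hη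
  set N := |N₁| + |N₂| with hN
  have a0 := abs_nonneg w₀
  have a1 := abs_nonneg w₁
  have a2 := abs_nonneg w₂
  have n1 := abs_nonneg N₁
  have n2 := abs_nonneg N₂
  have e0 : |w₀| ≤ η := by linarith
  have e1 : |w₁| ≤ η := by linarith
  have e2 : |w₂| ≤ η := by linarith
  have hη0 : 0 ≤ η := by linarith
  have hN0 : 0 ≤ N := by linarith
  have hB0 : 0 ≤ B := by linarith
  have pw : ∀ n : ℕ, n ≤ 4 → |w₀ ^ n| ≤ B ^ 4 := fun n hn => by
    rw [abs_pow]; exact (pow_le_pow_left₀ (abs_nonneg _) h0 n).trans (pow_le_pow_right₀ hB hn)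
  have pw1 : |w₁ ^ 2| ≤ B ^ 4 := by
    rw [abs_pow]
    exact (pow_le_pow_left₀ (abs_nonneg _) h1 2).trans (pow_le_pow_right₀ hB (by norm_num))
  have one : |(1 : ℝ)| ≤ B ^ 4 := by rw [abs_one]; exact one_le_pow₀ hB
  have d1 : |N₁ * P| ≤ N := by
    rw [abs_mul, abs_of_nonneg hP]; nlinarith
  have d1' : |N₁ * p| ≤ N := by
    rw [abs_mul, abs_of_nonneg hp]; nlinarith
  have d2 : |N₂ * p| ≤ N := by
    rw [abs_mul, abs_of_nonneg hp]; nlinarith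
  have c1 := abs_mul_mul_le e2 one d2
  have c2 := abs_mul_mul_le e1 (pw 2 (by norm_num)) d1'
  have c3 := abs_mul_mul_le e2 (pw 2 (by norm_num)) d1
  have c4 := abs_mul_mul_le e0 pw1 d1
  have c5 := abs_mul_mul_le e0 (pw 4 (by norm_num)) d1
  have c6 := abs_mul_mul_le e2 one d1
  have c7 := abs_mul_mul_le e0 (pw 2 (by norm_num)) d1
  have c8 := abs_mul_mul_le e1 one d1'
  have c9 := abs_mul_mul_le e0 one d1
  set X := η * B ^ 4 * N with hX
  have hX0 : 0 ≤ X := by positivity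
  have hR : B ^ 4 * (18 + 3 * |A| + |D|) * (η * N) = 18 * X + |A| * (3 * X) + |D| * X := by
    rw [hX]; ring
  rw [hR]
  have t2 : |(w₂ + w₀ ^ 3) * N₁ * P - w₁ * N₁ * p| ≤ 3 * X := by
    rw [show (w₂ + w₀ ^ 3) * N₁ * P - w₁ * N₁ * p =
      w₂ * 1 * (N₁ * P) + w₀ * w₀ ^ 2 * (N₁ * P) - w₁ * 1 * (N₁ * p) by ring]
    rw [abs_le] at c6 c7 c8 ⊢
    constructor <;> linarith [c6.1, c6.2, c7.1, c7.2, c8.1, c8.2]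
  have t3 : |w₀ * N₁ * P| ≤ X := by
    rw [show w₀ * N₁ * P = w₀ * 1 * (N₁ * P) by ring]; exact c9
  have g2 : |A * ((w₂ + w₀ ^ 3) * N₁ * P - w₁ * N₁ * p)| ≤ |A| * (3 * X) := by
    rw [abs_mul]; gcongr
  have g3 : |D * (w₀ * N₁ * P)| ≤ |D| * X := by rw [abs_mul]; gcongr
  have t1 : |-w₂ * N₂ * p + 5 * w₀ ^ 2 * w₁ * N₁ * p
      - (5 * w₀ ^ 2 * w₂ + 5 * w₀ * w₁ ^ 2 + 3 / 2 * w₀ ^ 5) * N₁ * P| ≤ 18 * X := by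
    rw [show -w₂ * N₂ * p + 5 * w₀ ^ 2 * w₁ * N₁ * p
      - (5 * w₀ ^ 2 * w₂ + 5 * w₀ * w₁ ^ 2 + 3 / 2 * w₀ ^ 5) * N₁ * P =
      -(w₂ * 1 * (N₂ * p)) + 5 * (w₁ * w₀ ^ 2 * (N₁ * p)) - 5 * (w₂ * w₀ ^ 2 * (N₁ * P))
      - 5 * (w₀ * w₁ ^ 2 * (N₁ * P)) - 3 / 2 * (w₀ * w₀ ^ 4 * (N₁ * P)) by ring]
    rw [abs_le] at c1 c2 c3 c4 c5 ⊢
    constructor <;> linarith [c1.1, c1.2, c2.1, c2.2, c3.1, c3.2, c4.1, c4.2, c5.1, c5.2]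
  rw [abs_le] at t1 g2 g3 ⊢
  constructor <;> linarith [t1.1, t1.2, g2.1, g2.2, g3.1, g3.2]

/-! ### Classes of continuous functions stable under the operations of the flux -/

/-- Bounded continuous functions. -/
class BoundedCont (f : ℝ → ℝ) : Prop where
  cont : Continuous f
  bdd : ∃ B, ∀ x, |f x| ≤ B

/-- Bounded continuous square integrable functions. -/
class BoundedL2 (f : ℝ → ℝ) : Prop extends BoundedCont f where
  memLp : MemLp f 2

/-- Bounded continuous integrable functions. -/
class BoundedL1 (f : ℝ → ℝ) : Prop extends BoundedCont f where
  integrable : Integrable f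

section Instances

variable {f g : ℝ → ℝ}

/-- These instances reduce the integrability of a polynomial in bounded square integrable functions
to class inference, once it is written with the operations on functions. This is how the terms of
the flux are handled. -/
instance BoundedCont.add [BoundedCont f] [BoundedCont g] : BoundedCont (f + g) := by
  obtain ⟨B, hB⟩ := BoundedCont.bdd (f := f)
  obtain ⟨C, hC⟩ := BoundedCont.bdd (f := g)
  exact ⟨(BoundedCont.cont (f := f)).add (BoundedCont.cont (f := g)), B + C, fun x =>
    (abs_add_le _ _).trans (add_le_add (hB x) (hC x))⟩

instance BoundedCont.neg [BoundedCont f] : BoundedCont (-f) := by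
  obtain ⟨B, hB⟩ := BoundedCont.bdd (f := f)
  exact ⟨(BoundedCont.cont (f := f)).neg, B, fun x => by simpa using hB x⟩

instance BoundedCont.mul [BoundedCont f] [BoundedCont g] : BoundedCont (f * g) := by
  obtain ⟨B, hB⟩ := BoundedCont.bdd (f := f)
  obtain ⟨C, hC⟩ := BoundedCont.bdd (f := g)
  exact ⟨(BoundedCont.cont (f := f)).mul (BoundedCont.cont (f := g)), B * C, fun x => by
    simp only [Pi.mul_apply, abs_mul]
    exact mul_le_mul (hB x) (hC x) (abs_nonneg _) ((abs_nonneg _).trans (hB x))⟩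

instance BoundedCont.sub [BoundedCont f] [BoundedCont g] : BoundedCont (f - g) := by
  rw [sub_eq_add_neg]; infer_instance

instance BoundedCont.smul (c : ℝ) [BoundedCont f] : BoundedCont (c • f) := by
  obtain ⟨B, hB⟩ := BoundedCont.bdd (f := f)
  exact ⟨(BoundedCont.cont (f := f)).const_smul c, |c| * B, fun x => by
    simp only [Pi.smul_apply, smul_eq_mul, abs_mul]
    exact mul_le_mul_of_nonneg_left (hB x) (abs_nonneg _)⟩

instance BoundedL2.add [BoundedL2 f] [BoundedL2 g] : BoundedL2 (f + g) where
  memLp := (BoundedL2.memLp (f := f)).add (BoundedL2.memLp (f := g))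

instance BoundedL2.neg [BoundedL2 f] : BoundedL2 (-f) where
  memLp := (BoundedL2.memLp (f := f)).neg

instance BoundedL2.sub [BoundedL2 f] [BoundedL2 g] : BoundedL2 (f - g) where
  memLp := (BoundedL2.memLp (f := f)).sub (BoundedL2.memLp (f := g))

instance BoundedL2.smul (c : ℝ) [BoundedL2 f] : BoundedL2 (c • f) where
  memLp := (BoundedL2.memLp (f := f)).const_smul c

instance BoundedL2.mul [BoundedCont f] [BoundedL2 g] : BoundedL2 (f * g) where
  memLp := by
    obtain ⟨B, hB⟩ := BoundedCont.bdd (f := f)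
    exact memLp_bdd_mul (BoundedCont.cont (f := f)).aestronglyMeasurable hB
      (BoundedL2.memLp (f := g))

instance BoundedL1.add [BoundedL1 f] [BoundedL1 g] : BoundedL1 (f + g) where
  integrable := (BoundedL1.integrable (f := f)).add (BoundedL1.integrable (f := g))

instance BoundedL1.neg [BoundedL1 f] : BoundedL1 (-f) where
  integrable := (BoundedL1.integrable (f := f)).neg

instance BoundedL1.sub [BoundedL1 f] [BoundedL1 g] : BoundedL1 (f - g) where
  integrable := (BoundedL1.integrable (f := f)).sub (BoundedL1.integrable (f := g))

instance BoundedL1.smul (c : ℝ) [BoundedL1 f] : BoundedL1 (c • f) where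
  integrable := (BoundedL1.integrable (f := f)).smul c

instance BoundedL1.mul_bounded [BoundedL1 f] [BoundedCont g] : BoundedL1 (f * g) where
  integrable := by
    obtain ⟨B, hB⟩ := BoundedCont.bdd (f := g)
    exact (BoundedL1.integrable (f := f)).mul_bdd
      (BoundedCont.cont (f := g)).aestronglyMeasurable (Eventually.of_forall hB)

instance BoundedL1.mul [BoundedL2 f] [BoundedL2 g] : BoundedL1 (f * g) where
  integrable := (BoundedL2.memLp (f := f)).integrable_mul (BoundedL2.memLp (f := g))

end Instances

theorem boundedL2_conv {f g : ℝ → ℝ} (hf : MemLp f 2) (hg : IsTestFunction g) :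
    BoundedL2 (conv f g) where
  cont := continuous_conv hf.locallyIntegrable_two hg
  bdd := ⟨√(l2sq f * l2sq g), fun x => Real.abs_le_sqrt (sq_conv_le hf hg x)⟩
  memLp := (l2sq_conv_le hf hg).1

/-! ### Weights -/

/-- A decreasing weight `P` with `P' = -p`, together with the derivatives of `p`. -/
structure IsWeight (κ : ℝ) (P p p₁ p₂ : ℝ → ℝ) : Prop where
  hasDerivAt : ∀ x, HasDerivAt P (-p x) x
  hasDerivAt₁ : ∀ x, HasDerivAt p (p₁ x) x
  hasDerivAt₂ : ∀ x, HasDerivAt p₁ (p₂ x) x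
  cont : Continuous p₂
  nonneg : ∀ x, 0 ≤ P x
  le_one : ∀ x, P x ≤ 1
  nonneg₁ : ∀ x, 0 ≤ p x
  le_one₁ : ∀ x, p x ≤ 1
  abs_le₁ : ∀ x, |p₁ x| ≤ p x
  abs_le₂ : ∀ x, |p₂ x| ≤ κ * p x

namespace IsWeight

variable {κ : ℝ} {P p p₁ p₂ : ℝ → ℝ}

theorem bounded (h : IsWeight κ P p p₁ p₂) : BoundedCont P :=
  ⟨continuous_iff_continuousAt.2 fun x => (h.hasDerivAt x).continuousAt, 1, fun x => by
    rw [abs_of_nonneg (h.nonneg x)]; exact h.le_one x⟩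

theorem bounded₁ (h : IsWeight κ P p p₁ p₂) : BoundedCont p :=
  ⟨continuous_iff_continuousAt.2 fun x => (h.hasDerivAt₁ x).continuousAt, 1, fun x => by
    rw [abs_of_nonneg (h.nonneg₁ x)]; exact h.le_one₁ x⟩

theorem bounded₂ (h : IsWeight κ P p p₁ p₂) : BoundedCont p₁ :=
  ⟨continuous_iff_continuousAt.2 fun x => (h.hasDerivAt₂ x).continuousAt, 1, fun x =>
    (h.abs_le₁ x).trans (h.le_one₁ x)⟩

theorem bounded₃ (h : IsWeight κ P p p₁ p₂) : BoundedCont p₂ :=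
  ⟨h.cont, |κ|, fun x => (h.abs_le₂ x).trans (by
    have := h.nonneg₁ x
    have := h.le_one₁ x
    have := abs_nonneg κ
    nlinarith [le_abs_self κ])⟩

theorem comp_sub (h : IsWeight κ P p p₁ p₂) (c : ℝ) :
    IsWeight κ (fun x => P (x - c)) (fun x => p (x - c)) (fun x => p₁ (x - c))
      (fun x => p₂ (x - c)) where
  hasDerivAt x := (h.hasDerivAt (x - c)).comp_sub_const x c
  hasDerivAt₁ x := (h.hasDerivAt₁ (x - c)).comp_sub_const x c
  hasDerivAt₂ x := (h.hasDerivAt₂ (x - c)).comp_sub_const x c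
  cont := h.cont.comp (continuous_id.sub continuous_const)
  nonneg _ := h.nonneg _
  le_one _ := h.le_one _
  nonneg₁ _ := h.nonneg₁ _
  le_one₁ _ := h.le_one₁ _
  abs_le₁ _ := h.abs_le₁ _
  abs_le₂ _ := h.abs_le₂ _

end IsWeight

/-! ### The flux identity -/

/-- The part of the flux carried by the weight `P`. -/
noncomputable def fluxP (A D w₀ w₁ w₂ w₃ W W₁ K₁ : ℝ) : ℝ :=
  w₂ * W₁ - w₃ * W - 5 * (w₀ * w₀ * w₁ * W) - (1 / 2 * (w₃ * w₃) + 3 * (w₀ * w₀ * w₁ * w₃) +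
    w₀ * w₀ * w₂ * w₂ - w₀ * w₁ * w₁ * w₂ + 1 / 4 * (w₁ * w₁ * w₁ * w₁) +
    3 / 2 * (w₀ * w₀ * w₀ * w₀ * w₀ * w₂) + 15 / 4 * (w₀ * w₀ * w₀ * w₀ * w₁ * w₁) +
    9 / 16 * (w₀ * w₀ * w₀ * w₀ * w₀ * w₀ * w₀ * w₀)) - w₃ * (K₁ - 3 * (w₀ * w₀ * w₁)) +
    A * (w₁ * W + 1 / 2 * ((w₂ + w₀ * w₀ * w₀) * (w₂ + w₀ * w₀ * w₀))) +
    D * (1 / 2 * (w₁ * w₁) - w₀ * w₂ - 3 / 4 * (w₀ * w₀ * w₀ * w₀))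

/-- The derivative of `fluxP`. -/
noncomputable def fluxP' (A D w₀ w₁ w₂ w₃ w₄ W W₁ W₂ K₁ K₂ : ℝ) : ℝ :=
  w₂ * W₂ - w₄ * W - 5 * (2 * w₀ * w₁ ^ 2 * W + w₀ ^ 2 * w₂ * W + w₀ ^ 2 * w₁ * W₁) -
    (w₃ * w₄ + 3 * (2 * w₀ * w₁ ^ 2 * w₃ + w₀ ^ 2 * w₂ * w₃ + w₀ ^ 2 * w₁ * w₄) +
      2 * w₀ * w₁ * w₂ ^ 2 + 2 * w₀ ^ 2 * w₂ * w₃ - 2 * w₀ * w₁ * w₂ ^ 2 - w₀ * w₁ ^ 2 * w₃ +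
      3 / 2 * (5 * w₀ ^ 4 * w₁ * w₂ + w₀ ^ 5 * w₃) +
      15 / 4 * (4 * w₀ ^ 3 * w₁ ^ 3 + 2 * w₀ ^ 4 * w₁ * w₂) + 9 / 2 * w₀ ^ 7 * w₁) -
    w₄ * (K₁ - 3 * w₀ ^ 2 * w₁) - w₃ * (K₂ - 6 * w₀ * w₁ ^ 2 - 3 * w₀ ^ 2 * w₂) +
    A * (w₂ * W + w₁ * W₁ + (w₂ + w₀ ^ 3) * (w₃ + 3 * w₀ ^ 2 * w₁)) +
    D * (-w₀ * w₃ - 3 * w₀ ^ 3 * w₁)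

/-- The part of the flux carried by `p`. -/
noncomputable def fluxp (A D μ w₀ w₁ w₂ w₃ : ℝ) : ℝ :=
  5 * (w₀ * w₀ * w₁ * w₂) - w₂ * w₃ - (3 * μ + A) * (w₁ * w₂) - D * (w₀ * w₁)

/-- The derivative of `fluxp`. -/
noncomputable def fluxp' (A D μ w₀ w₁ w₂ w₃ w₄ : ℝ) : ℝ :=
  5 * (2 * w₀ * w₁ ^ 2 * w₂ + w₀ ^ 2 * w₂ ^ 2 + w₀ ^ 2 * w₁ * w₃) - w₃ ^ 2 - w₂ * w₄ -
    (3 * μ + A) * (w₂ ^ 2 + w₁ * w₃) - D * (w₁ ^ 2 + w₀ * w₂)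

/-- The part of the flux carried by `p'`. -/
noncomputable def fluxp₁ (A D μ w₀ w₁ w₂ : ℝ) : ℝ :=
  1 / 2 * (w₂ * w₂) + (3 / 2 * μ + 1 / 2 * A) * (w₁ * w₁) + 1 / 2 * D * (w₀ * w₀)

/-- The derivative of `fluxp₁`. -/
noncomputable def fluxp₁' (A D μ w₀ w₁ w₂ w₃ : ℝ) : ℝ :=
  w₂ * w₃ + (3 * μ + A) * (w₁ * w₂) + D * (w₀ * w₁)

/-- Pointwise algebra in independent variables. When P' = -p, p' = p₁, p₁' = p₂ and the `w`, `W`,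
`K` are successive derivatives, the first bracket is the derivative of `fluxP` · P + `fluxp` · p +
`fluxp₁` · p₁ and integrates to zero. The differences of `K₁`, `K₂` with the corresponding
derivatives of `w₀ ^ 3` are the commutators; they vanish when nothing is mollified. The parameter
`μ` expresses the integration by parts that turns the integral of w₁ w₃ p into minus that of w₂² p
plus half that of w₁² p₂: completing the square with `μ * w₁` shifts the coefficients of w₂² and
w₁². -/
theorem flux_identity (A D m μ w₀ w₁ w₂ w₃ w₄ w₅ K₁ K₂ K₃ P p p₁ p₂ : ℝ) :
    densVar A D w₀ w₁ w₂ (-(w₃ + K₁)) (-(w₄ + K₂)) (-(w₅ + K₃)) * P + m * dens A D w₀ w₁ w₂ * p =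
    (fluxP' A D w₀ w₁ w₂ w₃ w₄ (-(w₃ + K₁)) (-(w₄ + K₂)) (-(w₅ + K₃)) K₁ K₂ * P
      - fluxP A D w₀ w₁ w₂ w₃ (-(w₃ + K₁)) (-(w₄ + K₂)) K₁ * p
      + fluxp' A D μ w₀ w₁ w₂ w₃ w₄ * p + fluxp A D μ w₀ w₁ w₂ w₃ * p₁
      + fluxp₁' A D μ w₀ w₁ w₂ w₃ * p₁ + fluxp₁ A D μ w₀ w₁ w₂ * p₂)
    + 3 / 2 * (w₃ + μ * w₁) ^ 2 * p
    + ((m / 2 + 3 / 2 * A + 3 * μ) * w₂ ^ 2 + (m * A / 2 + 3 / 2 * D - 3 / 2 * μ ^ 2) * w₁ ^ 2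
      + m * D / 2 * w₀ ^ 2) * p
    - (1 / 2 * w₂ ^ 2 + (1 / 2 * A + 3 / 2 * μ) * w₁ ^ 2 + 1 / 2 * D * w₀ ^ 2) * p₂
    + ((-15 * w₀ * w₁ ^ 2 * w₂ - 9 * w₀ ^ 2 * w₂ ^ 2 + 45 / 4 * w₀ ^ 4 * w₁ ^ 2
        - 3 / 2 * w₀ ^ 5 * w₂ - 1 / 4 * w₁ ^ 4 - 9 / 16 * w₀ ^ 8) * p
      - 5 * w₀ ^ 2 * w₁ * w₂ * p₁ + m * (-5 / 2 * w₀ ^ 2 * w₁ ^ 2 + 1 / 4 * w₀ ^ 6) * p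
      + A * (w₂ * w₀ ^ 3 + 1 / 2 * w₀ ^ 6 - 3 * w₀ ^ 2 * w₁ ^ 2) * p - A * m * (1 / 4 * w₀ ^ 4) * p
      - D * (3 / 4 * w₀ ^ 4) * p)
    + w₃ * (K₂ - 6 * w₀ * w₁ ^ 2 - 3 * w₀ ^ 2 * w₂) * P
    + (-w₂ * (K₂ - 6 * w₀ * w₁ ^ 2 - 3 * w₀ ^ 2 * w₂) * p
      + 5 * w₀ ^ 2 * w₁ * (K₁ - 3 * w₀ ^ 2 * w₁) * p
      - (5 * w₀ ^ 2 * w₂ + 5 * w₀ * w₁ ^ 2 + 3 / 2 * w₀ ^ 5) * (K₁ - 3 * w₀ ^ 2 * w₁) * P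
      + A * ((w₂ + w₀ ^ 3) * (K₁ - 3 * w₀ ^ 2 * w₁) * P - w₁ * (K₁ - 3 * w₀ ^ 2 * w₁) * p)
      - D * (w₀ * (K₁ - 3 * w₀ ^ 2 * w₁) * P)) := by
  unfold densVar dens fluxP' fluxP fluxp' fluxp fluxp₁' fluxp₁
  ring

/-! ### Commutator estimates -/

theorem abs_conv_moll_le_conv {f g : ℝ → ℝ} {ε x : ℝ} (hε : 0 < ε) (hf : LocallyIntegrable f)
    (hg : LocallyIntegrable g) (h : ∀ y, |x - y| ≤ ε → |f y| ≤ g y) :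
    |conv f (moll ε) x| ≤ conv g (moll ε) x := by
  have hr := (isTestFunction_moll hε).reflect x
  refine (abs_integral_le_integral_abs).trans (integral_mono
    (integrable_mul_test hf hr.continuous hr.2).abs
    (integrable_mul_test hg hr.continuous hr.2) fun y => ?_)
  dsimp
  rw [abs_mul, abs_of_nonneg (moll_nonneg hε _)]
  by_cases hy : |x - y| ≤ ε
  · exact mul_le_mul_of_nonneg_right (h y hy) (moll_nonneg hε _)
  · simp [moll_eq_zero hε (not_le.1 hy).le]

theorem conv_const_mul (c : ℝ) (f g : ℝ → ℝ) (x : ℝ) :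
    conv (fun y => c * f y) g x = c * conv f g x := by
  unfold conv
  rw [← integral_const_mul]
  simp only [mul_assoc]

theorem conv_abs_moll_nonneg (f : ℝ → ℝ) {ε : ℝ} (hε : 0 < ε) (x : ℝ) :
    0 ≤ conv (fun y => |f y|) (moll ε) x :=
  integral_nonneg fun _ => mul_nonneg (abs_nonneg _) (moll_nonneg hε _)

namespace IsH2Triple

variable {u u₁ u₂ : ℝ → ℝ}

theorem abs_sub_le (h : IsH2Triple u u₁ u₂) {B : ℝ} (hB : ∀ x, |u₁ x| ≤ B) (x y : ℝ) :
    |u y - u x| ≤ B * |y - x| := by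
  simpa using Convex.norm_image_sub_le_of_norm_hasDerivWithin_le (s := Set.univ) (f := u)
    (f' := u₁) (fun z _ => (h.hasDerivAt z).hasDerivWithinAt) (fun z _ => hB z) convex_univ
    (Set.mem_univ x) (Set.mem_univ y)

theorem abs_sub_conv_le (h : IsH2Triple u u₁ u₂) {B ε : ℝ} (hε : 0 < ε) (hB : ∀ x, |u₁ x| ≤ B)
    {x y : ℝ} (hxy : |x - y| ≤ ε) : |u y - conv u (moll ε) x| ≤ 2 * B * ε := by
  have hB0 : 0 ≤ B := (abs_nonneg _).trans (hB 0)
  have h1 : ∀ y, |x - y| ≤ ε → |u y - u x| ≤ B * ε := fun y hy =>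
    (h.abs_sub_le hB x y).trans (by rw [abs_sub_comm]; gcongr)
  have h2 := abs_conv_moll_sub_le hε h.continuous.locallyIntegrable h1
  have h3 := h1 y hxy
  rw [_root_.abs_le] at *
  constructor <;> linarith [h2.1, h2.2, h3.1, h3.2]

/-- With the mollified value `w` frozen at `x`, the commutator is the average of 3(u(y)² - w²)
u₁(y). The Lipschitz bound on `u` supplies the factor ε. -/
theorem abs_comm₁_le (h : IsH2Triple u u₁ u₂) {B ε : ℝ} (hε : 0 < ε) (hB0 : ∀ x, |u x| ≤ B)
    (hB : ∀ x, |u₁ x| ≤ B) (x : ℝ) :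
    |conv (fun y => 3 * u y ^ 2 * u₁ y) (moll ε) x
      - 3 * conv u (moll ε) x ^ 2 * conv u₁ (moll ε) x|
      ≤ 12 * B ^ 2 * ε * conv (fun y => |u₁ y|) (moll ε) x := by
  have hm := isTestFunction_moll hε
  have hBn : 0 ≤ B := (abs_nonneg _).trans (hB 0)
  set w := conv u (moll ε) x with hw
  have hwB : |w| ≤ B := abs_conv_moll_le hε h.continuous.locallyIntegrable fun y _ => hB0 y
  rw [← conv_const_mul, ← conv_sub_left h.memLp_cube₁.locallyIntegrable_two
    (h.memLp₁.const_mul _).locallyIntegrable_two hm, ← conv_const_mul]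
  refine abs_conv_moll_le_conv hε
    (h.memLp_cube₁.sub (h.memLp₁.const_mul _)).locallyIntegrable_two
    (h.memLp₁.abs.const_mul _).locallyIntegrable_two fun y hy => ?_
  have e1 := h.abs_sub_conv_le hε hB hy
  have e2 : |u y + w| ≤ 2 * B := (abs_add_le _ _).trans (by linarith [hB0 y])
  calc |3 * u y ^ 2 * u₁ y - 3 * w ^ 2 * u₁ y| = 3 * (|u y - w| * |u y + w|) * |u₁ y| := by
        rw [show 3 * u y ^ 2 * u₁ y - 3 * w ^ 2 * u₁ y = 3 * ((u y - w) * (u y + w)) * u₁ y by ring]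
        simp [abs_mul]
    _ ≤ 3 * ((2 * B * ε) * (2 * B)) * |u₁ y| := by gcongr
    _ = _ := by ring

/-- As in `abs_comm₁_le`, but the factor `u₁` has to be compared with its average too, and it need
not be Lipschitz since `u₂` is only in L². Its oscillation is controlled instead by ε times an
average of |u₂|, which costs nothing in L². -/
theorem abs_comm₂_le (h : IsH2Triple u u₁ u₂) {B ε C : ℝ} (hε : 0 < ε) (hB0 : ∀ x, |u x| ≤ B)
    (hB : ∀ x, |u₁ x| ≤ B)
    (hosc : ∀ x y, |x - y| ≤ ε → |u₁ y - u₁ x| ≤ C * ε * conv (fun z => |u₂ z|) (moll (2 * ε)) x)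
    (x : ℝ) :
    |conv (fun y => 6 * u y * u₁ y * u₁ y + 3 * u y ^ 2 * u₂ y) (moll ε) x
      - 6 * conv u (moll ε) x * conv u₁ (moll ε) x ^ 2
      - 3 * conv u (moll ε) x ^ 2 * conv u₂ (moll ε) x|
      ≤ 12 * B ^ 2 * ε * (conv (fun y => |u₁ y|) (moll ε) x + conv (fun y => |u₂ y|) (moll ε) x
        + C * conv (fun y => |u₂ y|) (moll (2 * ε)) x) := by
  have hm := isTestFunction_moll hε
  have hBn : 0 ≤ B := (abs_nonneg _).trans (hB 0)
  set w := conv u (moll ε) x with hw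
  set v := conv u₁ (moll ε) x with hv
  set a := conv (fun y => |u₂ y|) (moll (2 * ε)) x with ha
  have hwB : |w| ≤ B := abs_conv_moll_le hε h.continuous.locallyIntegrable fun y _ => hB0 y
  have hCa : 0 ≤ C * ε * a := (abs_nonneg _).trans (hosc x x (by simpa using hε.le))
  have hvu : |v - u₁ x| ≤ C * ε * a :=
    abs_conv_moll_sub_le hε h.cont.locallyIntegrable (hosc x)
  have l1 : MemLp (fun y => 6 * w * v * u₁ y + 3 * w ^ 2 * u₂ y) 2 :=
    (h.memLp₁.const_mul _).add (h.memLp₂.const_mul _)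
  have e : conv (fun y => 6 * u y * u₁ y * u₁ y + 3 * u y ^ 2 * u₂ y) (moll ε) x
      - 6 * w * v ^ 2 - 3 * w ^ 2 * conv u₂ (moll ε) x =
      conv (fun y => (6 * u y * u₁ y * u₁ y + 3 * u y ^ 2 * u₂ y) -
        (6 * w * v * u₁ y + 3 * w ^ 2 * u₂ y)) (moll ε) x := by
    rw [conv_sub_left h.memLp_cube₂.locallyIntegrable_two l1.locallyIntegrable_two hm,
      conv_add_left (h.memLp₁.const_mul _).locallyIntegrable_two
        (h.memLp₂.const_mul _).locallyIntegrable_two hm, conv_const_mul, conv_const_mul, ← hv]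
    ring
  have l2 : LocallyIntegrable fun y => (12 * B ^ 2 * ε) * |u₁ y| :=
    (h.memLp₁.abs.const_mul _).locallyIntegrable_two
  have l3 : LocallyIntegrable fun y => (12 * B ^ 2 * ε) * |u₂ y| :=
    (h.memLp₂.abs.const_mul _).locallyIntegrable_two
  have e' : 12 * B ^ 2 * ε * (conv (fun y => |u₁ y|) (moll ε) x
      + conv (fun y => |u₂ y|) (moll ε) x + C * a) =
      conv (fun y => ((12 * B ^ 2 * ε) * |u₁ y| + (12 * B ^ 2 * ε) * |u₂ y|)
        + (12 * B ^ 2 * ε) * (C * a)) (moll ε) x := by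
    rw [conv_add_left (by exact l2.add l3) (locallyIntegrable_const _) hm, conv_add_left l2 l3 hm,
      conv_const_mul, conv_const_mul, conv_const_moll hε]
    ring
  rw [e, e']
  refine abs_conv_moll_le_conv hε (h.memLp_cube₂.sub l1).locallyIntegrable_two
    ((l2.add l3).add (locallyIntegrable_const _)) fun y hy => ?_
  have e1 := h.abs_sub_conv_le hε hB hy
  rw [← hw] at e1
  have e2 : |u y + w| ≤ 2 * B := (abs_add_le _ _).trans (by linarith [hB0 y])
  have e3 : |u₁ y - v| ≤ 2 * (C * ε * a) := by
    have := hosc x y hy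
    rw [_root_.abs_le] at *
    constructor <;> linarith [hvu.1, hvu.2, this.1, this.2]
  have s1 : |6 * (u y - w) * u₁ y * u₁ y| ≤ 6 * (2 * B * ε) * B * |u₁ y| := by
    simp only [abs_mul, show |(6 : ℝ)| = 6 by norm_num]
    have := hB y
    gcongr
  have s2 : |6 * w * (u₁ y - v) * u₁ y| ≤ 6 * B * (2 * (C * ε * a)) * B := by
    simp only [abs_mul, show |(6 : ℝ)| = 6 by norm_num]
    have := hB y
    gcongr
  have s3 : |3 * (u y - w) * (u y + w) * u₂ y| ≤ 3 * (2 * B * ε) * (2 * B) * |u₂ y| := by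
    simp only [abs_mul, show |(3 : ℝ)| = 3 by norm_num]
    gcongr
  calc |6 * u y * u₁ y * u₁ y + 3 * u y ^ 2 * u₂ y - (6 * w * v * u₁ y + 3 * w ^ 2 * u₂ y)|
      = |6 * (u y - w) * u₁ y * u₁ y + 6 * w * (u₁ y - v) * u₁ y
          + 3 * (u y - w) * (u y + w) * u₂ y| := by congr 1; ring
    _ ≤ _ := (abs_add_le _ _).trans (add_le_add_left (abs_add_le _ _) _)
    _ ≤ 6 * (2 * B * ε) * B * |u₁ y| + 6 * B * (2 * (C * ε * a)) * B
        + 3 * (2 * B * ε) * (2 * B) * |u₂ y| := by linarith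
    _ = _ := by ring

/-- The commutators of mollification and nonlinearity are of order `ε` in `L²`. -/
theorem exists_l2sq_comm_le : ∃ C : ℝ, 0 < C ∧ ∀ u u₁ u₂ : ℝ → ℝ, IsH2Triple u u₁ u₂ →
    ∀ B : ℝ, (∀ x, |u x| ≤ B) → (∀ x, |u₁ x| ≤ B) → ∀ ε : ℝ, 0 < ε →
    l2sq (fun x => conv (fun y => 3 * u y ^ 2 * u₁ y) (moll ε) x
      - 3 * conv u (moll ε) x ^ 2 * conv u₁ (moll ε) x) ≤ C * B ^ 4 * ε ^ 2 * h2sq u u₁ u₂ ∧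
    l2sq (fun x => conv (fun y => 6 * u y * u₁ y * u₁ y + 3 * u y ^ 2 * u₂ y) (moll ε) x
      - 6 * conv u (moll ε) x * conv u₁ (moll ε) x ^ 2
      - 3 * conv u (moll ε) x ^ 2 * conv u₂ (moll ε) x) ≤ C * B ^ 4 * ε ^ 2 * h2sq u u₁ u₂ := by
  obtain ⟨C, hC, hosc⟩ := exists_oscillation_bound
  refine ⟨144 * (8 + 4 * C ^ 2), by positivity, fun u u₁ u₂ h B hB0 hB ε hε => ?_⟩
  have hm := isTestFunction_moll hε
  have h2 : (0 : ℝ) < 2 * ε := by positivity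
  have m1 : MemLp (conv (fun y => |u₁ y|) (moll ε)) 2 := (l2sq_conv_le h.memLp₁.abs hm).1
  have m2 : MemLp (conv (fun y => |u₂ y|) (moll ε)) 2 := (l2sq_conv_le h.memLp₂.abs hm).1
  have m3 : MemLp (conv (fun y => |u₂ y|) (moll (2 * ε))) 2 :=
    (l2sq_conv_le h.memLp₂.abs (isTestFunction_moll h2)).1
  have b1 : l2sq (conv (fun y => |u₁ y|) (moll ε)) ≤ l2sq u₁ :=
    (l2sq_conv_moll_le h.memLp₁.abs hε).trans (l2sq_abs u₁).le
  have b2 : l2sq (conv (fun y => |u₂ y|) (moll ε)) ≤ l2sq u₂ :=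
    (l2sq_conv_moll_le h.memLp₂.abs hε).trans (l2sq_abs u₂).le
  have b3 : l2sq (conv (fun y => |u₂ y|) (moll (2 * ε))) ≤ l2sq u₂ :=
    (l2sq_conv_moll_le h.memLp₂.abs h2).trans (l2sq_abs u₂).le
  have n1 := conv_abs_moll_nonneg u₁ hε
  have n2 := conv_abs_moll_nonneg u₂ hε
  have n3 := conv_abs_moll_nonneg u₂ h2
  have p0 := l2sq_nonneg u
  have p1 := l2sq_nonneg u₁
  have p2 := l2sq_nonneg u₂
  have pB : 0 ≤ 144 * B ^ 4 * ε ^ 2 := by positivity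
  constructor
  · calc _ ≤ l2sq (fun x => 12 * B ^ 2 * ε * conv (fun y => |u₁ y|) (moll ε) x) :=
          l2sq_mono (m1.const_mul _) fun x => (h.abs_comm₁_le hε hB0 hB x).trans (le_abs_self _)
      _ = 144 * B ^ 4 * ε ^ 2 * l2sq (conv (fun y => |u₁ y|) (moll ε)) := by
          rw [l2sq_const_mul]; ring
      _ ≤ 144 * B ^ 4 * ε ^ 2 * ((8 + 4 * C ^ 2) * h2sq u u₁ u₂) := by
          refine mul_le_mul_of_nonneg_left (b1.trans ?_) pB
          unfold h2sq
          nlinarith [mul_nonneg (sq_nonneg C) (add_nonneg (add_nonneg p0 p1) p2)]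
      _ = _ := by ring
  · have q := l2sq_add_le (m1.add m2) (m3.const_mul C)
    have q' := l2sq_add_le m1 m2
    have q'' := l2sq_const_mul C (conv (fun y => |u₂ y|) (moll (2 * ε)))
    calc _ ≤ l2sq (fun x => 12 * B ^ 2 * ε * (conv (fun y => |u₁ y|) (moll ε) x
            + conv (fun y => |u₂ y|) (moll ε) x
            + C * conv (fun y => |u₂ y|) (moll (2 * ε)) x)) :=
          l2sq_mono (((m1.add m2).add (m3.const_mul C)).const_mul _) fun x =>
            (h.abs_comm₂_le hε hB0 hB (fun x y => hosc u₁ u₂ h.memLp₂.locallyIntegrable_two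
              h.prim ε x y hε) x).trans (le_abs_self _)
      _ = 144 * B ^ 4 * ε ^ 2 * l2sq (fun x => conv (fun y => |u₁ y|) (moll ε) x
            + conv (fun y => |u₂ y|) (moll ε) x
            + C * conv (fun y => |u₂ y|) (moll (2 * ε)) x) := by
          rw [l2sq_const_mul]; ring
      _ ≤ 144 * B ^ 4 * ε ^ 2 * ((8 + 4 * C ^ 2) * h2sq u u₁ u₂) := by
          refine mul_le_mul_of_nonneg_left ?_ pB
          simp only [Pi.add_apply] at q
          change l2sq (fun x => conv (fun y => |u₁ y|) (moll ε) x
            + conv (fun y => |u₂ y|) (moll ε) x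
            + C * conv (fun y => |u₂ y|) (moll (2 * ε)) x) ≤
            2 * l2sq (fun x => conv (fun y => |u₁ y|) (moll ε) x
            + conv (fun y => |u₂ y|) (moll ε) x) + _ at q
          have c2 := mul_le_mul_of_nonneg_left b3 (sq_nonneg C)
          unfold h2sq
          nlinarith [mul_nonneg (sq_nonneg C) p0, mul_nonneg (sq_nonneg C) p1,
            mul_nonneg (sq_nonneg C) p2]
      _ = _ := by ring

end IsH2Triple

/-! ### The flux integrates to zero -/

theorem BoundedL1.integrable_mul {f g : ℝ → ℝ} (hf : BoundedL1 f) [BoundedCont g] :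
    Integrable fun x => f x * g x :=
  (BoundedL1.mul_bounded (f := f) (g := g)).integrable

section Flux

variable {κ : ℝ} {P p p₁ p₂ : ℝ → ℝ} (A D m μ : ℝ) {w₀ w₁ w₂ w₃ w₄ W W₁ W₂ K₁ K₂ : ℝ → ℝ}

set_option synthInstance.maxHeartbeats 400000 in
set_option synthInstance.maxSize 4096 in
theorem boundedL1_fluxP [BoundedL2 w₀] [BoundedL2 w₁] [BoundedL2 w₂] [BoundedL2 w₃]
    [BoundedL2 W] [BoundedL2 W₁] [BoundedL2 K₁] :
    BoundedL1 fun x => fluxP A D (w₀ x) (w₁ x) (w₂ x) (w₃ x) (W x) (W₁ x) (K₁ x) := by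
  have e : (fun x => fluxP A D (w₀ x) (w₁ x) (w₂ x) (w₃ x) (W x) (W₁ x) (K₁ x)) =
      w₂ * W₁ - w₃ * W - (5 : ℝ) • (w₀ * w₀ * w₁ * W) - ((1 / 2 : ℝ) • (w₃ * w₃) +
      (3 : ℝ) • (w₀ * w₀ * w₁ * w₃) +
      w₀ * w₀ * w₂ * w₂ - w₀ * w₁ * w₁ * w₂ + (1 / 4 : ℝ) • (w₁ * w₁ * w₁ * w₁) +
      (3 / 2 : ℝ) • (w₀ * w₀ * w₀ * w₀ * w₀ * w₂) +
      (15 / 4 : ℝ) • (w₀ * w₀ * w₀ * w₀ * w₁ * w₁) +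
      (9 / 16 : ℝ) • (w₀ * w₀ * w₀ * w₀ * w₀ * w₀ * w₀ * w₀)) -
      w₃ * (K₁ - (3 : ℝ) • (w₀ * w₀ * w₁)) +
      A • (w₁ * W + (1 / 2 : ℝ) • ((w₂ + w₀ * w₀ * w₀) * (w₂ + w₀ * w₀ * w₀))) +
      D • ((1 / 2 : ℝ) • (w₁ * w₁) - w₀ * w₂ - (3 / 4 : ℝ) • (w₀ * w₀ * w₀ * w₀)) := by
    ext x; simp [fluxP]; ring
  rw [e]; infer_instance

set_option synthInstance.maxHeartbeats 400000 in
set_option synthInstance.maxSize 4096 in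
theorem boundedL1_fluxP' [BoundedL2 w₀] [BoundedL2 w₁] [BoundedL2 w₂] [BoundedL2 w₃]
    [BoundedL2 w₄] [BoundedL2 W] [BoundedL2 W₁] [BoundedL2 W₂] [BoundedL2 K₁] [BoundedL2 K₂] :
    BoundedL1 fun x => fluxP' A D (w₀ x) (w₁ x) (w₂ x) (w₃ x) (w₄ x) (W x) (W₁ x) (W₂ x)
      (K₁ x) (K₂ x) := by
  have e : (fun x => fluxP' A D (w₀ x) (w₁ x) (w₂ x) (w₃ x) (w₄ x) (W x) (W₁ x) (W₂ x)
      (K₁ x) (K₂ x)) =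
      w₂ * W₂ - w₄ * W - (5 : ℝ) • ((2 : ℝ) • (w₀ * w₁ * w₁ * W) + w₀ * w₀ * w₂ * W
        + w₀ * w₀ * w₁ * W₁) -
      (w₃ * w₄ + (3 : ℝ) • ((2 : ℝ) • (w₀ * w₁ * w₁ * w₃) + w₀ * w₀ * w₂ * w₃ + w₀ * w₀ * w₁ * w₄)
        + (2 : ℝ) • (w₀ * w₀ * w₂ * w₃) - w₀ * w₁ * w₁ * w₃ +
        (3 / 2 : ℝ) • ((5 : ℝ) • (w₀ * w₀ * w₀ * w₀ * w₁ * w₂) + w₀ * w₀ * w₀ * w₀ * w₀ * w₃) +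
        (15 / 4 : ℝ) • ((4 : ℝ) • (w₀ * w₀ * w₀ * w₁ * w₁ * w₁) +
          (2 : ℝ) • (w₀ * w₀ * w₀ * w₀ * w₁ * w₂)) +
        (9 / 2 : ℝ) • (w₀ * w₀ * w₀ * w₀ * w₀ * w₀ * w₀ * w₁)) -
      w₄ * (K₁ - (3 : ℝ) • (w₀ * w₀ * w₁)) -
      w₃ * (K₂ - (6 : ℝ) • (w₀ * w₁ * w₁) - (3 : ℝ) • (w₀ * w₀ * w₂)) +
      A • (w₂ * W + w₁ * W₁ + (w₂ + w₀ * w₀ * w₀) * (w₃ + (3 : ℝ) • (w₀ * w₀ * w₁))) +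
      D • (-(w₀ * w₃) - (3 : ℝ) • (w₀ * w₀ * w₀ * w₁)) := by
    ext x; simp [fluxP']; ring
  rw [e]; infer_instance

theorem boundedL1_fluxp [BoundedL2 w₀] [BoundedL2 w₁] [BoundedL2 w₂] [BoundedL2 w₃] :
    BoundedL1 fun x => fluxp A D μ (w₀ x) (w₁ x) (w₂ x) (w₃ x) := by
  have e : (fun x => fluxp A D μ (w₀ x) (w₁ x) (w₂ x) (w₃ x)) =
      (5 : ℝ) • (w₀ * w₀ * w₁ * w₂) - w₂ * w₃ - (3 * μ + A) • (w₁ * w₂) - D • (w₀ * w₁) := by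
    ext x; simp [fluxp]
  rw [e]; infer_instance

theorem boundedL1_fluxp' [BoundedL2 w₀] [BoundedL2 w₁] [BoundedL2 w₂] [BoundedL2 w₃]
    [BoundedL2 w₄] :
    BoundedL1 fun x => fluxp' A D μ (w₀ x) (w₁ x) (w₂ x) (w₃ x) (w₄ x) := by
  have e : (fun x => fluxp' A D μ (w₀ x) (w₁ x) (w₂ x) (w₃ x) (w₄ x)) =
      (5 : ℝ) • ((2 : ℝ) • (w₀ * w₁ * w₁ * w₂) + w₀ * w₀ * w₂ * w₂ + w₀ * w₀ * w₁ * w₃)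
        - w₃ * w₃ - w₂ * w₄ -
        (3 * μ + A) • (w₂ * w₂ + w₁ * w₃) - D • (w₁ * w₁ + w₀ * w₂) := by
    ext x; simp [fluxp']; ring
  rw [e]; infer_instance

theorem boundedL1_fluxp₁ [BoundedL2 w₀] [BoundedL2 w₁] [BoundedL2 w₂] :
    BoundedL1 fun x => fluxp₁ A D μ (w₀ x) (w₁ x) (w₂ x) := by
  have e : (fun x => fluxp₁ A D μ (w₀ x) (w₁ x) (w₂ x)) =
      (1 / 2 : ℝ) • (w₂ * w₂) + (3 / 2 * μ + 1 / 2 * A) • (w₁ * w₁) + (1 / 2 * D) • (w₀ * w₀) := by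
    ext x; simp [fluxp₁]
  rw [e]; infer_instance

theorem boundedL1_fluxp₁' [BoundedL2 w₀] [BoundedL2 w₁] [BoundedL2 w₂] [BoundedL2 w₃] :
    BoundedL1 fun x => fluxp₁' A D μ (w₀ x) (w₁ x) (w₂ x) (w₃ x) := by
  have e : (fun x => fluxp₁' A D μ (w₀ x) (w₁ x) (w₂ x) (w₃ x)) =
      w₂ * w₃ + (3 * μ + A) • (w₁ * w₂) + D • (w₀ * w₁) := by
    ext x; simp [fluxp₁']
  rw [e]; infer_instance

theorem boundedL1_densVar [BoundedL2 w₀] [BoundedL2 w₁] [BoundedL2 w₂] [BoundedL2 W]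
    [BoundedL2 W₁] [BoundedL2 W₂] :
    BoundedL1 fun x => densVar A D (w₀ x) (w₁ x) (w₂ x) (W x) (W₁ x) (W₂ x) := by
  have e : (fun x => densVar A D (w₀ x) (w₁ x) (w₂ x) (W x) (W₁ x) (W₂ x)) =
      w₂ * W₂ - (5 : ℝ) • (w₀ * w₁ * w₁ * W) - (5 : ℝ) • (w₀ * w₀ * w₁ * W₁)
      + (3 / 2 : ℝ) • (w₀ * w₀ * w₀ * w₀ * w₀ * W) + A • (w₁ * W₁ - w₀ * w₀ * w₀ * W)
      + D • (w₀ * W) := by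
    ext x; simp [densVar]; ring
  rw [e]; infer_instance

theorem boundedL1_dens [BoundedL2 w₀] [BoundedL2 w₁] [BoundedL2 w₂] :
    BoundedL1 fun x => dens A D (w₀ x) (w₁ x) (w₂ x) := by
  have e : (fun x => dens A D (w₀ x) (w₁ x) (w₂ x)) =
      (1 / 2 : ℝ) • (w₂ * w₂) - (5 / 2 : ℝ) • (w₀ * w₀ * w₁ * w₁)
      + (1 / 4 : ℝ) • (w₀ * w₀ * w₀ * w₀ * w₀ * w₀)
      + A • ((1 / 2 : ℝ) • (w₁ * w₁) - (1 / 4 : ℝ) • (w₀ * w₀ * w₀ * w₀))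
      + D • ((1 / 2 : ℝ) • (w₀ * w₀)) := by
    ext x; simp [dens]; ring
  rw [e]; infer_instance

theorem hasDerivAt_fluxP {x : ℝ} (h0 : HasDerivAt w₀ (w₁ x) x) (h1 : HasDerivAt w₁ (w₂ x) x)
    (h2 : HasDerivAt w₂ (w₃ x) x) (h3 : HasDerivAt w₃ (w₄ x) x) (hW : HasDerivAt W (W₁ x) x)
    (hW1 : HasDerivAt W₁ (W₂ x) x) (hK : HasDerivAt K₁ (K₂ x) x) :
    HasDerivAt (fun x => fluxP A D (w₀ x) (w₁ x) (w₂ x) (w₃ x) (W x) (W₁ x) (K₁ x))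
      (fluxP' A D (w₀ x) (w₁ x) (w₂ x) (w₃ x) (w₄ x) (W x) (W₁ x) (W₂ x) (K₁ x) (K₂ x)) x := by
  have a00 := h0.fun_mul h0
  have a001 := a00.fun_mul h1
  have a000 := a00.fun_mul h0
  have a0000 := a000.fun_mul h0
  have a00000 := a0000.fun_mul h0
  have q := h2.fun_add a000
  have H := ((((((((h3.fun_mul h3).const_mul (1 / 2)).fun_add ((a001.fun_mul h3).const_mul 3)).fun_add
    ((a00.fun_mul h2).fun_mul h2)).fun_sub (((h0.fun_mul h1).fun_mul h1).fun_mul h2)).fun_add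
    ((((h1.fun_mul h1).fun_mul h1).fun_mul h1).const_mul (1 / 4))).fun_add
    ((a00000.fun_mul h2).const_mul (3 / 2))).fun_add
    (((a0000.fun_mul h1).fun_mul h1).const_mul (15 / 4))).fun_add
    ((((a00000.fun_mul h0).fun_mul h0).fun_mul h0).const_mul (9 / 16))
  have T := ((((((h2.fun_mul hW1).fun_sub (h3.fun_mul hW)).fun_sub
    ((a001.fun_mul hW).const_mul 5)).fun_sub H).fun_sub
    (h3.fun_mul (hK.fun_sub (a001.const_mul 3)))).fun_add
    (((h1.fun_mul hW).fun_add ((q.fun_mul q).const_mul (1 / 2))).const_mul A)).fun_add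
    (((((h1.fun_mul h1).const_mul (1 / 2)).fun_sub (h0.fun_mul h2)).fun_sub
    (a0000.const_mul (3 / 4))).const_mul D)
  refine T.congr_deriv ?_
  unfold fluxP'
  ring

theorem hasDerivAt_fluxp {x : ℝ} (h0 : HasDerivAt w₀ (w₁ x) x) (h1 : HasDerivAt w₁ (w₂ x) x)
    (h2 : HasDerivAt w₂ (w₃ x) x) (h3 : HasDerivAt w₃ (w₄ x) x) :
    HasDerivAt (fun x => fluxp A D μ (w₀ x) (w₁ x) (w₂ x) (w₃ x))
      (fluxp' A D μ (w₀ x) (w₁ x) (w₂ x) (w₃ x) (w₄ x)) x := by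
  have a001 := (h0.fun_mul h0).fun_mul h1
  have T := ((((a001.fun_mul h2).const_mul 5).fun_sub (h2.fun_mul h3)).fun_sub
    ((h1.fun_mul h2).const_mul (3 * μ + A))).fun_sub ((h0.fun_mul h1).const_mul D)
  refine T.congr_deriv ?_
  unfold fluxp'
  ring

theorem hasDerivAt_fluxp₁ {x : ℝ} (h0 : HasDerivAt w₀ (w₁ x) x) (h1 : HasDerivAt w₁ (w₂ x) x)
    (h2 : HasDerivAt w₂ (w₃ x) x) :
    HasDerivAt (fun x => fluxp₁ A D μ (w₀ x) (w₁ x) (w₂ x))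
      (fluxp₁' A D μ (w₀ x) (w₁ x) (w₂ x) (w₃ x)) x := by
  have T := (((h2.fun_mul h2).const_mul (1 / 2)).fun_add
    ((h1.fun_mul h1).const_mul (3 / 2 * μ + 1 / 2 * A))).fun_add
    ((h0.fun_mul h0).const_mul (1 / 2 * D))
  refine T.congr_deriv ?_
  unfold fluxp₁'
  ring

theorem integral_flux_eq_zero (hw : IsWeight κ P p p₁ p₂) [BoundedL2 w₀] [BoundedL2 w₁]
    [BoundedL2 w₂] [BoundedL2 w₃] [BoundedL2 w₄] [BoundedL2 W] [BoundedL2 W₁] [BoundedL2 W₂]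
    [BoundedL2 K₁] [BoundedL2 K₂]
    (h0 : ∀ x, HasDerivAt w₀ (w₁ x) x) (h1 : ∀ x, HasDerivAt w₁ (w₂ x) x)
    (h2 : ∀ x, HasDerivAt w₂ (w₃ x) x) (h3 : ∀ x, HasDerivAt w₃ (w₄ x) x)
    (hW : ∀ x, HasDerivAt W (W₁ x) x) (hW1 : ∀ x, HasDerivAt W₁ (W₂ x) x)
    (hK : ∀ x, HasDerivAt K₁ (K₂ x) x) :
    Integrable (fun x =>
      fluxP' A D (w₀ x) (w₁ x) (w₂ x) (w₃ x) (w₄ x) (W x) (W₁ x) (W₂ x) (K₁ x) (K₂ x) * P x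
      - fluxP A D (w₀ x) (w₁ x) (w₂ x) (w₃ x) (W x) (W₁ x) (K₁ x) * p x
      + fluxp' A D μ (w₀ x) (w₁ x) (w₂ x) (w₃ x) (w₄ x) * p x
      + fluxp A D μ (w₀ x) (w₁ x) (w₂ x) (w₃ x) * p₁ x
      + fluxp₁' A D μ (w₀ x) (w₁ x) (w₂ x) (w₃ x) * p₁ x
      + fluxp₁ A D μ (w₀ x) (w₁ x) (w₂ x) * p₂ x) ∧
    ∫ x, (fluxP' A D (w₀ x) (w₁ x) (w₂ x) (w₃ x) (w₄ x) (W x) (W₁ x) (W₂ x) (K₁ x) (K₂ x) * P x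
      - fluxP A D (w₀ x) (w₁ x) (w₂ x) (w₃ x) (W x) (W₁ x) (K₁ x) * p x
      + fluxp' A D μ (w₀ x) (w₁ x) (w₂ x) (w₃ x) (w₄ x) * p x
      + fluxp A D μ (w₀ x) (w₁ x) (w₂ x) (w₃ x) * p₁ x
      + fluxp₁' A D μ (w₀ x) (w₁ x) (w₂ x) (w₃ x) * p₁ x
      + fluxp₁ A D μ (w₀ x) (w₁ x) (w₂ x) * p₂ x) = 0 := by
  have := hw.bounded
  have := hw.bounded₁
  have := hw.bounded₂
  have := hw.bounded₃
  have i1 := boundedL1_fluxP A D (w₀ := w₀) (w₁ := w₁) (w₂ := w₂) (w₃ := w₃) (W := W) (W₁ := W₁)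
    (K₁ := K₁)
  have i2 := boundedL1_fluxP' A D (w₀ := w₀) (w₁ := w₁) (w₂ := w₂) (w₃ := w₃) (w₄ := w₄) (W := W)
    (W₁ := W₁) (W₂ := W₂) (K₁ := K₁) (K₂ := K₂)
  have i3 := boundedL1_fluxp A D μ (w₀ := w₀) (w₁ := w₁) (w₂ := w₂) (w₃ := w₃)
  have i4 := boundedL1_fluxp' A D μ (w₀ := w₀) (w₁ := w₁) (w₂ := w₂) (w₃ := w₃) (w₄ := w₄)
  have i5 := boundedL1_fluxp₁ A D μ (w₀ := w₀) (w₁ := w₁) (w₂ := w₂)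
  have i6 := boundedL1_fluxp₁' A D μ (w₀ := w₀) (w₁ := w₁) (w₂ := w₂) (w₃ := w₃)
  have j1 := i2.integrable_mul (g := P)
  have j2 := i1.integrable_mul (g := p)
  have j3 := i4.integrable_mul (g := p)
  have j4 := i3.integrable_mul (g := p₁)
  have j5 := i6.integrable_mul (g := p₁)
  have j6 := i5.integrable_mul (g := p₂)
  have k1 := i1.integrable_mul (g := P)
  have k2 := i3.integrable_mul (g := p)
  have k3 := i5.integrable_mul (g := p₁)
  have hint := ((((j1.sub j2).add j3).add j4).add j5).add j6
  refine ⟨hint, ?_⟩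
  refine integral_eq_zero_of_hasDerivAt_of_integrable (fun x => ?_) hint ((k1.add k2).add k3)
  have d1 := (hasDerivAt_fluxP A D (h0 x) (h1 x) (h2 x) (h3 x) (hW x) (hW1 x) (hK x)).mul
    (hw.hasDerivAt x)
  have d2 := (hasDerivAt_fluxp A D μ (h0 x) (h1 x) (h2 x) (h3 x)).mul (hw.hasDerivAt₁ x)
  have d3 := (hasDerivAt_fluxp₁ A D μ (h0 x) (h1 x) (h2 x)).mul (hw.hasDerivAt₂ x)
  refine ((d1.add d2).add d3).congr_deriv ?_
  ring

end Flux

/-! ### Lower bound for the growth rate of the localized functional -/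

/-- Coercivity of the quadratic part of the flux. -/
structure Coercive (c κ A D m μ : ℝ) : Prop where
  mu_nonneg : 0 ≤ μ
  D_nonneg : 0 ≤ D
  two : c ≤ m / 2 + 3 / 2 * A + 3 * μ - κ / 2
  one : c ≤ m * A / 2 + 3 / 2 * D - 3 / 2 * μ ^ 2 - κ * (|A| / 2 + 3 / 2 * μ)
  zero : c ≤ D * m / 2 - κ * D / 2

/-- The constant in front of the cubic part of the flux. -/
noncomputable def fluxConst (A D m B : ℝ) : ℝ :=
  B ^ 5 * (50 + 4 * |m| + 6 * |A| + |A * m| + |D|)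

/-- The constant in front of the commutators. -/
noncomputable def commConst (A D B : ℝ) : ℝ := B ^ 4 * (18 + 3 * |A| + |D|)

theorem fluxConst_nonneg {A D m B : ℝ} (hB : 1 ≤ B) : 0 ≤ fluxConst A D m B := by
  unfold fluxConst; positivity

theorem commConst_nonneg {A D B : ℝ} (hB : 1 ≤ B) : 0 ≤ commConst A D B := by
  unfold commConst; positivity

/-- The form in `p₂` loses at most κ p times its coefficients in absolute value, and `Coercive`
includes this loss. The alternative `p = 0` serves the constant weight: it forces `p₂ = 0` and both
sides vanish. -/
theorem quad_lower_bound {c κ A D m μ w₀ w₁ w₂ p p₂ : ℝ} (hc : Coercive c κ A D m μ ∨ p = 0)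
    (hp : 0 ≤ p) (hpp2 : |p₂| ≤ κ * p) :
    c * (w₀ ^ 2 + w₁ ^ 2 + w₂ ^ 2) * p ≤ ((m / 2 + 3 / 2 * A + 3 * μ) * w₂ ^ 2
      + (m * A / 2 + 3 / 2 * D - 3 / 2 * μ ^ 2) * w₁ ^ 2 + m * D / 2 * w₀ ^ 2) * p
    - (1 / 2 * w₂ ^ 2 + (1 / 2 * A + 3 / 2 * μ) * w₁ ^ 2 + 1 / 2 * D * w₀ ^ 2) * p₂ := by
  rcases hc with hc | hp0
  · have m0 := hc.mu_nonneg
    have d0 := hc.D_nonneg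
    have hb : |1 / 2 * w₂ ^ 2 + (1 / 2 * A + 3 / 2 * μ) * w₁ ^ 2 + 1 / 2 * D * w₀ ^ 2| ≤
        1 / 2 * w₂ ^ 2 + (|A| / 2 + 3 / 2 * μ) * w₁ ^ 2 + 1 / 2 * D * w₀ ^ 2 := by
      have a1 : |(1 / 2 * A + 3 / 2 * μ) * w₁ ^ 2| ≤ (|A| / 2 + 3 / 2 * μ) * w₁ ^ 2 := by
        rw [abs_mul, abs_of_nonneg (sq_nonneg w₁)]
        refine mul_le_mul_of_nonneg_right ((abs_add_le _ _).trans (le_of_eq ?_)) (sq_nonneg _)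
        rw [abs_mul, abs_of_nonneg (show (0 : ℝ) ≤ 3 / 2 * μ by positivity),
          abs_of_nonneg (show (0 : ℝ) ≤ 1 / 2 by norm_num)]
        ring
      refine (abs_add_le _ _).trans (add_le_add ((abs_add_le _ _).trans (add_le_add ?_ a1)) ?_)
      · rw [abs_of_nonneg (by positivity)]
      · rw [abs_of_nonneg (by positivity)]
    have r1 : (1 / 2 * w₂ ^ 2 + (1 / 2 * A + 3 / 2 * μ) * w₁ ^ 2 + 1 / 2 * D * w₀ ^ 2) * p₂
        ≤ (1 / 2 * w₂ ^ 2 + (|A| / 2 + 3 / 2 * μ) * w₁ ^ 2 + 1 / 2 * D * w₀ ^ 2) * (κ * p) := by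
      refine (le_abs_self _).trans ?_
      rw [abs_mul]
      exact mul_le_mul hb hpp2 (abs_nonneg _) ((abs_nonneg _).trans hb)
    have r2 := mul_nonneg (sub_nonneg.2 hc.two) (mul_nonneg (sq_nonneg w₂) hp)
    have r3 := mul_nonneg (sub_nonneg.2 hc.one) (mul_nonneg (sq_nonneg w₁) hp)
    have r4 := mul_nonneg (sub_nonneg.2 hc.zero) (mul_nonneg (sq_nonneg w₀) hp)
    linarith
  · have : p₂ = 0 := by
      rw [hp0, mul_zero] at hpp2
      exact abs_eq_zero.1 (le_antisymm hpp2 (abs_nonneg _))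
    rw [hp0, this]; simp

/-- The part of `η` coming from `δ` is paid by the coercivity constant; in the part coming from `g`
the weight turns `g * p` into the integrable error `e`. -/
theorem cubic_bound {c A D m B δ g e η S p : ℝ} (hB : 1 ≤ B) (hη : η ≤ 2 * δ + 2 * g)
    (hS : 0 ≤ S) (hp : 0 ≤ p) (hge : g * p ≤ e) (hδ : 2 * fluxConst A D m B * δ ≤ c) :
    fluxConst A D m B * (η * S * p) ≤ c * S * p + 2 * fluxConst A D m B * e * S := by
  have k1 := fluxConst_nonneg (A := A) (D := D) (m := m) hB
  have q2 := mul_le_mul_of_nonneg_right hδ (mul_nonneg hS hp)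
  have q3 := mul_le_mul_of_nonneg_right hge hS
  calc _ ≤ fluxConst A D m B * ((2 * δ + 2 * g) * S * p) := by gcongr
    _ = 2 * fluxConst A D m B * δ * (S * p) + 2 * fluxConst A D m B * (g * p * S) := by ring
    _ ≤ c * (S * p) + 2 * fluxConst A D m B * (e * S) := by gcongr
    _ = _ := by ring

/-- Young's inequality weighted by ε. The commutators `N₁`, `N₂` being O(ε) in L², both terms on the
right are O(ε) after integration. -/
theorem comm_bound {K ε w₀ w₁ w₂ N₁ N₂ : ℝ} (hK : 0 ≤ K) (hε : 0 < ε) :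
    K * ((|w₀| + |w₁| + |w₂|) * (|N₁| + |N₂|)) ≤
      3 / 2 * K * ε * (w₀ ^ 2 + w₁ ^ 2 + w₂ ^ 2) + K / ε * (N₁ ^ 2 + N₂ ^ 2) := by
  have q1 : (|w₀| + |w₁| + |w₂|) ^ 2 ≤ 3 * (w₀ ^ 2 + w₁ ^ 2 + w₂ ^ 2) := by
    rw [← sq_abs w₀, ← sq_abs w₁, ← sq_abs w₂]
    nlinarith [sq_nonneg (|w₀| - |w₁|), sq_nonneg (|w₀| - |w₂|), sq_nonneg (|w₁| - |w₂|)]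
  have q2 : (|N₁| + |N₂|) ^ 2 ≤ 2 * (N₁ ^ 2 + N₂ ^ 2) := by
    rw [← sq_abs N₁, ← sq_abs N₂]
    nlinarith [sq_nonneg (|N₁| - |N₂|)]
  have q3 : (|w₀| + |w₁| + |w₂|) * (|N₁| + |N₂|) ≤
      ε / 2 * (|w₀| + |w₁| + |w₂|) ^ 2 + 1 / (2 * ε) * (|N₁| + |N₂|) ^ 2 := by
    have : 0 ≤ 1 / (2 * ε) * (ε * (|w₀| + |w₁| + |w₂|) - (|N₁| + |N₂|)) ^ 2 := by positivity
    have e1 : 1 / (2 * ε) * (ε * (|w₀| + |w₁| + |w₂|) - (|N₁| + |N₂|)) ^ 2 =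
      ε / 2 * (|w₀| + |w₁| + |w₂|) ^ 2 + 1 / (2 * ε) * (|N₁| + |N₂|) ^ 2
      - (|w₀| + |w₁| + |w₂|) * (|N₁| + |N₂|) := by field_simp; ring
    linarith
  calc _ ≤ K * (ε / 2 * (3 * (w₀ ^ 2 + w₁ ^ 2 + w₂ ^ 2))
        + 1 / (2 * ε) * (2 * (N₁ ^ 2 + N₂ ^ 2))) := by
        refine mul_le_mul_of_nonneg_left (q3.trans ?_) hK
        gcongr
    _ = _ := by field_simp

/-- Here `w` is the mollified third derivative, of size o(1/ε), and `N` is a commutator of size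
O(ε). With these weights the second term integrates to O(τ), and the first vanishes as ε → 0 for
each fixed τ. -/
theorem product_bound {ε τ w N P : ℝ} (hP : 0 ≤ P) (hP1 : P ≤ 1) (hε : 0 < ε) (hτ : 0 < τ) :
    -(ε ^ 2 / (2 * τ) * w ^ 2 + τ / (2 * ε ^ 2) * N ^ 2) ≤ w * N * P := by
  have q1 : |w * N * P| ≤ |w| * |N| := by
    rw [abs_mul, abs_mul, abs_of_nonneg hP]
    exact mul_le_of_le_one_right (by positivity) hP1
  have q2 : |w| * |N| ≤ ε ^ 2 / (2 * τ) * w ^ 2 + τ / (2 * ε ^ 2) * N ^ 2 := by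
    have : 0 ≤ 1 / (2 * ε ^ 2 * τ) * (ε ^ 2 * |w| - τ * |N|) ^ 2 := by positivity
    have e1 : 1 / (2 * ε ^ 2 * τ) * (ε ^ 2 * |w| - τ * |N|) ^ 2 =
        ε ^ 2 / (2 * τ) * |w| ^ 2 + τ / (2 * ε ^ 2) * |N| ^ 2 - |w| * |N| := by
      field_simp; ring
    rw [sq_abs, sq_abs] at e1
    linarith
  have := neg_abs_le (w * N * P)
  linarith

theorem lower_bound_of_parts {Z R₁ R₂ R₃ w Q q F N M X c e : ℝ} (hw : 0 ≤ w) (hQ : c ≤ Q - q)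
    (hF : |F| ≤ X) (hX : X ≤ c + e) (hN : -R₂ ≤ N) (hM : |M| ≤ R₁ + R₃) :
    Z - (e + R₁) - R₂ - R₃ ≤ Z + w + Q - q + F + N + M := by
  have h1 := (abs_le.1 hF).1
  have h2 := (abs_le.1 hM).1
  linarith

theorem flux_lower_bound {c κ A D m μ B δ g e ε τ w₀ w₁ w₂ w₃ w₄ w₅ K₁ K₂ K₃ P p p₁ p₂ : ℝ}
    (hc : Coercive c κ A D m μ ∨ p = 0) (hB : 1 ≤ B) (h0 : |w₀| ≤ B) (h1 : |w₁| ≤ B)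
    (hP : 0 ≤ P) (hP1 : P ≤ 1) (hp : 0 ≤ p) (hp1 : p ≤ 1) (hpp : |p₁| ≤ p) (hpp2 : |p₂| ≤ κ * p)
    (g0 : |w₀| ≤ δ + g) (g1 : |w₁| ≤ δ + g) (hge : g * p ≤ e)
    (hδ : 2 * fluxConst A D m B * δ ≤ c) (hε : 0 < ε) (hτ : 0 < τ) :
    (fluxP' A D w₀ w₁ w₂ w₃ w₄ (-(w₃ + K₁)) (-(w₄ + K₂)) (-(w₅ + K₃)) K₁ K₂ * P
      - fluxP A D w₀ w₁ w₂ w₃ (-(w₃ + K₁)) (-(w₄ + K₂)) K₁ * p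
      + fluxp' A D μ w₀ w₁ w₂ w₃ w₄ * p + fluxp A D μ w₀ w₁ w₂ w₃ * p₁
      + fluxp₁' A D μ w₀ w₁ w₂ w₃ * p₁ + fluxp₁ A D μ w₀ w₁ w₂ * p₂)
    - (2 * fluxConst A D m B * e * (w₀ ^ 2 + w₁ ^ 2 + w₂ ^ 2)
      + 3 / 2 * commConst A D B * ε * (w₀ ^ 2 + w₁ ^ 2 + w₂ ^ 2))
    - (ε ^ 2 / (2 * τ) * w₃ ^ 2 + τ / (2 * ε ^ 2) * (K₂ - 6 * w₀ * w₁ ^ 2 - 3 * w₀ ^ 2 * w₂) ^ 2)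
    - commConst A D B / ε * ((K₁ - 3 * w₀ ^ 2 * w₁) ^ 2
      + (K₂ - 6 * w₀ * w₁ ^ 2 - 3 * w₀ ^ 2 * w₂) ^ 2)
    ≤ densVar A D w₀ w₁ w₂ (-(w₃ + K₁)) (-(w₄ + K₂)) (-(w₅ + K₃)) * P
      + m * dens A D w₀ w₁ w₂ * p := by
  rw [flux_identity A D m μ w₀ w₁ w₂ w₃ w₄ w₅ K₁ K₂ K₃ P p p₁ p₂]
  have hS : 0 ≤ w₀ ^ 2 + w₁ ^ 2 + w₂ ^ 2 := by positivity
  exact lower_bound_of_parts (by positivity) (quad_lower_bound hc hp hpp2)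
    (abs_flux_le (A := A) (D := D) (m := m) (w₂ := w₂) hB h0 h1 hp hpp)
    (cubic_bound hB (by linarith) hS hp hge hδ) (product_bound hP hP1 hε hτ)
    ((abs_comm_le hB h0 h1 hP hP1 hp hp1).trans (comm_bound (commConst_nonneg hB) hε))

/-- The variation of the density of the mollified function `w = u * ρ_ε`, in the direction in
which it moves under the equation. -/
noncomputable def rate (A D ε : ℝ) (u u₂ : ℝ → ℝ) (x : ℝ) : ℝ :=
  densVar A D (conv u (moll ε) x) (conv u (deriv (moll ε)) x) (conv u (deriv (deriv (moll ε))) x)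
    (-conv (fun y => u₂ y + u y ^ 3) (deriv (moll ε)) x)
    (-conv (fun y => u₂ y + u y ^ 3) (deriv (deriv (moll ε))) x)
    (-conv (fun y => u₂ y + u y ^ 3) (deriv (deriv (deriv (moll ε)))) x)

/-- The density of the mollified function. -/
noncomputable def mollDens (A D ε : ℝ) (u : ℝ → ℝ) (x : ℝ) : ℝ :=
  dens A D (conv u (moll ε) x) (conv u (deriv (moll ε)) x) (conv u (deriv (deriv (moll ε))) x)

theorem rate_eq {A D ε : ℝ} {u u₁ u₂ : ℝ → ℝ} (h : IsH2Triple u u₁ u₂) (hε : 0 < ε) (x : ℝ) :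
    rate A D ε u u₂ x = densVar A D (conv u (moll ε) x) (conv u₁ (moll ε) x) (conv u₂ (moll ε) x)
      (-(conv u₂ (deriv (moll ε)) x + conv (fun y => 3 * u y ^ 2 * u₁ y) (moll ε) x))
      (-(conv u₂ (deriv (deriv (moll ε))) x +
        conv (fun y => 6 * u y * u₁ y * u₁ y + 3 * u y ^ 2 * u₂ y) (moll ε) x))
      (-(conv u₂ (deriv (deriv (deriv (moll ε)))) x +
        conv (fun y => 6 * u y * u₁ y * u₁ y + 3 * u y ^ 2 * u₂ y) (deriv (moll ε)) x)) := by
  have t0 := isTestFunction_moll hε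
  have hu2 := h.memLp₂.locallyIntegrable_two
  have hu3 := h.memLp_cube.locallyIntegrable_two
  unfold rate
  rw [h.weak₀.conv_deriv t0, h.weak₀.conv_deriv t0.deriv, h.weak₁.conv_deriv t0,
    conv_add_left hu2 hu3 t0.deriv, h.weak_cube.conv_deriv t0,
    conv_add_left hu2 hu3 t0.deriv.deriv, h.weak_cube.conv_deriv t0.deriv,
    h.weak_cube₁.conv_deriv t0, conv_add_left hu2 hu3 t0.deriv.deriv.deriv,
    h.weak_cube.conv_deriv t0.deriv.deriv, h.weak_cube₁.conv_deriv t0.deriv]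

theorem mollDens_eq {A D ε : ℝ} {u u₁ u₂ : ℝ → ℝ} (h : IsH2Triple u u₁ u₂) (hε : 0 < ε) (x : ℝ) :
    mollDens A D ε u x =
      dens A D (conv u (moll ε) x) (conv u₁ (moll ε) x) (conv u₂ (moll ε) x) := by
  have t0 := isTestFunction_moll hε
  unfold mollDens
  rw [h.weak₀.conv_deriv t0, h.weak₀.conv_deriv t0.deriv, h.weak₁.conv_deriv t0]

theorem integrable_rate {κ A D m ε : ℝ} {u u₁ u₂ P p p₁ p₂ : ℝ → ℝ} (h : IsH2Triple u u₁ u₂)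
    (hw : IsWeight κ P p p₁ p₂) (hε : 0 < ε) :
    Integrable fun x => rate A D ε u u₂ x * P x + m * mollDens A D ε u x * p x := by
  have t0 := isTestFunction_moll hε
  have hv : MemLp (fun y => u₂ y + u y ^ 3) 2 := h.memLp₂.add h.memLp_cube
  have := boundedL2_conv h.memLp₀ t0
  have := boundedL2_conv h.memLp₀ t0.deriv
  have := boundedL2_conv h.memLp₀ t0.deriv.deriv
  have := boundedL2_conv hv t0.deriv
  have := boundedL2_conv hv t0.deriv.deriv
  have := boundedL2_conv hv t0.deriv.deriv.deriv
  have := hw.bounded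
  have := hw.bounded₁
  have i1 := boundedL1_densVar A D (w₀ := conv u (moll ε)) (w₁ := conv u (deriv (moll ε)))
    (w₂ := conv u (deriv (deriv (moll ε))))
    (W := -conv (fun y => u₂ y + u y ^ 3) (deriv (moll ε)))
    (W₁ := -conv (fun y => u₂ y + u y ^ 3) (deriv (deriv (moll ε))))
    (W₂ := -conv (fun y => u₂ y + u y ^ 3) (deriv (deriv (deriv (moll ε)))))
  have i2 := boundedL1_dens A D (w₀ := conv u (moll ε)) (w₁ := conv u (deriv (moll ε)))
    (w₂ := conv u (deriv (deriv (moll ε))))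
  have j1 := i1.integrable_mul (g := P)
  have j2 := (i2.integrable_mul (g := p)).const_mul m
  refine (j1.add j2).congr (Eventually.of_forall fun x => ?_)
  simp [rate, mollDens, mul_assoc]

/-- The constant depends only on bounds of the solution, hence is uniform in time and in ε. The term
with the mollified third derivative is kept apart, because its smallness is qualitative: it tends to
0 with ε, without a rate. -/
theorem exists_integral_rate_lower {A D m B H : ℝ} (hB : 1 ≤ B) :
    ∃ C : ℝ, 0 < C ∧ ∀ (c κ μ δ e ε τ : ℝ) (u u₁ u₂ P p p₁ p₂ g : ℝ → ℝ), IsH2Triple u u₁ u₂ →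
    IsWeight κ P p p₁ p₂ → (∀ x, |u x| ≤ B) → (∀ x, |u₁ x| ≤ B) → h2sq u u₁ u₂ ≤ H →
    (∀ x, Coercive c κ A D m μ ∨ p x = 0) → 2 * fluxConst A D m B * δ ≤ c → 0 < ε → ε ≤ 1 →
    0 < τ → 0 ≤ e → (∀ x y, |x - y| ≤ 1 → |u y| ≤ δ + g x) →
    (∀ x y, |x - y| ≤ 1 → |u₁ y| ≤ δ + g x) → (∀ x, g x * p x ≤ e) →
    -(C * (e + ε + τ) + ε ^ 2 / (2 * τ) * l2sq (conv u₂ (deriv (moll ε))))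
      ≤ ∫ x, (rate A D ε u u₂ x * P x + m * mollDens A D ε u x * p x) := by
  obtain ⟨C₀, hC₀, hcomm⟩ := IsH2Triple.exists_l2sq_comm_le
  have k1 := fluxConst_nonneg (A := A) (D := D) (m := m) hB
  have k2 := commConst_nonneg (A := A) (D := D) hB
  refine ⟨2 * fluxConst A D m B * |H| + 3 / 2 * commConst A D B * |H|
    + 2 * commConst A D B * (C₀ * B ^ 4 * |H|) + C₀ * B ^ 4 * |H| + 1, by positivity, ?_⟩
  intro c κ μ δ e ε τ u u₁ u₂ P p p₁ p₂ g h hw hu hu₁ hH hc hδ hε hε1 hτ he g0 g1 hge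
  have t0 := isTestFunction_moll hε
  set ρ := moll ε with hρ
  have hH' : h2sq u u₁ u₂ ≤ |H| := hH.trans (le_abs_self _)
  -- the mollified functions
  have W0 : BoundedL2 (conv u ρ) := boundedL2_conv h.memLp₀ t0
  have W1 : BoundedL2 (conv u₁ ρ) := boundedL2_conv h.memLp₁ t0
  have W2 : BoundedL2 (conv u₂ ρ) := boundedL2_conv h.memLp₂ t0
  have W3 : BoundedL2 (conv u₂ (deriv ρ)) := boundedL2_conv h.memLp₂ t0.deriv
  have W4 : BoundedL2 (conv u₂ (deriv (deriv ρ))) := boundedL2_conv h.memLp₂ t0.deriv.deriv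
  have W5 : BoundedL2 (conv u₂ (deriv (deriv (deriv ρ)))) :=
    boundedL2_conv h.memLp₂ t0.deriv.deriv.deriv
  set f₁ : ℝ → ℝ := fun y => 3 * u y ^ 2 * u₁ y with hf₁
  set f₂ : ℝ → ℝ := fun y => 6 * u y * u₁ y * u₁ y + 3 * u y ^ 2 * u₂ y with hf₂
  have V1 : BoundedL2 (conv f₁ ρ) := boundedL2_conv h.memLp_cube₁ t0
  have V2 : BoundedL2 (conv f₂ ρ) := boundedL2_conv h.memLp_cube₂ t0
  have V3 : BoundedL2 (conv f₂ (deriv ρ)) := boundedL2_conv h.memLp_cube₂ t0.deriv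
  have hu2 := h.memLp₂.locallyIntegrable_two
  have hint := integrable_rate (A := A) (D := D) (m := m) h hw hε
  simp only [rate_eq h hε, mollDens_eq h hε] at hint ⊢
  rw [← hρ] at *
  have d0 : ∀ x, HasDerivAt (conv u ρ) (conv u₁ ρ x) x := fun x => by
    rw [← h.weak₀.conv_deriv t0]; exact hasDerivAt_conv h.memLp₀.locallyIntegrable_two t0 x
  have d1 : ∀ x, HasDerivAt (conv u₁ ρ) (conv u₂ ρ x) x := fun x => by
    rw [← h.weak₁.conv_deriv t0]; exact hasDerivAt_conv h.memLp₁.locallyIntegrable_two t0 x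
  have d2 : ∀ x, HasDerivAt (conv u₂ ρ) (conv u₂ (deriv ρ) x) x := hasDerivAt_conv hu2 t0
  have d3 : ∀ x, HasDerivAt (conv u₂ (deriv ρ)) (conv u₂ (deriv (deriv ρ)) x) x :=
    hasDerivAt_conv hu2 t0.deriv
  have d4 : ∀ x, HasDerivAt (conv u₂ (deriv (deriv ρ))) (conv u₂ (deriv (deriv (deriv ρ))) x) x :=
    hasDerivAt_conv hu2 t0.deriv.deriv
  have q1 : ∀ x, HasDerivAt (conv f₁ ρ) (conv f₂ ρ x) x := fun x => by
    rw [← h.weak_cube₁.conv_deriv t0]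
    exact hasDerivAt_conv h.memLp_cube₁.locallyIntegrable_two t0 x
  have q2 : ∀ x, HasDerivAt (conv f₂ ρ) (conv f₂ (deriv ρ) x) x :=
    hasDerivAt_conv h.memLp_cube₂.locallyIntegrable_two t0
  obtain ⟨hZi, hZ⟩ := integral_flux_eq_zero A D μ (w₀ := conv u ρ) (w₁ := conv u₁ ρ)
    (w₂ := conv u₂ ρ) (w₃ := conv u₂ (deriv ρ)) (w₄ := conv u₂ (deriv (deriv ρ)))
    (W := -(conv u₂ (deriv ρ) + conv f₁ ρ)) (W₁ := -(conv u₂ (deriv (deriv ρ)) + conv f₂ ρ))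
    (W₂ := -(conv u₂ (deriv (deriv (deriv ρ))) + conv f₂ (deriv ρ)))
    (K₁ := conv f₁ ρ) (K₂ := conv f₂ ρ) hw d0 d1 d2 d3 (fun x => ((d3 x).add (q1 x)).neg)
    (fun x => ((d4 x).add (q2 x)).neg) q1
  simp only [Pi.neg_apply, Pi.add_apply] at hZi hZ
  obtain ⟨n1, n2⟩ := hcomm u u₁ u₂ h B hu hu₁ ε hε
  set N₁ : ℝ → ℝ := fun x => conv f₁ ρ x - 3 * conv u ρ x ^ 2 * conv u₁ ρ x with hN₁
  set N₂ : ℝ → ℝ := fun x => conv f₂ ρ x - 6 * conv u ρ x * conv u₁ ρ x ^ 2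
    - 3 * conv u ρ x ^ 2 * conv u₂ ρ x with hN₂
  have mN1 : MemLp N₁ 2 := by
    have e : N₁ = conv f₁ ρ - (3 : ℝ) • (conv u ρ * conv u ρ * conv u₁ ρ) := by
      ext x; simp [hN₁]; ring
    rw [e]; exact BoundedL2.memLp
  have mN2 : MemLp N₂ 2 := by
    have e : N₂ = conv f₂ ρ - (6 : ℝ) • (conv u ρ * conv u₁ ρ * conv u₁ ρ)
        - (3 : ℝ) • (conv u ρ * conv u ρ * conv u₂ ρ) := by
      ext x; simp [hN₂]; ring
    rw [e]; exact BoundedL2.memLp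
  have i0 := W0.memLp.integrable_sq
  have i1 := W1.memLp.integrable_sq
  have i2 := W2.memLp.integrable_sq
  have i3 := W3.memLp.integrable_sq
  have j1 := mN1.integrable_sq
  have j2 := mN2.integrable_sq
  have I1 := ((i0.add i1).add i2).const_mul
    (2 * fluxConst A D m B * e)
  have I1' := ((i0.add i1).add i2).const_mul (3 / 2 * commConst A D B * ε)
  have I2 := (i3.const_mul (ε ^ 2 / (2 * τ))).add (j2.const_mul (τ / (2 * ε ^ 2)))
  have I3 := (j1.add j2).const_mul (commConst A D B / ε)
  -- The pointwise lower bound `flux_lower_bound` is integrated. Its exact-derivative part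
  -- contributes zero and the squares become L² norms.
  have key := integral_mono (((hZi.sub (I1.add I1')).sub I2).sub I3) hint (fun x => by
    have b0 : |conv u ρ x| ≤ B :=
      abs_conv_moll_le hε h.memLp₀.locallyIntegrable_two fun y _ => hu y
    have b1 : |conv u₁ ρ x| ≤ B :=
      abs_conv_moll_le hε h.memLp₁.locallyIntegrable_two fun y _ => hu₁ y
    have c0 : |conv u ρ x| ≤ δ + g x :=
      abs_conv_moll_le hε h.memLp₀.locallyIntegrable_two fun y hy => g0 x y (hy.trans hε1)
    have c1 : |conv u₁ ρ x| ≤ δ + g x :=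
      abs_conv_moll_le hε h.memLp₁.locallyIntegrable_two fun y hy => g1 x y (hy.trans hε1)
    have := flux_lower_bound (w₂ := conv u₂ ρ x) (w₃ := conv u₂ (deriv ρ) x)
      (w₄ := conv u₂ (deriv (deriv ρ)) x) (w₅ := conv u₂ (deriv (deriv (deriv ρ))) x)
      (K₁ := conv f₁ ρ x) (K₂ := conv f₂ ρ x) (K₃ := conv f₂ (deriv ρ) x)
      (hc x) hB b0 b1 (hw.nonneg x) (hw.le_one x) (hw.nonneg₁ x) (hw.le_one₁ x) (hw.abs_le₁ x)
      (hw.abs_le₂ x) c0 c1 (hge x) hδ hε hτ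
    exact this)
  have E := (integral_sub ((hZi.sub (I1.add I1')).sub I2) I3).trans (congrArg₂ _
      ((integral_sub (hZi.sub (I1.add I1')) I2).trans
        (congrArg₂ _ (integral_sub hZi (I1.add I1')) rfl)) rfl)
  refine le_trans ?_ (E.symm.le.trans key)
  rw [hZ, integral_add' I1 I1', integral_add' (i3.const_mul _) (j2.const_mul _)]
  simp only [integral_const_mul]
  have E2 : ∫ x, (((fun x => conv u ρ x ^ 2) + fun x => conv u₁ ρ x ^ 2)
      + fun x => conv u₂ ρ x ^ 2) x = l2sq (conv u ρ) + l2sq (conv u₁ ρ) + l2sq (conv u₂ ρ) :=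
    (integral_add (i0.add i1) i2).trans (congrArg₂ _ (integral_add i0 i1) rfl)
  have E3 : ∫ x, ((fun x => N₁ x ^ 2) + fun x => N₂ x ^ 2) x = l2sq N₁ + l2sq N₂ :=
    integral_add j1 j2
  rw [E2, E3]
  change _ ≤ 0 - (2 * fluxConst A D m B * e * (l2sq (conv u ρ) + l2sq (conv u₁ ρ)
    + l2sq (conv u₂ ρ)) + 3 / 2 * commConst A D B * ε *
    (l2sq (conv u ρ) + l2sq (conv u₁ ρ) + l2sq (conv u₂ ρ))) -
    (ε ^ 2 / (2 * τ) * l2sq (conv u₂ (deriv ρ)) + τ / (2 * ε ^ 2) * l2sq N₂) -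
    commConst A D B / ε * (l2sq N₁ + l2sq N₂)
  have s0 := l2sq_conv_moll_le h.memLp₀ hε
  have s1 := l2sq_conv_moll_le h.memLp₁ hε
  have s2 := l2sq_conv_moll_le h.memLp₂ hε
  have hS : l2sq (conv u ρ) + l2sq (conv u₁ ρ) + l2sq (conv u₂ ρ) ≤ |H| := by
    unfold h2sq at hH'; linarith
  have hn : C₀ * B ^ 4 * ε ^ 2 * h2sq u u₁ u₂ ≤ (C₀ * B ^ 4 * |H|) * ε ^ 2 := by
    have : 0 ≤ C₀ * B ^ 4 * ε ^ 2 := by positivity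
    nlinarith
  have r1 : 2 * fluxConst A D m B * e * (l2sq (conv u ρ) + l2sq (conv u₁ ρ)
      + l2sq (conv u₂ ρ)) ≤ 2 * fluxConst A D m B * e * |H| := by gcongr
  have r1' : 3 / 2 * commConst A D B * ε * (l2sq (conv u ρ) + l2sq (conv u₁ ρ)
      + l2sq (conv u₂ ρ)) ≤ 3 / 2 * commConst A D B * ε * |H| := by gcongr
  have r2 : τ / (2 * ε ^ 2) * l2sq N₂ ≤ τ * (C₀ * B ^ 4 * |H|) := by
    calc _ ≤ τ / (2 * ε ^ 2) * ((C₀ * B ^ 4 * |H|) * ε ^ 2) := by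
          gcongr; exact n2.trans hn
      _ = τ * (C₀ * B ^ 4 * |H|) / 2 := by field_simp
      _ ≤ _ := by
          have : 0 ≤ τ * (C₀ * B ^ 4 * |H|) := by positivity
          linarith
  have r3 : commConst A D B / ε * (l2sq N₁ + l2sq N₂) ≤
      2 * commConst A D B * (C₀ * B ^ 4 * |H|) * ε := by
    calc _ ≤ commConst A D B / ε * ((C₀ * B ^ 4 * |H|) * ε ^ 2 + (C₀ * B ^ 4 * |H|) * ε ^ 2) := by
          gcongr
          exacts [n1.trans hn, n2.trans hn]
      _ = _ := by field_simp; ring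
  have z1 : 0 ≤ 2 * fluxConst A D m B * |H| := by positivity
  have z2 : 0 ≤ 3 / 2 * commConst A D B * |H| := by positivity
  have z3 : 0 ≤ 2 * commConst A D B * (C₀ * B ^ 4 * |H|) := by positivity
  have z4 : 0 ≤ C₀ * B ^ 4 * |H| := by positivity
  nlinarith [mul_nonneg z1 hε.le, mul_nonneg z1 hτ.le, mul_nonneg z2 he, mul_nonneg z2 hτ.le,
    mul_nonneg z3 he, mul_nonneg z3 hτ.le, mul_nonneg z4 he, mul_nonneg z4 hε.le]

/-! ### Continuity of the functionals in `H²` -/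

/-- A Lipschitz constant for the density. -/
noncomputable def densConst (A D B : ℝ) : ℝ :=
  1 / 2 + 5 / 2 * B ^ 2 + 3 / 4 * B ^ 4 + |A| * (1 / 2 + 1 / 2 * B ^ 2) + |D| * (1 / 2)

theorem densConst_nonneg (A D B : ℝ) : 0 ≤ densConst A D B := by
  unfold densConst; positivity

/-- All terms are differences of squares, up to factors bounded by powers of `B`, and x² - y² = (x -
y)(x + y). The arrangement a₀a₁ - b₀b₁ = a₀(a₁ - b₁) + (a₀ - b₀)b₁ dispenses with a bound on `a₁`.
-/
theorem abs_dens_sub_le {A D B a₀ a₁ a₂ b₀ b₁ b₂ : ℝ} (ha₀ : |a₀| ≤ B) (hb₀ : |b₀| ≤ B)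
    (hb₁ : |b₁| ≤ B) :
    |dens A D a₀ a₁ a₂ - dens A D b₀ b₁ b₂| ≤ densConst A D B *
      ((|a₀ - b₀| + |a₁ - b₁| + |a₂ - b₂|) *
        (|a₀| + |a₁| + |a₂| + (|b₀| + |b₁| + |b₂|))) := by
  set Δ := |a₀ - b₀| + |a₁ - b₁| + |a₂ - b₂| with hΔ
  set S := |a₀| + |a₁| + |a₂| + (|b₀| + |b₁| + |b₂|) with hS
  have n1 := abs_nonneg (a₀ - b₀)
  have n2 := abs_nonneg (a₁ - b₁)
  have n3 := abs_nonneg (a₂ - b₂)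
  have n4 := abs_nonneg a₀
  have n5 := abs_nonneg a₁
  have n6 := abs_nonneg a₂
  have n7 := abs_nonneg b₀
  have n8 := abs_nonneg b₁
  have n9 := abs_nonneg b₂
  have hB : 0 ≤ B := n4.trans ha₀
  have sq2 : ∀ x y d s : ℝ, |x - y| ≤ d → |x| + |y| ≤ s → |x ^ 2 - y ^ 2| ≤ d * s := by
    intro x y d s h1 h2
    have e : x ^ 2 - y ^ 2 = (x - y) * (x + y) := by ring
    rw [e, abs_mul]
    exact mul_le_mul h1 ((abs_add_le _ _).trans h2) (abs_nonneg _) ((abs_nonneg _).trans h1)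
  have q0 : |a₀ ^ 2 - b₀ ^ 2| ≤ Δ * S := sq2 _ _ _ _ (by linarith) (by linarith)
  have q1 : |a₁ ^ 2 - b₁ ^ 2| ≤ Δ * S := sq2 _ _ _ _ (by linarith) (by linarith)
  have q2 : |a₂ ^ 2 - b₂ ^ 2| ≤ Δ * S := sq2 _ _ _ _ (by linarith) (by linarith)
  have q01 : |(a₀ * a₁) ^ 2 - (b₀ * b₁) ^ 2| ≤ B ^ 2 * (Δ * S) := by
    have : |(a₀ * a₁) ^ 2 - (b₀ * b₁) ^ 2| ≤ (B * Δ) * (B * S) := by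
      refine sq2 _ _ _ _ ?_ ?_
      · have e : a₀ * a₁ - b₀ * b₁ = a₀ * (a₁ - b₁) + (a₀ - b₀) * b₁ := by ring
        rw [e]
        refine (abs_add_le _ _).trans ?_
        rw [abs_mul, abs_mul]
        have h1 : |a₀| * |a₁ - b₁| ≤ B * |a₁ - b₁| := by gcongr
        have h2 : |a₀ - b₀| * |b₁| ≤ |a₀ - b₀| * B := by gcongr
        have h3 : 0 ≤ B * |a₂ - b₂| := by positivity
        rw [hΔ]; linarith
      · rw [abs_mul, abs_mul]
        have h1 : |a₀| * |a₁| ≤ B * |a₁| := by gcongr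
        have h2 : |b₀| * |b₁| ≤ B * |b₁| := by gcongr
        have h3 : 0 ≤ B * (|a₀| + |a₂| + |b₀| + |b₂|) := by positivity
        rw [hS]; linarith
    linarith
  have p0 : a₀ ^ 2 ≤ B ^ 2 := sq_le_sq' (by linarith [neg_abs_le a₀]) (by linarith [le_abs_self a₀])
  have p1 : b₀ ^ 2 ≤ B ^ 2 := sq_le_sq' (by linarith [neg_abs_le b₀]) (by linarith [le_abs_self b₀])
  have q4 : |a₀ ^ 4 - b₀ ^ 4| ≤ 2 * B ^ 2 * (Δ * S) := by
    have e : a₀ ^ 4 - b₀ ^ 4 = (a₀ ^ 2 + b₀ ^ 2) * (a₀ ^ 2 - b₀ ^ 2) := by ring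
    rw [e, abs_mul, abs_of_nonneg (by positivity : 0 ≤ a₀ ^ 2 + b₀ ^ 2)]
    exact mul_le_mul (by linarith) q0 (abs_nonneg _) (by positivity)
  have q6 : |a₀ ^ 6 - b₀ ^ 6| ≤ 3 * B ^ 4 * (Δ * S) := by
    have e : a₀ ^ 6 - b₀ ^ 6 = (a₀ ^ 2 * a₀ ^ 2 + a₀ ^ 2 * b₀ ^ 2 + b₀ ^ 2 * b₀ ^ 2)
      * (a₀ ^ 2 - b₀ ^ 2) := by ring
    rw [e, abs_mul, abs_of_nonneg (by positivity)]
    refine mul_le_mul ?_ q0 (abs_nonneg _) (by positivity)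
    have := mul_le_mul p0 p0 (sq_nonneg _) (sq_nonneg _)
    have := mul_le_mul p0 p1 (sq_nonneg _) (sq_nonneg _)
    have := mul_le_mul p1 p1 (sq_nonneg _) (sq_nonneg _)
    nlinarith
  have e : dens A D a₀ a₁ a₂ - dens A D b₀ b₁ b₂ = 1 / 2 * (a₂ ^ 2 - b₂ ^ 2)
      - 5 / 2 * ((a₀ * a₁) ^ 2 - (b₀ * b₁) ^ 2) + 1 / 4 * (a₀ ^ 6 - b₀ ^ 6)
      + (1 / 2 * A) * (a₁ ^ 2 - b₁ ^ 2) - (1 / 4 * A) * (a₀ ^ 4 - b₀ ^ 4)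
      - (-(1 / 2 * D)) * (a₀ ^ 2 - b₀ ^ 2) := by unfold dens; ring
  rw [e]
  refine (abs_six_le _ _ _ _ _ _).trans ?_
  simp only [abs_mul, abs_neg]
  rw [show |(1 / 2 : ℝ)| = 1 / 2 by norm_num, show |(5 / 2 : ℝ)| = 5 / 2 by norm_num,
    show |(1 / 4 : ℝ)| = 1 / 4 by norm_num]
  have r1 : 1 / 2 * |A| * |a₁ ^ 2 - b₁ ^ 2| ≤ 1 / 2 * |A| * (Δ * S) := by gcongr
  have r2 : 1 / 4 * |A| * |a₀ ^ 4 - b₀ ^ 4| ≤ 1 / 4 * |A| * (2 * B ^ 2 * (Δ * S)) := by gcongr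
  have r3 : 1 / 2 * |D| * |a₀ ^ 2 - b₀ ^ 2| ≤ 1 / 2 * |D| * (Δ * S) := by gcongr
  unfold densConst
  linarith

/-- Young's inequality with a free parameter: first `θ` is taken small against the bounded norms,
then the difference is taken small against `θ`. -/
theorem mul_sum_le {d₀ d₁ d₂ a₀ a₁ a₂ b₀ b₁ b₂ θ : ℝ} (hθ : 0 < θ) :
    (|d₀| + |d₁| + |d₂|) * (|a₀| + |a₁| + |a₂| + (|b₀| + |b₁| + |b₂|)) ≤
      2 / θ * (d₀ ^ 2 + d₁ ^ 2 + d₂ ^ 2) +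
        3 * θ * (a₀ ^ 2 + a₁ ^ 2 + a₂ ^ 2 + (b₀ ^ 2 + b₁ ^ 2 + b₂ ^ 2)) := by
  set Δ := |d₀| + |d₁| + |d₂| with hΔ
  set S := |a₀| + |a₁| + |a₂| + (|b₀| + |b₁| + |b₂|) with hS
  have h3 : ∀ x y z : ℝ, (x + y + z) ^ 2 ≤ 3 * (x ^ 2 + y ^ 2 + z ^ 2) := fun x y z => by
    nlinarith [sq_nonneg (x - y), sq_nonneg (y - z), sq_nonneg (x - z)]
  have h1 : Δ ^ 2 ≤ 3 * (d₀ ^ 2 + d₁ ^ 2 + d₂ ^ 2) := by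
    have := h3 |d₀| |d₁| |d₂|; simpa only [sq_abs] using this
  have h2 : S ^ 2 ≤ 6 * (a₀ ^ 2 + a₁ ^ 2 + a₂ ^ 2 + (b₀ ^ 2 + b₁ ^ 2 + b₂ ^ 2)) := by
    have u := h3 |a₀| |a₁| |a₂|
    have v := h3 |b₀| |b₁| |b₂|
    simp only [sq_abs] at u v
    have w : S ^ 2 ≤ 2 * (|a₀| + |a₁| + |a₂|) ^ 2 + 2 * (|b₀| + |b₁| + |b₂|) ^ 2 := by
      nlinarith [sq_nonneg (|a₀| + |a₁| + |a₂| - (|b₀| + |b₁| + |b₂|))]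
    linarith
  have h4 : Δ * S ≤ 1 / 2 / θ * Δ ^ 2 + θ / 2 * S ^ 2 := by
    have : 0 ≤ 1 / 2 / θ * (Δ - θ * S) ^ 2 := by positivity
    have e : 1 / 2 / θ * (Δ - θ * S) ^ 2 = 1 / 2 / θ * Δ ^ 2 + θ / 2 * S ^ 2 - Δ * S := by
      field_simp; ring
    linarith
  have h5 : 1 / 2 / θ * Δ ^ 2 ≤ 1 / 2 / θ * (3 * (d₀ ^ 2 + d₁ ^ 2 + d₂ ^ 2)) := by gcongr
  have h6 : θ / 2 * S ^ 2 ≤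
    θ / 2 * (6 * (a₀ ^ 2 + a₁ ^ 2 + a₂ ^ 2 + (b₀ ^ 2 + b₁ ^ 2 + b₂ ^ 2))) := by gcongr
  have h7 : 0 ≤ 1 / 2 / θ * (d₀ ^ 2 + d₁ ^ 2 + d₂ ^ 2) := by positivity
  have e7 : 2 / θ * (d₀ ^ 2 + d₁ ^ 2 + d₂ ^ 2) = 4 * (1 / 2 / θ * (d₀ ^ 2 + d₁ ^ 2 + d₂ ^ 2)) := by
    ring
  linarith

namespace IsH2Triple

variable {f f' f'' g g' g'' : ℝ → ℝ}

theorem integrable_sum_sq (h : IsH2Triple f f' f'') :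
    Integrable fun x => f x ^ 2 + f' x ^ 2 + f'' x ^ 2 :=
  (h.memLp₀.integrable_sq.add h.memLp₁.integrable_sq).add h.memLp₂.integrable_sq

theorem integral_sum_sq (h : IsH2Triple f f' f'') :
    ∫ x, (f x ^ 2 + f' x ^ 2 + f'' x ^ 2) = h2sq f f' f'' :=
  (integral_add (h.memLp₀.integrable_sq.add h.memLp₁.integrable_sq)
    h.memLp₂.integrable_sq).trans
    (congrArg₂ _ (integral_add h.memLp₀.integrable_sq h.memLp₁.integrable_sq) rfl)

theorem aestronglyMeasurable_dens (h : IsH2Triple f f' f'') (A D : ℝ) :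
    AEStronglyMeasurable (fun x => dens A D (f x) (f' x) (f'' x)) := by
  have h0 := h.continuous.aestronglyMeasurable (μ := volume)
  have h1 := h.cont.aestronglyMeasurable (μ := volume)
  have h2 := h.memLp₂.aestronglyMeasurable
  unfold dens
  fun_prop

theorem abs_dens_le {B : ℝ} (hf : ∀ x, |f x| ≤ B) (A D x : ℝ) :
    |dens A D (f x) (f' x) (f'' x)| ≤
      densConst A D B * (5 * (f x ^ 2 + f' x ^ 2 + f'' x ^ 2)) := by
  have hB := (abs_nonneg _).trans (hf x)
  have h := abs_dens_sub_le (A := A) (D := D) (a₁ := f' x) (a₂ := f'' x) (b₀ := 0) (b₁ := 0)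
    (b₂ := 0) (hf x) (by simpa using hB) (by simpa using hB)
  have h0 : dens A D 0 0 0 = 0 := by simp [dens]
  have h1 := mul_sum_le (d₀ := f x) (d₁ := f' x) (d₂ := f'' x) (a₀ := f x) (a₁ := f' x)
    (a₂ := f'' x) (b₀ := 0) (b₁ := 0) (b₂ := 0) one_pos
  simp only [sub_zero, h0] at h h1
  refine h.trans (mul_le_mul_of_nonneg_left (h1.trans (by nlinarith)) (densConst_nonneg _ _ _))

theorem integrable_dens (h : IsH2Triple f f' f'') (A D : ℝ) :
    Integrable fun x => dens A D (f x) (f' x) (f'' x) := by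
  obtain ⟨B, hB, h0, h1⟩ := h.exists_bound
  refine ((h.integrable_sum_sq.const_mul 5).const_mul (densConst A D B)).mono'
    (h.aestronglyMeasurable_dens A D) (Eventually.of_forall fun x => ?_)
  exact abs_dens_le h0 A D x

theorem integrable_dens_mul (h : IsH2Triple f f' f'') (A D : ℝ) {Φ : ℝ → ℝ}
    (hΦ : AEStronglyMeasurable Φ) (hb : ∀ x, |Φ x| ≤ 1) :
    Integrable fun x => dens A D (f x) (f' x) (f'' x) * Φ x :=
  (h.integrable_dens A D).mul_bdd (c := 1) hΦ (Eventually.of_forall hb)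

theorem abs_integral_dens_sub_le (hf : IsH2Triple f f' f'') (hg : IsH2Triple g g' g'')
    {A D B θ : ℝ} (h0 : ∀ x, |f x| ≤ B) (k0 : ∀ x, |g x| ≤ B) (k1 : ∀ x, |g' x| ≤ B)
    {Φ : ℝ → ℝ} (hΦ : AEStronglyMeasurable Φ) (hb : ∀ x, |Φ x| ≤ 1) (hθ : 0 < θ) :
    |(∫ x, dens A D (f x) (f' x) (f'' x) * Φ x) - ∫ x, dens A D (g x) (g' x) (g'' x) * Φ x| ≤
      densConst A D B * (2 / θ * h2sq (fun x => f x - g x) (fun x => f' x - g' x)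
        (fun x => f'' x - g'' x) + 3 * θ * (h2sq f f' f'' + h2sq g g' g'')) := by
  rw [← integral_sub (hf.integrable_dens_mul A D hΦ hb) (hg.integrable_dens_mul A D hΦ hb)]
  have hs := hf.sub hg
  have i1 := (hs.integrable_sum_sq.const_mul (2 / θ))
  have i2 := (hf.integrable_sum_sq.add hg.integrable_sum_sq).const_mul (3 * θ)
  have e : densConst A D B * (2 / θ * h2sq (fun x => f x - g x) (fun x => f' x - g' x)
      (fun x => f'' x - g'' x) + 3 * θ * (h2sq f f' f'' + h2sq g g' g'')) =
      ∫ x, densConst A D B * (2 / θ * ((f x - g x) ^ 2 + (f' x - g' x) ^ 2 + (f'' x - g'' x) ^ 2)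
        + 3 * θ * (f x ^ 2 + f' x ^ 2 + f'' x ^ 2 + (g x ^ 2 + g' x ^ 2 + g'' x ^ 2))) := by
    rw [integral_const_mul, ← hs.integral_sum_sq, ← hf.integral_sum_sq, ← hg.integral_sum_sq,
      ← integral_add hf.integrable_sum_sq hg.integrable_sum_sq, ← integral_const_mul,
      ← integral_const_mul]
    exact congrArg _ (integral_add i1 i2).symm
  rw [e, ← Real.norm_eq_abs]
  refine (norm_integral_le_of_norm_le ((i1.add i2).const_mul (densConst A D B))
    (Eventually.of_forall fun x => ?_))
  rw [Real.norm_eq_abs, ← sub_mul, abs_mul]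
  refine (mul_le_of_le_one_right (abs_nonneg _) (hb x)).trans ?_
  exact (abs_dens_sub_le (h0 x) (k0 x) (k1 x)).trans
    (mul_le_mul_of_nonneg_left (mul_sum_le hθ) (densConst_nonneg _ _ _))

/-- The localized functionals depend continuously on the function. -/
theorem tendsto_integral_dens_sub {ι : Type*} {l : Filter ι} {f f₁ f₂ g g₁ g₂ Φ : ι → ℝ → ℝ}
    {B H : ℝ} (A D : ℝ) (hf : ∀ᶠ i in l, IsH2Triple (f i) (f₁ i) (f₂ i))
    (hg : ∀ᶠ i in l, IsH2Triple (g i) (g₁ i) (g₂ i)) (h0 : ∀ᶠ i in l, ∀ x, |f i x| ≤ B)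
    (k0 : ∀ᶠ i in l, ∀ x, |g i x| ≤ B) (k1 : ∀ᶠ i in l, ∀ x, |g₁ i x| ≤ B)
    (hH : ∀ᶠ i in l, h2sq (f i) (f₁ i) (f₂ i) ≤ H) (kH : ∀ᶠ i in l, h2sq (g i) (g₁ i) (g₂ i) ≤ H)
    (hΦ : ∀ᶠ i in l, AEStronglyMeasurable (Φ i)) (hb : ∀ᶠ i in l, ∀ x, |Φ i x| ≤ 1)
    (ht : Tendsto (fun i => h2sq (fun x => f i x - g i x) (fun x => f₁ i x - g₁ i x)
      (fun x => f₂ i x - g₂ i x)) l (𝓝 0)) :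
    Tendsto (fun i => (∫ x, dens A D (f i x) (f₁ i x) (f₂ i x) * Φ i x) -
      ∫ x, dens A D (g i x) (g₁ i x) (g₂ i x) * Φ i x) l (𝓝 0) := by
  rw [Metric.tendsto_nhds]
  intro η hη
  set K := densConst A D B + 1 with hK
  have hK0 : 0 < K := by have := densConst_nonneg A D B; linarith
  -- The choice makes the term in `θ` at most η/(2K); the bound η θ/(4K) on the squared distance
  -- makes the other term less than η/(2K).
  set θ := η / (2 * K * (6 * (|H| + 1))) with hθ
  have hθ0 : 0 < θ := by positivity
  have hsm : ∀ᶠ i in l, h2sq (fun x => f i x - g i x) (fun x => f₁ i x - g₁ i x)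
      (fun x => f₂ i x - g₂ i x) < η * θ / (4 * K) :=
    ht.eventually_lt_const (by positivity)
  filter_upwards [hf, hg, h0, k0, k1, hH, kH, hΦ, hb, hsm] with i a1 a2 a3 a4 a5 a6 a7 a8 a9 a10
  rw [Real.dist_0_eq_abs]
  refine (abs_integral_dens_sub_le a1 a2 a3 a4 a5 a8 a9 hθ0).trans_lt ?_
  set X := h2sq (fun x => f i x - g i x) (fun x => f₁ i x - g₁ i x)
      (fun x => f₂ i x - g₂ i x) with hX
  have hX0 : 0 ≤ X := h2sq_nonneg _ _ _
  have b1 : 3 * θ * (h2sq (f i) (f₁ i) (f₂ i) + h2sq (g i) (g₁ i) (g₂ i)) ≤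
      3 * θ * (2 * (|H|)) := by
    have := le_abs_self H
    gcongr; linarith
  have b2 : 2 / θ * X < 2 / θ * (η * θ / (4 * K)) := by gcongr
  have e2 : 2 / θ * (η * θ / (4 * K)) = η / (2 * K) := by field_simp; ring
  have e1 : 3 * θ * (2 * (|H| + 1)) = η / (2 * K) := by rw [hθ]; field_simp; ring
  have e3 : K * (η / (2 * K) + η / (2 * K)) = η := by field_simp; ring
  have b3 : 3 * θ * (2 * |H|) ≤ 3 * θ * (2 * (|H| + 1)) := by gcongr; linarith
  have n1 : 0 ≤ h2sq (f i) (f₁ i) (f₂ i) + h2sq (g i) (g₁ i) (g₂ i) :=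
    add_nonneg (h2sq_nonneg _ _ _) (h2sq_nonneg _ _ _)
  calc _ ≤ K * (2 / θ * X + 3 * θ * (h2sq (f i) (f₁ i) (f₂ i) + h2sq (g i) (g₁ i) (g₂ i))) := by
        gcongr; linarith
    _ < K * (η / (2 * K) + η / (2 * K)) := by gcongr ?_ * ?_; linarith
    _ = η := e3

end IsH2Triple

/-! ### Mollification of `H²` functions -/

theorem IsH2Triple.conv_moll {u u₁ u₂ : ℝ → ℝ} (h : IsH2Triple u u₁ u₂) {ε : ℝ} (hε : 0 < ε) :
    IsH2Triple (conv u (moll ε)) (conv u₁ (moll ε)) (conv u₂ (moll ε)) := by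
  have t0 := isTestFunction_moll hε
  have W0 := boundedL2_conv h.memLp₀ t0
  have W1 := boundedL2_conv h.memLp₁ t0
  have W2 := boundedL2_conv h.memLp₂ t0
  refine IsH2Triple.of_hasDerivAt (fun x => ?_) (fun x => ?_) W2.cont W0.memLp W1.memLp W2.memLp
  · rw [← h.weak₀.conv_deriv t0]; exact hasDerivAt_conv h.memLp₀.locallyIntegrable_two t0 x
  · rw [← h.weak₁.conv_deriv t0]; exact hasDerivAt_conv h.memLp₁.locallyIntegrable_two t0 x

/-- The functional of the mollified function converges to the functional of the function. -/
theorem IsH2Triple.tendsto_integral_mollDens {u u₁ u₂ : ℝ → ℝ} (h : IsH2Triple u u₁ u₂) (A D : ℝ)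
    {Φ : ℝ → ℝ} (hΦ : AEStronglyMeasurable Φ) (hb : ∀ x, |Φ x| ≤ 1) :
    Tendsto (fun ε => ∫ x, mollDens A D ε u x * Φ x) (𝓝[>] 0)
      (𝓝 (∫ x, dens A D (u x) (u₁ x) (u₂ x) * Φ x)) := by
  obtain ⟨B, hB, h0, h1⟩ := h.exists_bound
  have hpos : ∀ᶠ ε : ℝ in 𝓝[>] 0, 0 < ε := self_mem_nhdsWithin
  have key := IsH2Triple.tendsto_integral_dens_sub (l := 𝓝[>] (0 : ℝ)) (B := B)
    (H := h2sq u u₁ u₂) (f := fun ε => conv u (moll ε))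
    (f₁ := fun ε => conv u₁ (moll ε)) (f₂ := fun ε => conv u₂ (moll ε)) (g := fun _ => u)
    (g₁ := fun _ => u₁) (g₂ := fun _ => u₂) (Φ := fun _ => Φ) A D
    (hpos.mono fun ε hε => h.conv_moll hε) (Eventually.of_forall fun _ => h)
    (hpos.mono fun ε hε x => abs_conv_moll_le hε h.memLp₀.locallyIntegrable_two fun y _ => h0 y)
    (Eventually.of_forall fun _ => h0) (Eventually.of_forall fun _ => h1)
    (hpos.mono fun ε hε => by
      have a := l2sq_conv_moll_le h.memLp₀ hε
      have b := l2sq_conv_moll_le h.memLp₁ hε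
      have c := l2sq_conv_moll_le h.memLp₂ hε
      unfold h2sq; linarith)
    (Eventually.of_forall fun _ => le_rfl) (Eventually.of_forall fun _ => hΦ)
    (Eventually.of_forall fun _ => hb)
    (by
      have := ((tendsto_l2sq_conv_moll h.memLp₀).add (tendsto_l2sq_conv_moll h.memLp₁)).add
        (tendsto_l2sq_conv_moll h.memLp₂)
      simpa [h2sq] using this)
  have := key.add_const (∫ x, dens A D (u x) (u₁ x) (u₂ x) * Φ x)
  simp only [sub_add_cancel, zero_add] at this
  refine this.congr' (hpos.mono fun ε hε => ?_)
  exact integral_congr_ae (Eventually.of_forall fun x => by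
    simp only [mollDens_eq h hε])

/-! ### Mollified solutions as functions of time and space -/

/-- A continuous curve in `H²` whose mollifications solve the mollified equation. -/
structure IsH2Flow (T : ℝ) (U U₁ U₂ : ℝ → ℝ → ℝ) : Prop where
  triple : ∀ t, T ≤ t → IsH2Triple (U t) (U₁ t) (U₂ t)
  tendsto : ∀ t, T ≤ t → Tendsto (fun s => h2sq (fun x => U s x - U t x)
    (fun x => U₁ s x - U₁ t x) (fun x => U₂ s x - U₂ t x)) (𝓝[Set.Ici T] t) (𝓝 0)
  hasDerivAt : ∀ t, T < t → ∀ g, IsTestFunction g → ∀ x, HasDerivAt (fun s => conv (U s) g x)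
    (-conv (fun y => U₂ t y + U t y ^ 3) (deriv g) x) t

/-- Regular representatives are chosen at each time. Testing the equation with y ↦ g(x - y) turns
the distributional equation into an ordinary differential equation in time for the mollified
solution at each point `x`. -/
theorem IsH2Solution.exists_flow {T : ℝ} {u : ℝ → ℝ → ℝ} (h : IsH2Solution T u) :
    ∃ U U₁ U₂ : ℝ → ℝ → ℝ, IsH2Flow T U U₁ U₂ ∧ ∀ t, T ≤ t → u t =ᵐ[volume] U t := by
  choose! U U₁ U₂ hU hae using fun t (ht : T ≤ t) => (h.mem t ht).exists_triple
  refine ⟨U, U₁, U₂, ⟨hU, fun t ht => ?_, fun t ht g hg x => ?_⟩, hae⟩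
  · refine tendsto_h2sq ?_ ?_ (h.continuous t ht)
    · filter_upwards [self_mem_nhdsWithin] with s hs using (hU s hs).sub (hU t ht)
    · filter_upwards [self_mem_nhdsWithin] with s hs
      filter_upwards [hae s hs, hae t ht] with x h1 h2
      rw [h1, h2]
  · have e := h.equation t ht _ (hg.reflect x)
    have e1 : ∫ y, (weakDeriv (weakDeriv (u t)) y + u t y ^ 3) * deriv (fun y => g (x - y)) y =
        -conv (fun y => U₂ t y + U t y ^ 3) (deriv g) x := by
      unfold conv
      rw [← integral_neg]
      have hw : weakDeriv (weakDeriv (u t)) =ᵐ[volume] U₂ t := by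
        rw [weakDeriv_congr (hae t ht.le)]
        exact (hU t ht.le).weakDeriv₂_ae
      refine integral_congr_ae ?_
      filter_upwards [hw, hae t ht.le] with y h1 h2
      rw [h1, h2, hg.deriv_reflect x y]
      ring
    rw [e1] at e
    refine e.congr_of_eventuallyEq ?_
    filter_upwards [lt_mem_nhds ht] with s hs
    exact integral_congr_ae ((hae s (le_of_lt hs)).mono fun y hy => by simp only [hy])

/-- Cauchy–Schwarz bounds the change of the convolution between two times by an L² distance,
uniformly in `x`; together with continuity in `x` this gives joint continuity. -/
theorem continuousOn_conv {F : ℝ → ℝ → ℝ} {S : Set ℝ} (hF : ∀ t ∈ S, MemLp (F t) 2)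
    (hc : ∀ t ∈ S, Tendsto (fun s => l2sq (fun x => F s x - F t x)) (𝓝[S] t) (𝓝 0))
    {g : ℝ → ℝ} (hg : IsTestFunction g) :
    ContinuousOn (fun q : ℝ × ℝ => conv (F q.1) g q.2) (S ×ˢ Set.univ) := by
  rintro ⟨t, x⟩ ⟨ht, -⟩
  simp only at ht
  have h1 : Tendsto (fun q : ℝ × ℝ => q.1) (𝓝[S ×ˢ Set.univ] (t, x)) (𝓝[S] t) := by
    rw [nhdsWithin_prod_eq]; exact tendsto_fst
  have h2 : Tendsto (fun q : ℝ × ℝ => conv (F t) g q.2) (𝓝[S ×ˢ Set.univ] (t, x))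
      (𝓝 (conv (F t) g x)) :=
    (((continuous_conv (hF t ht).locallyIntegrable_two hg).comp continuous_snd).tendsto
      (t, x)).mono_left nhdsWithin_le_nhds
  have h3 : Tendsto (fun q : ℝ × ℝ => √(l2sq (fun x => F q.1 x - F t x) * l2sq g))
      (𝓝[S ×ˢ Set.univ] (t, x)) (𝓝 0) := by
    have := (((hc t ht).comp h1).mul_const (l2sq g)).sqrt
    simpa using this
  have h4 : Tendsto (fun q : ℝ × ℝ => conv (F q.1) g q.2 - conv (F t) g q.2)
      (𝓝[S ×ˢ Set.univ] (t, x)) (𝓝 0) := by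
    refine squeeze_zero_norm' ?_ h3
    filter_upwards [self_mem_nhdsWithin] with q hq
    have hs := hF q.1 hq.1
    rw [← conv_sub_left hs.locallyIntegrable_two (hF t ht).locallyIntegrable_two hg]
    exact Real.abs_le_sqrt (sq_conv_le (hs.sub (hF t ht)) hg _)
  have := h4.add h2
  simpa [ContinuousWithinAt] using this

section Flow

variable {T : ℝ} {U U₁ U₂ : ℝ → ℝ → ℝ}

theorem IsH2Flow.tendsto_l2sq₀ (h : IsH2Flow T U U₁ U₂) {t : ℝ} (ht : T ≤ t) :
    Tendsto (fun s => l2sq (fun x => U s x - U t x)) (𝓝[Set.Ici T] t) (𝓝 0) :=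
  squeeze_zero (fun _ => l2sq_nonneg _) (fun _ => l2sq₀_le_h2sq _ _ _) (h.tendsto t ht)

theorem IsH2Flow.tendsto_l2sq₂ (h : IsH2Flow T U U₁ U₂) {t : ℝ} (ht : T ≤ t) :
    Tendsto (fun s => l2sq (fun x => U₂ s x - U₂ t x)) (𝓝[Set.Ici T] t) (𝓝 0) :=
  squeeze_zero (fun _ => l2sq_nonneg _) (fun _ => l2sq₂_le_h2sq _ _ _) (h.tendsto t ht)

theorem IsH2Flow.tendsto_l2sq_cube (h : IsH2Flow T U U₁ U₂) {t : ℝ} (ht : T ≤ t) :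
    Tendsto (fun s => l2sq (fun x => U s x ^ 3 - U t x ^ 3)) (𝓝[Set.Ici T] t) (𝓝 0) := by
  obtain ⟨B, hB, h0, -⟩ := (h.triple t ht).exists_bound
  have h1 := (h.tendsto_l2sq₀ ht).const_mul ((3 * (B + 2) ^ 2) ^ 2)
  rw [mul_zero] at h1
  refine squeeze_zero' (Eventually.of_forall fun _ => l2sq_nonneg _) ?_ h1
  filter_upwards [self_mem_nhdsWithin, (h.tendsto t ht).eventually_lt_const zero_lt_one]
    with s hs hs1
  have hd := (h.triple s hs).sub (h.triple t ht)
  rw [← l2sq_const_mul]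
  refine l2sq_mono (hd.memLp₀.const_mul _) fun x => ?_
  have hx : |U s x - U t x| ≤ 2 := hd.abs_le (by norm_num) (by linarith) x
  have hx1 : |U s x| ≤ B + 2 := by
    have := abs_add_le (U s x - U t x) (U t x)
    rw [sub_add_cancel] at this
    linarith [h0 x]
  have hx2 : |U t x| ≤ B + 2 := by linarith [h0 x]
  have e : U s x ^ 3 - U t x ^ 3 =
      (U s x * U s x + U s x * U t x + U t x * U t x) * (U s x - U t x) := by ring
  rw [e, abs_mul, abs_mul (3 * (B + 2) ^ 2)]
  refine mul_le_mul_of_nonneg_right ?_ (abs_nonneg _)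
  rw [abs_of_nonneg (by positivity : 0 ≤ 3 * (B + 2) ^ 2)]
  refine (abs_add_le _ _).trans ?_
  refine (add_le_add_left (abs_add_le _ _) _).trans ?_
  rw [abs_mul, abs_mul, abs_mul]
  have a1 := mul_le_mul hx1 hx1 (abs_nonneg _) (by positivity)
  have a2 := mul_le_mul hx1 hx2 (abs_nonneg _) (by positivity)
  have a3 := mul_le_mul hx2 hx2 (abs_nonneg _) (by positivity)
  linarith

theorem IsH2Flow.memLp_force (h : IsH2Flow T U U₁ U₂) {t : ℝ} (ht : T ≤ t) :
    MemLp (fun y => U₂ t y + U t y ^ 3) 2 :=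
  (h.triple t ht).memLp₂.add (h.triple t ht).memLp_cube

theorem IsH2Flow.tendsto_l2sq_force (h : IsH2Flow T U U₁ U₂) {t : ℝ} (ht : T ≤ t) :
    Tendsto (fun s => l2sq (fun x => U₂ s x + U s x ^ 3 - (U₂ t x + U t x ^ 3)))
      (𝓝[Set.Ici T] t) (𝓝 0) := by
  have h1 := ((h.tendsto_l2sq₂ ht).const_mul 2).add ((h.tendsto_l2sq_cube ht).const_mul 2)
  simp only [mul_zero, add_zero] at h1
  refine squeeze_zero' (Eventually.of_forall fun _ => l2sq_nonneg _) ?_ h1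
  filter_upwards [self_mem_nhdsWithin] with s hs
  have := l2sq_add_le ((h.triple s hs).memLp₂.sub (h.triple t ht).memLp₂)
    ((h.triple s hs).memLp_cube.sub (h.triple t ht).memLp_cube)
  refine le_trans (le_of_eq ?_) this
  exact congrArg l2sq (funext fun x => by simp only [Pi.sub_apply]; ring)

theorem IsH2Flow.continuousOn_conv (h : IsH2Flow T U U₁ U₂) {g : ℝ → ℝ} (hg : IsTestFunction g) :
    ContinuousOn (fun q : ℝ × ℝ => conv (U q.1) g q.2) (Set.Ici T ×ˢ Set.univ) :=
  MKdV.continuousOn_conv (fun t ht => (h.triple t ht).memLp₀) (fun _ ht => h.tendsto_l2sq₀ ht) hg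

theorem IsH2Flow.continuousOn_conv_force (h : IsH2Flow T U U₁ U₂) {g : ℝ → ℝ}
    (hg : IsTestFunction g) :
    ContinuousOn (fun q : ℝ × ℝ => conv (fun y => U₂ q.1 y + U q.1 y ^ 3) g q.2)
      (Set.Ici T ×ˢ Set.univ) :=
  MKdV.continuousOn_conv (F := fun t y => U₂ t y + U t y ^ 3) (fun _ ht => h.memLp_force ht)
    (fun _ ht => h.tendsto_l2sq_force ht) hg

/-! ### Time derivative of the localized mollified density. -/

theorem hasDerivAt_dens (A D : ℝ) {a₀ a₁ a₂ : ℝ → ℝ} {b₀ b₁ b₂ t : ℝ} (h0 : HasDerivAt a₀ b₀ t)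
    (h1 : HasDerivAt a₁ b₁ t) (h2 : HasDerivAt a₂ b₂ t) :
    HasDerivAt (fun s => dens A D (a₀ s) (a₁ s) (a₂ s))
      (densVar A D (a₀ t) (a₁ t) (a₂ t) b₀ b₁ b₂) t := by
  have T := (((((h2.fun_pow 2).const_mul (1 / 2)).fun_sub
    (((h0.fun_pow 2).const_mul (5 / 2)).fun_mul (h1.fun_pow 2))).fun_add
    ((h0.fun_pow 6).const_mul (1 / 4))).fun_add
    ((((h1.fun_pow 2).const_mul (1 / 2)).fun_sub ((h0.fun_pow 4).const_mul (1 / 4))).const_mul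
      A)).fun_add (((h0.fun_pow 2).const_mul (1 / 2)).const_mul D)
  refine T.congr_deriv ?_
  unfold densVar
  norm_num
  ring

theorem IsH2Flow.hasDerivAt_mollDens (h : IsH2Flow T U U₁ U₂) (A D : ℝ) {ε t : ℝ} (hε : 0 < ε)
    (ht : T < t) (x : ℝ) :
    HasDerivAt (fun s => mollDens A D ε (U s) x) (rate A D ε (U t) (U₂ t) x) t := by
  have t0 := isTestFunction_moll hε
  exact hasDerivAt_dens A D (h.hasDerivAt t ht _ t0 x) (h.hasDerivAt t ht _ t0.deriv x)
    (h.hasDerivAt t ht _ t0.deriv.deriv x)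

variable {κ : ℝ} {P p p₁ p₂ : ℝ → ℝ}

/-- The time derivative of the localized mollified density. -/
noncomputable def localRate (A D m ε : ℝ) (U U₂ : ℝ → ℝ → ℝ) (P p : ℝ → ℝ) (t x : ℝ) : ℝ :=
  rate A D ε (U t) (U₂ t) x * P (x - m * t) + m * mollDens A D ε (U t) x * p (x - m * t)

theorem IsH2Flow.hasDerivAt_localDens (h : IsH2Flow T U U₁ U₂) (hw : IsWeight κ P p p₁ p₂)
    (A D m : ℝ) {ε t : ℝ} (hε : 0 < ε) (ht : T < t) (x : ℝ) :
    HasDerivAt (fun s => mollDens A D ε (U s) x * P (x - m * s))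
      (localRate A D m ε U U₂ P p t x) t := by
  have h1 : HasDerivAt (fun s => P (x - m * s)) (m * p (x - m * t)) t := by
    have e : HasDerivAt (fun s => x - m * s) (-m) t := by
      simpa using ((hasDerivAt_id t).const_mul m).const_sub x
    exact ((hw.hasDerivAt (x - m * t)).comp t e).congr_deriv (by ring)
  exact ((h.hasDerivAt_mollDens A D hε ht x).fun_mul h1).congr_deriv (by unfold localRate; ring)

theorem IsH2Flow.continuousOn_localRate (h : IsH2Flow T U U₁ U₂) (hw : IsWeight κ P p p₁ p₂)
    (A D m : ℝ) {ε : ℝ} (hε : 0 < ε) :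
    ContinuousOn (fun q : ℝ × ℝ => localRate A D m ε U U₂ P p q.1 q.2)
      (Set.Ici T ×ˢ Set.univ) := by
  have t0 := isTestFunction_moll hε
  have c0 := h.continuousOn_conv t0
  have c1 := h.continuousOn_conv t0.deriv
  have c2 := h.continuousOn_conv t0.deriv.deriv
  have d1 := h.continuousOn_conv_force t0.deriv
  have d2 := h.continuousOn_conv_force t0.deriv.deriv
  have d3 := h.continuousOn_conv_force t0.deriv.deriv.deriv
  have hP : Continuous P := hw.bounded.cont
  have hp : Continuous p := hw.bounded₁.cont
  have eP : ContinuousOn (fun q : ℝ × ℝ => P (q.2 - m * q.1)) (Set.Ici T ×ˢ Set.univ) := by fun_prop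
  have ep : ContinuousOn (fun q : ℝ × ℝ => p (q.2 - m * q.1)) (Set.Ici T ×ˢ Set.univ) := by fun_prop
  unfold localRate rate mollDens densVar dens
  fun_prop

theorem abs_densVar_le {A D B w₀ w₁ w₂ W W₁ W₂ : ℝ} (h0 : |w₀| ≤ B) (h1 : |w₁| ≤ B) :
    |densVar A D w₀ w₁ w₂ W W₁ W₂| ≤
      (1 + 10 * B ^ 2 + 3 / 2 * B ^ 4 + |A| * (1 + B ^ 2) + |D|) *
        (w₀ ^ 2 + w₁ ^ 2 + w₂ ^ 2 + (W ^ 2 + W₁ ^ 2 + W₂ ^ 2)) := by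
  set S := w₀ ^ 2 + w₁ ^ 2 + w₂ ^ 2 + (W ^ 2 + W₁ ^ 2 + W₂ ^ 2) with hS
  have n0 := sq_nonneg w₀
  have n1 := sq_nonneg w₁
  have n2 := sq_nonneg w₂
  have n3 := sq_nonneg W
  have n4 := sq_nonneg W₁
  have n5 := sq_nonneg W₂
  have hB : 0 ≤ B := (abs_nonneg _).trans h0
  have am : ∀ x y : ℝ, x ^ 2 + y ^ 2 ≤ S → |x * y| ≤ S := fun x y hxy => by
    rw [abs_le]; constructor <;> nlinarith [sq_nonneg (x + y), sq_nonneg (x - y)]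
  have q1 : |w₂ * W₂| ≤ S := am _ _ (by linarith)
  have q2 : |w₁ * W| ≤ S := am _ _ (by linarith)
  have q3 : |w₁ * W₁| ≤ S := am _ _ (by linarith)
  have q4 : |w₀ * W| ≤ S := am _ _ (by linarith)
  have hS0 : 0 ≤ S := by positivity
  have b2 : |w₀ * w₁| ≤ B ^ 2 := by
    rw [abs_mul, sq]; exact mul_le_mul h0 h1 (abs_nonneg _) hB
  have b3 : |w₀ ^ 2| ≤ B ^ 2 := by rw [abs_pow]; gcongr
  have b4 : |w₀ ^ 4| ≤ B ^ 4 := by rw [abs_pow]; gcongr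
  have e : densVar A D w₀ w₁ w₂ W W₁ W₂ = w₂ * W₂ - 5 * ((w₀ * w₁) * (w₁ * W))
      + (-(5 * (w₀ ^ 2 * (w₁ * W₁)))) + 3 / 2 * (w₀ ^ 4 * (w₀ * W)) - (-(A * (w₁ * W₁ - w₀ ^ 2
      * (w₀ * W)))) - (-(D * (w₀ * W))) := by unfold densVar; ring
  rw [e]
  refine (abs_six_le _ _ _ _ _ _).trans ?_
  have r1 : |5 * ((w₀ * w₁) * (w₁ * W))| ≤ 5 * (B ^ 2 * S) := by
    rw [abs_mul, abs_mul (w₀ * w₁), abs_of_pos (by norm_num : (0 : ℝ) < 5)]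
    gcongr
  have r2 : |-(5 * (w₀ ^ 2 * (w₁ * W₁)))| ≤ 5 * (B ^ 2 * S) := by
    rw [abs_neg, abs_mul, abs_mul (w₀ ^ 2), abs_of_pos (by norm_num : (0 : ℝ) < 5)]
    gcongr
  have r3 : |3 / 2 * (w₀ ^ 4 * (w₀ * W))| ≤ 3 / 2 * (B ^ 4 * S) := by
    rw [abs_mul, abs_mul (w₀ ^ 4), abs_of_pos (by norm_num : (0 : ℝ) < 3 / 2)]
    gcongr
  have r4 : |-(A * (w₁ * W₁ - w₀ ^ 2 * (w₀ * W)))| ≤ |A| * (S + B ^ 2 * S) := by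
    rw [abs_neg, abs_mul]
    gcongr
    refine (abs_sub _ _).trans (add_le_add q3 ?_)
    rw [abs_mul]
    gcongr
  have r5 : |-(D * (w₀ * W))| ≤ |D| * S := by
    rw [abs_neg, abs_mul]; gcongr
  linarith

/-- A uniform `L¹` bound for the time derivative of the localized mollified density. -/
theorem exists_integral_abs_localRate_le (A D m B H : ℝ) {ε : ℝ} (hε : 0 < ε)
    (hw : IsWeight κ P p p₁ p₂) :
    ∃ M : ℝ, ∀ t, IsH2Triple (U t) (U₁ t) (U₂ t) → (∀ x, |U t x| ≤ B) → (∀ x, |U₁ t x| ≤ B) →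
      h2sq (U t) (U₁ t) (U₂ t) ≤ H → ∫ x, ‖localRate A D m ε U U₂ P p t x‖ ≤ M := by
  have t0 := isTestFunction_moll hε
  set K := 1 + 10 * B ^ 2 + 3 / 2 * B ^ 4 + |A| * (1 + B ^ 2) + |D| with hK
  have hK0 : 0 ≤ K := by positivity
  have hd := densConst_nonneg A D B
  set I : (ℝ → ℝ) → ℝ := fun g => (∫ y, |g y|) ^ 2 with hI
  set L := (2 + 2 * B ^ 4) * |H| with hL
  set ρ := moll ε with hρ
  refine ⟨K * (3 * |H| + (I (deriv ρ) * L + I (deriv (deriv ρ)) * L +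
    I (deriv (deriv (deriv ρ))) * L)) + |m| * (densConst A D B * (5 * (3 * |H|))), ?_⟩
  intro t h h0 h1 hH
  set V := fun y => U₂ t y + U t y ^ 3 with hV
  have hVm : MemLp V 2 := h.memLp₂.add h.memLp_cube
  have w := h.conv_moll hε
  have v1 := l2sq_conv_le hVm t0.deriv
  have v2 := l2sq_conv_le hVm t0.deriv.deriv
  have v3 := l2sq_conv_le hVm t0.deriv.deriv.deriv
  have hVL : l2sq V ≤ L := by
    have a := l2sq_add_le h.memLp₂ h.memLp_cube
    have b : l2sq (fun x => U t x ^ 3) ≤ B ^ 4 * l2sq (U t) := by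
      have := l2sq_mono (f := fun x => U t x ^ 3) (h.memLp₀.const_mul (B ^ 2)) fun x => by
        have e : U t x ^ 3 = U t x ^ 2 * U t x := by ring
        rw [e, abs_mul, abs_mul (B ^ 2), abs_pow, abs_pow]
        exact mul_le_mul_of_nonneg_right (pow_le_pow_left₀ (abs_nonneg _)
          ((h0 x).trans (le_abs_self _)) 2) (abs_nonneg _)
      rw [l2sq_const_mul] at this
      linarith
    have c := l2sq₂_le_h2sq (U t) (U₁ t) (U₂ t)
    have d := l2sq₀_le_h2sq (U t) (U₁ t) (U₂ t)
    have e := le_abs_self H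
    have f : B ^ 4 * l2sq (U t) ≤ B ^ 4 * |H| := by gcongr; linarith
    have : l2sq V = l2sq (fun x => U₂ t x + U t x ^ 3) := rfl
    rw [this]
    linarith
  have hcH : h2sq (conv (U t) ρ) (conv (U₁ t) ρ) (conv (U₂ t) ρ) ≤ 3 * |H| := by
    have a := l2sq_conv_moll_le h.memLp₀ hε
    have b := l2sq_conv_moll_le h.memLp₁ hε
    have c := l2sq_conv_moll_le h.memLp₂ hε
    have e := le_abs_self H
    have : h2sq (conv (U t) ρ) (conv (U₁ t) ρ) (conv (U₂ t) ρ) ≤ h2sq (U t) (U₁ t) (U₂ t) := by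
      unfold h2sq; linarith
    have := abs_nonneg H
    linarith
  have i0 := w.integrable_sum_sq
  have i1 := v1.1.integrable_sq
  have i2 := v2.1.integrable_sq
  have i3 := v3.1.integrable_sq
  have j := (i0.add ((i1.add i2).add i3)).const_mul K
  have j' := ((i0.const_mul 5).const_mul (densConst A D B)).const_mul |m|
  have key := integral_mono_of_nonneg (Eventually.of_forall fun x => norm_nonneg _) (j.add j')
    (Eventually.of_forall fun x : ℝ => show ‖localRate A D m ε U U₂ P p t x‖ ≤ _ by
      have b0 : |conv (U t) ρ x| ≤ B :=
        abs_conv_moll_le hε h.memLp₀.locallyIntegrable_two fun y _ => h0 y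
      have b1 : |conv (U₁ t) ρ x| ≤ B :=
        abs_conv_moll_le hε h.memLp₁.locallyIntegrable_two fun y _ => h1 y
      have r1 : |rate A D ε (U t) (U₂ t) x| ≤ K * (conv (U t) ρ x ^ 2 + conv (U₁ t) ρ x ^ 2 +
          conv (U₂ t) ρ x ^ 2 + (conv V (deriv ρ) x ^ 2 + conv V (deriv (deriv ρ)) x ^ 2 +
          conv V (deriv (deriv (deriv ρ))) x ^ 2)) := by
        have := abs_densVar_le (A := A) (D := D) (w₂ := conv (U₂ t) ρ x)
          (W := -conv V (deriv ρ) x) (W₁ := -conv V (deriv (deriv ρ)) x)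
          (W₂ := -conv V (deriv (deriv (deriv ρ))) x) b0 b1
        simp only [neg_sq] at this
        unfold rate
        rw [h.weak₀.conv_deriv t0, h.weak₀.conv_deriv t0.deriv, h.weak₁.conv_deriv t0]
        exact this
      have r2 : |mollDens A D ε (U t) x| ≤ densConst A D B * (5 * (conv (U t) ρ x ^ 2 +
          conv (U₁ t) ρ x ^ 2 + conv (U₂ t) ρ x ^ 2)) := by
        rw [mollDens_eq h hε]
        exact IsH2Triple.abs_dens_le (f := conv (U t) ρ) (f' := conv (U₁ t) ρ)
          (f'' := conv (U₂ t) ρ) (fun x => abs_conv_moll_le hε h.memLp₀.locallyIntegrable_two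
            fun y _ => h0 y) A D x
      rw [Real.norm_eq_abs]
      unfold localRate
      refine (abs_add_le _ _).trans (add_le_add ?_ ?_)
      · rw [abs_mul]
        refine (mul_le_of_le_one_right (abs_nonneg _) ?_).trans r1
        rw [abs_of_nonneg (hw.nonneg _)]; exact hw.le_one _
      · rw [abs_mul, abs_mul]
        refine (mul_le_of_le_one_right (by positivity) ?_).trans
          (mul_le_mul_of_nonneg_left r2 (abs_nonneg _))
        rw [abs_of_nonneg (hw.nonneg₁ _)]; exact hw.le_one₁ _)
  refine key.trans ?_
  have e1 : ∫ x, ((fun x => conv (U t) ρ x ^ 2 + conv (U₁ t) ρ x ^ 2 + conv (U₂ t) ρ x ^ 2) +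
      (((fun x => conv V (deriv ρ) x ^ 2) + fun x => conv V (deriv (deriv ρ)) x ^ 2) +
      fun x => conv V (deriv (deriv (deriv ρ))) x ^ 2)) x =
      h2sq (conv (U t) ρ) (conv (U₁ t) ρ) (conv (U₂ t) ρ) + (l2sq (conv V (deriv ρ)) +
      l2sq (conv V (deriv (deriv ρ))) + l2sq (conv V (deriv (deriv (deriv ρ))))) := by
    refine (integral_add i0 ((i1.add i2).add i3)).trans (congrArg₂ _ w.integral_sum_sq ?_)
    exact (integral_add (i1.add i2) i3).trans (congrArg₂ _ (integral_add i1 i2) rfl)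
  rw [integral_add' j j']
  refine add_le_add ?_ ?_
  · rw [integral_const_mul, e1]
    have g1 := v1.2.trans (mul_le_mul_of_nonneg_left hVL (sq_nonneg _))
    have g2 := v2.2.trans (mul_le_mul_of_nonneg_left hVL (sq_nonneg _))
    have g3 := v3.2.trans (mul_le_mul_of_nonneg_left hVL (sq_nonneg _))
    refine mul_le_mul_of_nonneg_left ?_ hK0
    simp only [hI]
    linarith
  · rw [integral_const_mul, integral_const_mul, integral_const_mul, w.integral_sum_sq]
    gcongr

end Flow

/-! ### Almost monotonicity of the localized functionals -/

section Flow

variable {T : ℝ} {U U₁ U₂ : ℝ → ℝ → ℝ} {κ : ℝ} {P p p₁ p₂ : ℝ → ℝ}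

/-- Joint measurability follows from continuity, and the L¹ norms of the time slices are uniformly
bounded. This justifies Fubini in `integral_localRate`. -/
theorem IsH2Flow.integrable_localRate (h : IsH2Flow T U U₁ U₂) (hw : IsWeight κ P p p₁ p₂)
    (A D m : ℝ) {B H ε t₁ t₂ : ℝ} (hε : 0 < ε) (ht : T < t₁)
    (h0 : ∀ t ∈ Set.Icc t₁ t₂, ∀ x, |U t x| ≤ B) (h1 : ∀ t ∈ Set.Icc t₁ t₂, ∀ x, |U₁ t x| ≤ B)
    (hH : ∀ t ∈ Set.Icc t₁ t₂, h2sq (U t) (U₁ t) (U₂ t) ≤ H) :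
    Integrable (Function.uncurry (localRate A D m ε U U₂ P p))
      ((volume.restrict (Set.Ioc t₁ t₂)).prod volume) := by
  have hsub : ∀ t ∈ Set.Ioc t₁ t₂, T ≤ t := fun t h => ht.le.trans h.1.le
  have hm : AEStronglyMeasurable (Function.uncurry (localRate A D m ε U U₂ P p))
      ((volume.restrict (Set.Ioc t₁ t₂)).prod volume) := by
    have := ((h.continuousOn_localRate hw A D m hε).mono
      (Set.prod_mono (fun t h => hsub t h) le_rfl)).aestronglyMeasurable
      (μ := (volume : Measure ℝ).prod (volume : Measure ℝ))
      (measurableSet_Ioc.prod MeasurableSet.univ) (s := Set.Ioc t₁ t₂ ×ˢ Set.univ)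
    rwa [← Measure.prod_restrict, Measure.restrict_univ] at this
  refine (integrable_prod_iff hm).2 ⟨?_, ?_⟩
  · filter_upwards [ae_restrict_mem measurableSet_Ioc] with t htm
    have := integrable_rate (A := A) (D := D) (m := m) (h.triple t (hsub t htm))
      (hw.comp_sub (m * t)) hε
    simpa only [Function.uncurry_apply_pair, localRate] using this
  · obtain ⟨M, hM⟩ := exists_integral_abs_localRate_le (U := U) (U₁ := U₁) (U₂ := U₂)
      A D m B H hε hw
    refine Integrable.of_bound hm.norm.integral_prod_right' M ?_
    filter_upwards [ae_restrict_mem measurableSet_Ioc] with t htm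
    have hti : t ∈ Set.Icc t₁ t₂ := ⟨htm.1.le, htm.2⟩
    rw [Real.norm_of_nonneg (integral_nonneg fun x => norm_nonneg _)]
    exact hM t (h.triple t (hsub t htm)) (h0 t hti) (h1 t hti) (hH t hti)

/-- Exchanging the integrals reduces the claim to the fundamental theorem of calculus in time at
each fixed `x`, so no differentiation under the integral sign is needed. -/
theorem IsH2Flow.integral_localRate (h : IsH2Flow T U U₁ U₂) (hw : IsWeight κ P p p₁ p₂)
    (A D m : ℝ) {B H ε t₁ t₂ : ℝ} (hε : 0 < ε) (ht : T < t₁) (h12 : t₁ ≤ t₂)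
    (h0 : ∀ t ∈ Set.Icc t₁ t₂, ∀ x, |U t x| ≤ B) (h1 : ∀ t ∈ Set.Icc t₁ t₂, ∀ x, |U₁ t x| ≤ B)
    (hH : ∀ t ∈ Set.Icc t₁ t₂, h2sq (U t) (U₁ t) (U₂ t) ≤ H) :
    ∫ t in t₁..t₂, ∫ x, localRate A D m ε U U₂ P p t x =
      (∫ x, mollDens A D ε (U t₂) x * P (x - m * t₂)) -
        ∫ x, mollDens A D ε (U t₁) x * P (x - m * t₁) := by
  have hI : ∀ t, T ≤ t → Integrable fun x => mollDens A D ε (U t) x * P (x - m * t) :=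
    fun t ht => by
      have hw' := hw.comp_sub (m * t)
      simp only [mollDens_eq (h.triple t ht) hε]
      refine ((h.triple t ht).conv_moll hε).integrable_dens_mul A D
        hw'.bounded.cont.aestronglyMeasurable fun x => ?_
      rw [abs_of_nonneg (hw.nonneg _)]; exact hw.le_one _
  rw [intervalIntegral.integral_of_le h12,
    integral_integral_swap (h.integrable_localRate hw A D m hε ht h0 h1 hH),
    ← integral_sub (hI t₂ (ht.le.trans h12)) (hI t₁ ht.le)]
  refine integral_congr_ae (Eventually.of_forall fun x => ?_)
  simp only
  rw [← intervalIntegral.integral_of_le h12]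
  have hc : ContinuousOn (fun t => localRate A D m ε U U₂ P p t x) (Set.uIcc t₁ t₂) := by
    refine (h.continuousOn_localRate hw A D m hε).comp (f := fun t => (t, x)) (by fun_prop) ?_
    intro t htm
    rw [Set.uIcc_of_le h12] at htm
    exact ⟨ht.le.trans htm.1, trivial⟩
  refine intervalIntegral.integral_eq_sub_of_hasDerivAt
    (f := fun s => mollDens A D ε (U s) x * P (x - m * s)) (fun t htm => ?_) hc.intervalIntegrable
  rw [Set.uIcc_of_le h12] at htm
  exact h.hasDerivAt_localDens hw A D m hε (ht.trans_le htm.1) x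

/-- The smallness of the mollified third derivative is uniform on compact time intervals. -/
theorem IsH2Flow.eventually_l2sq_conv_deriv_moll_le (h : IsH2Flow T U U₁ U₂) {t₁ t₂ η : ℝ}
    (ht : T ≤ t₁) (hη : 0 < η) :
    ∀ᶠ ε in 𝓝[>] (0 : ℝ), ∀ t ∈ Set.Icc t₁ t₂,
      ε ^ 2 * l2sq (conv (U₂ t) (deriv (moll ε))) ≤ η := by
  obtain ⟨C, hC, hCb⟩ := exists_l2sq_conv_deriv_moll_le
  refine (isCompact_Icc (a := t₁) (b := t₂)).induction_on
    (p := fun s => ∀ᶠ ε in 𝓝[>] (0 : ℝ), ∀ t ∈ s,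
      ε ^ 2 * l2sq (conv (U₂ t) (deriv (moll ε))) ≤ η) (by simp) ?_ ?_ ?_
  · exact fun s t hst hs => hs.mono fun ε hε r hr => hε r (hst hr)
  · intro s t hs ht
    filter_upwards [hs, ht] with ε h1 h2 r hr
    exact hr.elim (h1 r) (h2 r)
  · intro t htm
    have hTt : T ≤ t := ht.trans htm.1
    have hn : 𝓝[Set.Icc t₁ t₂] t ≤ 𝓝[Set.Ici T] t := nhdsWithin_mono _ fun s hs => ht.trans hs.1
    -- Near `t`, the function `U₂ s` is `U₂ t` plus a remainder of squared norm below η/(4C). The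
    -- bound `hCb`, uniform in ε, handles the remainder, and the limit for the single function `U₂
    -- t` does the rest: 2 · η/4 + 2 · η/4 = η.
    refine ⟨{s | T ≤ s ∧ l2sq (fun x => U₂ s x - U₂ t x) < η / (4 * C)}, ?_, ?_⟩
    · filter_upwards [hn self_mem_nhdsWithin, ((h.tendsto_l2sq₂ hTt).mono_left hn).eventually_lt_const
        (show 0 < η / (4 * C) by positivity)] with s h1 h2 using ⟨h1, h2⟩
    · filter_upwards [self_mem_nhdsWithin, (tendsto_l2sq_conv_deriv_moll
        (h.triple t hTt).memLp₂).eventually_lt_const (show 0 < η / 4 by positivity)] with ε hε h1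
      rintro s ⟨hs, hs2⟩
      have hε' : (0 : ℝ) < ε := hε
      have td := (isTestFunction_moll hε').deriv
      have m1 := (h.triple s hs).memLp₂
      have m2 := (h.triple t hTt).memLp₂
      have a := hCb _ (m1.sub m2) ε hε'
      have b := l2sq_add_le (l2sq_conv_le (m1.sub m2) td).1 (l2sq_conv_le m2 td).1
      have e : l2sq (fun x => conv (U₂ s - U₂ t) (deriv (moll ε)) x +
          conv (U₂ t) (deriv (moll ε)) x) = l2sq (conv (U₂ s) (deriv (moll ε))) := by
        refine congrArg l2sq (funext fun x => ?_)
        have := conv_sub_left m1.locallyIntegrable_two m2.locallyIntegrable_two td (x := x)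
        have e' : conv (U₂ s - U₂ t) (deriv (moll ε)) x =
          conv (fun y => U₂ s y - U₂ t y) (deriv (moll ε)) x := rfl
        rw [e', this]; ring
      rw [e] at b
      have c : C * l2sq (U₂ s - U₂ t) ≤ C * (η / (4 * C)) := by
        have : l2sq (U₂ s - U₂ t) = l2sq (fun x => U₂ s x - U₂ t x) := rfl
        rw [this]; gcongr
      have e2 : C * (η / (4 * C)) = η / 4 := by field_simp
      have : ε ^ 2 * l2sq (conv (U₂ s) (deriv (moll ε))) ≤
        ε ^ 2 * (2 * l2sq (conv (U₂ s - U₂ t) (deriv (moll ε))) +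
          2 * l2sq (conv (U₂ t) (deriv (moll ε)))) := by gcongr
      linarith

end Flow

/-- The localized functionals are almost nondecreasing in time. -/
theorem exists_integral_dens_le {A D m B H : ℝ} (hB : 1 ≤ B) :
    ∃ C : ℝ, 0 < C ∧ ∀ (c κ μ δ T t₁ t₂ : ℝ) (U U₁ U₂ g : ℝ → ℝ → ℝ) (P p p₁ p₂ e : ℝ → ℝ),
    IsH2Flow T U U₁ U₂ → IsWeight κ P p p₁ p₂ → T < t₁ → t₁ ≤ t₂ →
    (∀ t ∈ Set.Icc t₁ t₂, ∀ x, |U t x| ≤ B) → (∀ t ∈ Set.Icc t₁ t₂, ∀ x, |U₁ t x| ≤ B) →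
    (∀ t ∈ Set.Icc t₁ t₂, h2sq (U t) (U₁ t) (U₂ t) ≤ H) →
    (∀ x, Coercive c κ A D m μ ∨ p x = 0) → 2 * fluxConst A D m B * δ ≤ c →
    Continuous e → (∀ t, 0 ≤ e t) →
    (∀ t ∈ Set.Icc t₁ t₂, ∀ x y, |x - y| ≤ 1 → |U t y| ≤ δ + g t x) →
    (∀ t ∈ Set.Icc t₁ t₂, ∀ x y, |x - y| ≤ 1 → |U₁ t y| ≤ δ + g t x) →
    (∀ t ∈ Set.Icc t₁ t₂, ∀ x, g t x * p (x - m * t) ≤ e t) →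
    ∫ x, dens A D (U t₁ x) (U₁ t₁ x) (U₂ t₁ x) * P (x - m * t₁) ≤
      (∫ x, dens A D (U t₂ x) (U₁ t₂ x) (U₂ t₂ x) * P (x - m * t₂)) +
        C * ∫ t in t₁..t₂, e t := by
  obtain ⟨C, hC, key⟩ := exists_integral_rate_lower (A := A) (D := D) (m := m) (H := H) hB
  refine ⟨C, hC, ?_⟩
  intro c κ μ δ T t₁ t₂ U U₁ U₂ g P p p₁ p₂ e h hw hT h12 h0 h1 hH hc hδ he he0 g0 g1 hg
  have hT2 := hT.le.trans h12
  have hΦ : ∀ t, AEStronglyMeasurable (fun x => P (x - m * t)) := fun t =>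
    (hw.comp_sub (m * t)).bounded.cont.aestronglyMeasurable
  have hΦ1 : ∀ t x, |P (x - m * t)| ≤ 1 := fun t x => by
    rw [abs_of_nonneg (hw.nonneg _)]; exact hw.le_one _
  have lim : ∀ t, T ≤ t → Tendsto (fun ε => ∫ x, mollDens A D ε (U t) x * P (x - m * t)) (𝓝[>] 0)
      (𝓝 (∫ x, dens A D (U t x) (U₁ t x) (U₂ t x) * P (x - m * t))) := fun t ht =>
    (h.triple t ht).tendsto_integral_mollDens A D (hΦ t) (hΦ1 t)
  -- The order of limits matters: ε → 0 at fixed τ removes the mollification and leaves an error (C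
  -- + 1) τ per unit time; then τ → 0.
  have step : ∀ τ : ℝ, 0 < τ →
      ∫ x, dens A D (U t₁ x) (U₁ t₁ x) (U₂ t₁ x) * P (x - m * t₁) ≤
      (∫ x, dens A D (U t₂ x) (U₁ t₂ x) (U₂ t₂ x) * P (x - m * t₂)) +
        (C * (∫ t in t₁..t₂, e t) + (C * 0 + (C + 1) * τ) * (t₂ - t₁)) := by
    intro τ hτ
    have hε0 : Tendsto (fun ε : ℝ => ε) (𝓝[>] 0) (𝓝 0) := nhdsWithin_le_nhds
    refine le_of_tendsto_of_tendsto (lim t₁ hT.le) ((lim t₂ hT2).add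
      ((((hε0.const_mul C).add_const ((C + 1) * τ)).mul_const (t₂ - t₁)).const_add
        (C * (∫ t in t₁..t₂, e t)))) ?_
    -- The threshold 2τ² makes the term in the mollified third derivative, which carries the factor
    -- 1/(2τ), at most τ.
    filter_upwards [self_mem_nhdsWithin, hε0.eventually_lt_const zero_lt_one,
      h.eventually_l2sq_conv_deriv_moll_le (t₂ := t₂) hT.le (show 0 < 2 * τ ^ 2 by positivity)]
      with ε hε hε1 hsm
    have hε' : (0 : ℝ) < ε := hε
    have hfub := h.integral_localRate hw A D m hε' hT h12 h0 h1 hH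
    have hint : IntervalIntegrable (fun t => ∫ x, localRate A D m ε U U₂ P p t x) volume t₁ t₂ :=
      (intervalIntegrable_iff_integrableOn_Ioc_of_le h12).2
        (h.integrable_localRate hw A D m hε' hT h0 h1 hH).integral_prod_left
    have hlow : IntervalIntegrable (fun t => -(C * e t + (C * ε + (C + 1) * τ))) volume t₁ t₂ :=
      (by fun_prop : Continuous fun t => -(C * e t + (C * ε + (C + 1) * τ))).intervalIntegrable _ _
    have hmono := intervalIntegral.integral_mono_on h12 hlow hint fun t ht => by
      have := key c κ μ δ (e t) ε τ (U t) (U₁ t) (U₂ t) (fun x => P (x - m * t))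
        (fun x => p (x - m * t)) (fun x => p₁ (x - m * t)) (fun x => p₂ (x - m * t)) (g t)
        (h.triple t (hT.le.trans ht.1)) (hw.comp_sub (m * t)) (h0 t ht) (h1 t ht) (hH t ht)
        (fun x => hc _) hδ hε' hε1.le hτ (he0 t) (g0 t ht) (g1 t ht) (hg t ht)
      refine le_trans ?_ this
      have h3 : ε ^ 2 / (2 * τ) * l2sq (conv (U₂ t) (deriv (moll ε))) ≤ τ := by
        have e3 : ε ^ 2 / (2 * τ) * l2sq (conv (U₂ t) (deriv (moll ε))) =
          (ε ^ 2 * l2sq (conv (U₂ t) (deriv (moll ε)))) / (2 * τ) := by ring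
        rw [e3, div_le_iff₀ (by positivity)]
        linarith [hsm t ht]
      linarith
    rw [hfub] at hmono
    have hcomp : ∫ t in t₁..t₂, -(C * e t + (C * ε + (C + 1) * τ)) =
        -(C * (∫ t in t₁..t₂, e t) + (C * ε + (C + 1) * τ) * (t₂ - t₁)) := by
      rw [intervalIntegral.integral_neg, intervalIntegral.integral_add
        ((he.const_mul C).intervalIntegrable _ _) (by simp), intervalIntegral.integral_const_mul,
        intervalIntegral.integral_const, smul_eq_mul]
      ring
    rw [hcomp] at hmono
    linarith
  have hlim : Tendsto (fun τ : ℝ => (∫ x, dens A D (U t₂ x) (U₁ t₂ x) (U₂ t₂ x) *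
      P (x - m * t₂)) + (C * (∫ t in t₁..t₂, e t) + (C * 0 + (C + 1) * τ) * (t₂ - t₁))) (𝓝[>] 0)
      (𝓝 ((∫ x, dens A D (U t₂ x) (U₁ t₂ x) (U₂ t₂ x) * P (x - m * t₂)) +
        (C * (∫ t in t₁..t₂, e t) + (C * 0 + (C + 1) * 0) * (t₂ - t₁)))) := by
    refine (Continuous.tendsto ?_ 0).mono_left nhdsWithin_le_nhds
    fun_prop
  have := ge_of_tendsto hlim (by filter_upwards [self_mem_nhdsWithin] with τ hτ using step τ hτ)
  simpa using this

/-! ### Solitons and breathers -/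

/-- A smooth travelling profile: localized around `v t`, periodic in time up to translation. -/
structure IsWaveTriple (v γ : ℝ) (p p₁ p₂ : ℝ → ℝ → ℝ) : Prop where
  hasDerivAt : ∀ t x, HasDerivAt (p t) (p₁ t x) x
  hasDerivAt₁ : ∀ t x, HasDerivAt (p₁ t) (p₂ t x) x
  cont : Continuous fun q : ℝ × ℝ => p q.1 q.2
  cont₁ : Continuous fun q : ℝ × ℝ => p₁ q.1 q.2
  cont₂ : Continuous fun q : ℝ × ℝ => p₂ q.1 q.2
  bound : ∃ K : ℝ, 0 ≤ K ∧ ∀ t x, |p t x| ≤ K * Real.exp (-γ * |x - v * t|) ∧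
    |p₁ t x| ≤ K * Real.exp (-γ * |x - v * t|) ∧ |p₂ t x| ≤ K * Real.exp (-γ * |x - v * t|)
  period : ∃ τ : ℝ, 0 < τ ∧ ∀ t x, p (t + τ) (x + v * τ) = p t x ∧
    p₁ (t + τ) (x + v * τ) = p₁ t x ∧ p₂ (t + τ) (x + v * τ) = p₂ t x

section Frame

variable (α β : ℝ) (η₁ η₂ : ℝ → ℝ)

/-- The functions out of which breathers are built: cosine and sine of the first phase, hyperbolic
tangent and secant of the second one, and the inverse of the denominator. -/
noncomputable def frame (t x : ℝ) : Fin 5 → ℝ :=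
  ![Real.cos (α * (x + η₁ t)), Real.sin (α * (x + η₁ t)),
    Real.sinh (β * (x + η₂ t)) * (Real.cosh (β * (x + η₂ t)))⁻¹, (Real.cosh (β * (x + η₂ t)))⁻¹,
    (α ^ 2 + β ^ 2 * Real.sin (α * (x + η₁ t)) ^ 2 * (Real.cosh (β * (x + η₂ t)))⁻¹ ^ 2)⁻¹]

open MvPolynomial in
/-- The derivation of polynomials that corresponds to the derivative in space. -/
noncomputable def frameDeriv : Derivation ℝ (MvPolynomial (Fin 5) ℝ) (MvPolynomial (Fin 5) ℝ) :=
  mkDerivation ℝ ![-(C α * X 1), C α * X 0, C β * X 3 ^ 2, -(C β * X 2 * X 3),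
    -(C (2 * β ^ 2) * X 4 ^ 2 * X 1 * X 3 ^ 2 * (C α * X 0 - C β * X 1 * X 2))]

variable {α β η₁ η₂}

theorem frame_denominator_pos (hα : 0 < α) (s S : ℝ) : 0 < α ^ 2 + β ^ 2 * s ^ 2 * S ^ 2 := by
  positivity

theorem hasDerivAt_frame (hα : 0 < α) (t x : ℝ) (i : Fin 5) :
    HasDerivAt (fun y => frame α β η₁ η₂ t y i)
      (MvPolynomial.eval (frame α β η₁ η₂ t x) (frameDeriv α β (MvPolynomial.X i))) x := by
  have hc : Real.cosh (β * (x + η₂ t)) ≠ 0 := (Real.cosh_pos _).ne'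
  have l1 : HasDerivAt (fun y => α * (y + η₁ t)) α x := by
    simpa using ((hasDerivAt_id x).add_const (η₁ t)).const_mul α
  have l2 : HasDerivAt (fun y => β * (y + η₂ t)) β x := by
    simpa using ((hasDerivAt_id x).add_const (η₂ t)).const_mul β
  have d0 := l1.cos
  have d1 := l1.sin
  have d3 := l2.cosh.fun_inv hc
  have d2 := l2.sinh.fun_mul d3
  have d4 := ((((d1.fun_pow 2).const_mul (β ^ 2)).fun_mul (d3.fun_pow 2)).const_add
    (α ^ 2)).fun_inv (frame_denominator_pos hα _ _).ne'
  have hcs := Real.cosh_sq (β * (x + η₂ t))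
  fin_cases i
  · refine d0.congr_deriv ?_
    simp [frameDeriv, frame]; ring
  · refine d1.congr_deriv ?_
    simp [frameDeriv, frame]; ring
  · refine d2.congr_deriv ?_
    simp [frameDeriv, frame]
    field_simp
    linear_combination β * hcs
  · refine d3.congr_deriv ?_
    simp [frameDeriv, frame]
    field_simp
  · refine d4.congr_deriv ?_
    have hp := (frame_denominator_pos (β := β) hα (Real.sin (α * (x + η₁ t)))
      (Real.cosh (β * (x + η₂ t)))⁻¹).ne'
    simp [frameDeriv, frame]
    generalize (Real.cosh (β * (x + η₂ t)))⁻¹ = S at *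
    field_simp
    ring

/-- The five frame functions generate an algebra closed under differentiation, so every derivative
of a wave is again a polynomial in bounded functions and is never computed explicitly. -/
theorem hasDerivAt_eval_frame (hα : 0 < α) (t x : ℝ) (q : MvPolynomial (Fin 5) ℝ) :
    HasDerivAt (fun y => MvPolynomial.eval (frame α β η₁ η₂ t y) q)
      (MvPolynomial.eval (frame α β η₁ η₂ t x) (frameDeriv α β q)) x := by
  induction q using MvPolynomial.induction_on with
  | C c => simpa using hasDerivAt_const x c
  | add p q hp hq => simpa using hp.fun_add hq
  | mul_X p i hp =>
    simp only [map_mul, MvPolynomial.eval_X, Derivation.leibniz, smul_eq_mul, map_add]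
    refine (hp.fun_mul (hasDerivAt_frame hα t x i)).congr_deriv ?_
    ring

theorem abs_frame_le (hα : 0 < α) (t x : ℝ) (i : Fin 5) :
    |frame α β η₁ η₂ t x i| ≤ 1 + (α ^ 2)⁻¹ := by
  have h0 : 0 ≤ (α ^ 2)⁻¹ := by positivity
  have hc := Real.cosh_pos (β * (x + η₂ t))
  have hs : |Real.sinh (β * (x + η₂ t))| ≤ Real.cosh (β * (x + η₂ t)) := by
    rw [abs_le]
    constructor <;> nlinarith [Real.cosh_sq (β * (x + η₂ t)), Real.sinh_lt_cosh (β * (x + η₂ t)),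
      Real.exp_pos (-(β * (x + η₂ t))), Real.exp_pos (β * (x + η₂ t)),
      Real.cosh_add_sinh (β * (x + η₂ t)), Real.cosh_sub_sinh (β * (x + η₂ t))]
  fin_cases i
  · exact (Real.abs_cos_le_one _).trans (by simpa using h0)
  · exact (Real.abs_sin_le_one _).trans (by simpa using h0)
  · change |Real.sinh _ * (Real.cosh _)⁻¹| ≤ _
    rw [abs_mul, abs_inv, abs_of_pos hc, ← div_eq_mul_inv]
    exact ((div_le_one hc).2 hs).trans (by simpa using h0)
  · change |(Real.cosh _)⁻¹| ≤ _
    rw [abs_inv, abs_of_pos hc]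
    exact (inv_le_one_of_one_le₀ (Real.one_le_cosh _)).trans (by simpa using h0)
  · change |(α ^ 2 + _)⁻¹| ≤ _
    have hp := frame_denominator_pos (β := β) hα (Real.sin (α * (x + η₁ t)))
      (Real.cosh (β * (x + η₂ t)))⁻¹
    rw [abs_inv, abs_of_pos hp]
    have h1 : α ^ 2 ≤ α ^ 2 + β ^ 2 * Real.sin (α * (x + η₁ t)) ^ 2 *
        (Real.cosh (β * (x + η₂ t)))⁻¹ ^ 2 := le_add_of_nonneg_right (by positivity)
    have := inv_anti₀ (by positivity : 0 < α ^ 2) h1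
    linarith

theorem exists_abs_eval_frame_le (hα : 0 < α) (q : MvPolynomial (Fin 5) ℝ) :
    ∃ B : ℝ, 0 ≤ B ∧ ∀ t x, |MvPolynomial.eval (frame α β η₁ η₂ t x) q| ≤ B := by
  induction q using MvPolynomial.induction_on with
  | C c => exact ⟨|c|, abs_nonneg _, fun t x => by simp⟩
  | add p q hp hq =>
    obtain ⟨B, hB, h1⟩ := hp
    obtain ⟨C, hC, h2⟩ := hq
    refine ⟨B + C, by positivity, fun t x => ?_⟩
    rw [map_add]
    exact (abs_add_le _ _).trans (add_le_add (h1 t x) (h2 t x))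
  | mul_X p i hp =>
    obtain ⟨B, hB, h1⟩ := hp
    refine ⟨B * (1 + (α ^ 2)⁻¹), by positivity, fun t x => ?_⟩
    rw [map_mul, MvPolynomial.eval_X, abs_mul]
    exact mul_le_mul (h1 t x) (abs_frame_le hα t x i) (abs_nonneg _) hB

theorem continuous_eval_frame (hα : 0 < α) (h1 : Continuous η₁) (h2 : Continuous η₂)
    (q : MvPolynomial (Fin 5) ℝ) :
    Continuous fun z : ℝ × ℝ => MvPolynomial.eval (frame α β η₁ η₂ z.1 z.2) q := by
  refine (MvPolynomial.continuous_eval q).comp (continuous_pi fun i => ?_)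
  have hc : ∀ z : ℝ × ℝ, Real.cosh (β * (z.2 + η₂ z.1)) ≠ 0 := fun z => (Real.cosh_pos _).ne'
  have cc : Continuous fun z : ℝ × ℝ => (Real.cosh (β * (z.2 + η₂ z.1)))⁻¹ :=
    (Real.continuous_cosh.comp (by fun_prop)).inv₀ hc
  have cs : Continuous fun z : ℝ × ℝ => Real.sinh (β * (z.2 + η₂ z.1)) :=
    Real.continuous_sinh.comp (by fun_prop)
  fin_cases i
  · exact Real.continuous_cos.comp (by fun_prop)
  · exact Real.continuous_sin.comp (by fun_prop)
  · exact cs.mul cc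
  · exact cc
  · refine Continuous.inv₀ ?_ fun z => (frame_denominator_pos (β := β) hα _ _).ne'
    exact continuous_const.add ((continuous_const.mul ((Real.continuous_sin.comp
      (by fun_prop)).pow 2)).mul (cc.pow 2))

theorem inv_cosh_le (y : ℝ) : (Real.cosh y)⁻¹ ≤ 2 * Real.exp (-|y|) := by
  have h : Real.exp |y| / 2 ≤ Real.cosh y := by
    rw [← Real.cosh_abs, Real.cosh_eq]
    have := Real.exp_pos (-|y|)
    linarith
  have h2 := inv_anti₀ (by positivity) h
  rwa [inv_div, div_eq_mul_inv, ← Real.exp_neg] at h2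

/-- The variable `X 3` is the hyperbolic secant of the second phase, centred at v t up to a constant
shift. Its derivative is a multiple of itself, so the multiples of `X 3` are stable under the
derivation and all derivatives inherit its exponential decay. -/
theorem isWaveTriple_frame {v x₂ τ : ℝ} (hα : 0 < α) (hβ : 0 < β) (h1 : Continuous η₁)
    (h2 : ∀ t, η₂ t = x₂ - v * t) (hτ : 0 < τ)
    (hper : ∀ t x, frame α β η₁ η₂ (t + τ) (x + v * τ) = frame α β η₁ η₂ t x)
    (q : MvPolynomial (Fin 5) ℝ) {p : ℝ → ℝ → ℝ}
    (hp : ∀ t x, p t x = MvPolynomial.eval (frame α β η₁ η₂ t x) (MvPolynomial.X 3 * q)) :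
    ∃ p₁ p₂ : ℝ → ℝ → ℝ, IsWaveTriple v β p p₁ p₂ := by
  have h2c : Continuous η₂ := by
    rw [show η₂ = fun t => x₂ - v * t from funext h2]; fun_prop
  -- The operator induced on the cofactor of `X 3`: differentiating `X 3 * q` gives `X 3 * d q`.
  set d : MvPolynomial (Fin 5) ℝ → MvPolynomial (Fin 5) ℝ := fun q =>
    frameDeriv α β q - MvPolynomial.C β * MvPolynomial.X 2 * q with hd
  have hD : ∀ q, frameDeriv α β (MvPolynomial.X 3 * q) = MvPolynomial.X 3 * d q := fun q => by
    have : frameDeriv α β (MvPolynomial.X 3) =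
      -(MvPolynomial.C β * MvPolynomial.X 2 * MvPolynomial.X 3) := by simp [frameDeriv]
    rw [Derivation.leibniz, this, hd]
    simp only [smul_eq_mul]
    ring
  have hb : ∀ q, ∃ K : ℝ, 0 ≤ K ∧ ∀ t x, |MvPolynomial.eval (frame α β η₁ η₂ t x)
      (MvPolynomial.X 3 * q)| ≤ K * Real.exp (-β * |x - v * t|) := fun q => by
    obtain ⟨B, hB, hq⟩ := exists_abs_eval_frame_le (β := β) (η₁ := η₁) (η₂ := η₂) hα q
    refine ⟨2 * Real.exp (β * |x₂|) * B, by positivity, fun t x => ?_⟩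
    rw [map_mul, MvPolynomial.eval_X, abs_mul]
    have e : frame α β η₁ η₂ t x 3 = (Real.cosh (β * (x + η₂ t)))⁻¹ := rfl
    have h3 : |frame α β η₁ η₂ t x 3| ≤
        2 * (Real.exp (β * |x₂|) * Real.exp (-β * |x - v * t|)) := by
      rw [e, abs_inv, abs_of_pos (Real.cosh_pos _)]
      refine (inv_cosh_le _).trans ?_
      rw [← Real.exp_add]
      gcongr
      rw [abs_mul, abs_of_pos hβ, h2 t]
      have := abs_sub (x + (x₂ - v * t)) x₂
      rw [show x + (x₂ - v * t) - x₂ = x - v * t by ring] at this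
      nlinarith
    calc _ ≤ (2 * (Real.exp (β * |x₂|) * Real.exp (-β * |x - v * t|))) * B := by
          gcongr; exact hq t x
      _ = _ := by ring
  have hpe : p = fun t x => MvPolynomial.eval (frame α β η₁ η₂ t x) (MvPolynomial.X 3 * q) :=
    funext fun t => funext fun x => hp t x
  obtain ⟨K₀, hK₀, hb₀⟩ := hb q
  obtain ⟨K₁, hK₁, hb₁⟩ := hb (d q)
  obtain ⟨K₂, hK₂, hb₂⟩ := hb (d (d q))
  refine ⟨fun t x => MvPolynomial.eval (frame α β η₁ η₂ t x) (MvPolynomial.X 3 * d q),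
    fun t x => MvPolynomial.eval (frame α β η₁ η₂ t x) (MvPolynomial.X 3 * d (d q)), ?_⟩
  rw [hpe]
  refine ⟨fun t x => ?_, fun t x => ?_, continuous_eval_frame hα h1 h2c _,
    continuous_eval_frame hα h1 h2c _, continuous_eval_frame hα h1 h2c _,
    ⟨K₀ + K₁ + K₂, by positivity, fun t x => ⟨?_, ?_, ?_⟩⟩, ⟨τ, hτ, fun t x => ?_⟩⟩
  · rw [← hD]; exact hasDerivAt_eval_frame hα t x _
  · rw [← hD (d q)]; exact hasDerivAt_eval_frame hα t x _
  · exact (hb₀ t x).trans (by gcongr; linarith)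
  · exact (hb₁ t x).trans (by gcongr; linarith)
  · exact (hb₂ t x).trans (by gcongr; linarith)
  · simp only [hper, and_self]

end Frame

/-! ### Solitons and breathers as polynomials in the frame. -/

theorem groundState_eq {c : ℝ} (x : ℝ) :
    groundState c x = √(2 * c) * (Real.cosh (√c * x))⁻¹ := by
  unfold groundState
  rw [Real.sqrt_div' _ (by positivity), Real.sqrt_sq (Real.cosh_pos _).le, div_eq_mul_inv]

theorem breatherProfile_eq {α β : ℝ} (hα : 0 < α) (x₁ x₂ t x : ℝ) :
    breatherProfile α β x₁ x₂ t x =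
      MvPolynomial.eval (frame α β (fun t => (α ^ 2 - 3 * β ^ 2) * t + x₁)
        (fun t => (3 * α ^ 2 - β ^ 2) * t + x₂) t x)
        (MvPolynomial.X 3 * (MvPolynomial.C (2 * √2 * α * β) * MvPolynomial.X 4 *
          (MvPolynomial.C α * MvPolynomial.X 0 -
            MvPolynomial.C β * MvPolynomial.X 1 * MvPolynomial.X 2))) := by
  have hc : Real.cosh (β * (x + (3 * α ^ 2 - β ^ 2) * t + x₂)) ≠ 0 := (Real.cosh_pos _).ne'
  have l1 : HasDerivAt (fun y => α * (y + (α ^ 2 - 3 * β ^ 2) * t + x₁)) α x := by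
    simpa using (((hasDerivAt_id x).add_const ((α ^ 2 - 3 * β ^ 2) * t)).add_const x₁).const_mul α
  have l2 : HasDerivAt (fun y => β * (y + (3 * α ^ 2 - β ^ 2) * t + x₂)) β x := by
    simpa using (((hasDerivAt_id x).add_const ((3 * α ^ 2 - β ^ 2) * t)).add_const x₂).const_mul β
  have d := ((l1.sin.fun_div l2.cosh hc).const_mul (β / α)).arctan
  unfold breatherProfile
  rw [d.deriv]
  simp only [map_mul, map_sub, MvPolynomial.eval_X, MvPolynomial.eval_C]
  have e0 : frame α β (fun t => (α ^ 2 - 3 * β ^ 2) * t + x₁)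
      (fun t => (3 * α ^ 2 - β ^ 2) * t + x₂) t x 0 =
      Real.cos (α * (x + (α ^ 2 - 3 * β ^ 2) * t + x₁)) := by simp [frame, add_assoc]
  have e1 : frame α β (fun t => (α ^ 2 - 3 * β ^ 2) * t + x₁)
      (fun t => (3 * α ^ 2 - β ^ 2) * t + x₂) t x 1 =
      Real.sin (α * (x + (α ^ 2 - 3 * β ^ 2) * t + x₁)) := by simp [frame, add_assoc]
  have e3 : frame α β (fun t => (α ^ 2 - 3 * β ^ 2) * t + x₁)
      (fun t => (3 * α ^ 2 - β ^ 2) * t + x₂) t x 3 =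
      (Real.cosh (β * (x + (3 * α ^ 2 - β ^ 2) * t + x₂)))⁻¹ := by simp [frame, add_assoc]
  have e2 : frame α β (fun t => (α ^ 2 - 3 * β ^ 2) * t + x₁)
      (fun t => (3 * α ^ 2 - β ^ 2) * t + x₂) t x 2 =
      Real.sinh (β * (x + (3 * α ^ 2 - β ^ 2) * t + x₂)) *
      (Real.cosh (β * (x + (3 * α ^ 2 - β ^ 2) * t + x₂)))⁻¹ := by simp [frame, add_assoc]
  have e4 : frame α β (fun t => (α ^ 2 - 3 * β ^ 2) * t + x₁)
      (fun t => (3 * α ^ 2 - β ^ 2) * t + x₂) t x 4 =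
      (α ^ 2 + β ^ 2 * Real.sin (α * (x + (α ^ 2 - 3 * β ^ 2) * t + x₁)) ^ 2 *
      (Real.cosh (β * (x + (3 * α ^ 2 - β ^ 2) * t + x₂)))⁻¹ ^ 2)⁻¹ := by simp [frame, add_assoc]
  rw [e0, e1, e2, e3, e4]
  generalize Real.cosh (β * (x + (3 * α ^ 2 - β ^ 2) * t + x₂)) = S at *
  generalize Real.sinh (β * (x + (3 * α ^ 2 - β ^ 2) * t + x₂)) = S'
  generalize Real.sin (α * (x + (α ^ 2 - 3 * β ^ 2) * t + x₁)) = s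
  generalize Real.cos (α * (x + (α ^ 2 - 3 * β ^ 2) * t + x₁)) = c
  have n1 : α ^ 2 + β ^ 2 * s ^ 2 * S⁻¹ ^ 2 ≠ 0 := (frame_denominator_pos hα _ _).ne'
  have n2 : 1 + (β / α * (s / S)) ^ 2 ≠ 0 := by positivity
  have n3 : α ≠ 0 := hα.ne'
  have e5 : (α ^ 2 + β ^ 2 * s ^ 2 * S⁻¹ ^ 2)⁻¹ = (α ^ 2)⁻¹ * (1 + (β / α * (s / S)) ^ 2)⁻¹ := by
    rw [← mul_inv]; congr 1; field_simp
  rw [e5, one_div]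
  generalize (1 + (β / α * (s / S)) ^ 2)⁻¹ = R
  field_simp

theorem Wave.b_pos (w : Wave) : 0 < w.b := by
  cases w with
  | soliton c κ x₀ hc hκ => exact Real.sqrt_pos.2 hc
  | breather α β x₁ x₂ hα hβ => exact hβ

theorem Wave.exists_triple (w : Wave) :
    ∃ p₁ p₂ : ℝ → ℝ → ℝ, IsWaveTriple w.velocity w.b w.profile p₁ p₂ := by
  cases w with
  | soliton c κ x₀ hc hκ =>
    -- The value `α = 1` is a dummy, since a soliton involves only `X 3` and a constant. The first
    -- phase is made to travel with the soliton, so that any `τ` is a period.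
    refine isWaveTriple_frame (α := 1) (β := √c) (η₁ := fun t => -c * t)
      (η₂ := fun t => -x₀ - c * t) (x₂ := -x₀) (τ := 1) one_pos (Real.sqrt_pos.2 hc) (by fun_prop)
      (fun t => rfl) one_pos (fun t x => ?_) (MvPolynomial.C (κ * √(2 * c))) (fun t x => ?_)
    · have a1 : x + c * 1 + -c * (t + 1) = x + -c * t := by ring
      have a2 : x + c * 1 + (-x₀ - c * (t + 1)) = x + (-x₀ - c * t) := by ring
      simp only [frame, a1, a2]
    · simp only [Wave.profile, solitonProfile, groundState_eq, map_mul, MvPolynomial.eval_X,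
        MvPolynomial.eval_C]
      have : frame 1 (√c) (fun t => -c * t) (fun t => -x₀ - c * t) t x 3 =
        (Real.cosh (√c * (x + (-x₀ - c * t))))⁻¹ := rfl
      rw [this, show x + (-x₀ - c * t) = x - x₀ - c * t by ring]
      ring
  | breather α β x₁ x₂ hα hβ =>
    have hs : 0 < α * (α ^ 2 + β ^ 2) := by positivity
    -- In the frame of velocity β² - 3α² the second phase is constant, while the first changes in
    -- time τ by α(β² - 3α² + α² - 3β²)τ = -2α(α² + β²)τ; the chosen period makes this -2π.
    refine isWaveTriple_frame (α := α) (β := β) (η₁ := fun t => (α ^ 2 - 3 * β ^ 2) * t + x₁)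
      (η₂ := fun t => (3 * α ^ 2 - β ^ 2) * t + x₂) (x₂ := x₂) (τ := Real.pi / (α * (α ^ 2 + β ^ 2)))
      hα hβ (by fun_prop) (fun t => by simp only [Wave.velocity]; ring) (by positivity)
      (fun t x => ?_) _ (fun t x => breatherProfile_eq hα x₁ x₂ t x)
    set τ := Real.pi / (α * (α ^ 2 + β ^ 2)) with hτ
    have hτ' : τ * (α * (α ^ 2 + β ^ 2)) = Real.pi := by rw [hτ]; field_simp
    have a1 : α * (x + Wave.velocity (.breather α β x₁ x₂ hα hβ) * τ +
        ((α ^ 2 - 3 * β ^ 2) * (t + τ) + x₁)) =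
        α * (x + ((α ^ 2 - 3 * β ^ 2) * t + x₁)) - 2 * Real.pi := by
      simp only [Wave.velocity]; rw [← hτ']; ring
    have a2 : x + Wave.velocity (.breather α β x₁ x₂ hα hβ) * τ +
        ((3 * α ^ 2 - β ^ 2) * (t + τ) + x₂) = x + ((3 * α ^ 2 - β ^ 2) * t + x₂) := by
      simp only [Wave.velocity]; ring
    simp only [frame, a1, a2, Real.cos_sub_two_pi, Real.sin_sub_two_pi]

/-! ### Sums of decoupled waves -/

theorem integrable_exp_neg_mul_abs {γ : ℝ} (hγ : 0 < γ) (c : ℝ) :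
    Integrable fun x : ℝ => Real.exp (-γ * |x - c|) := by
  have h : Integrable fun x : ℝ => Real.exp (-γ * |x|) := by
    rw [← integrableOn_univ, ← Set.Iic_union_Ioi (a := (0 : ℝ))]
    refine IntegrableOn.union ?_ ?_
    · refine (integrableOn_exp_mul_Iic hγ 0).congr_fun (fun x hx => ?_) measurableSet_Iic
      simp only [abs_of_nonpos (Set.mem_Iic.1 hx)]; congr 1; ring
    · refine (integrableOn_exp_mul_Ioi (neg_lt_zero.2 hγ) 0).congr_fun (fun x hx => ?_)
        measurableSet_Ioi
      simp only [abs_of_pos (Set.mem_Ioi.1 hx)]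
  exact h.comp_sub_right c

theorem tendsto_exp_neg_mul_abs {γ w : ℝ} (hγ : 0 < γ) (hw : w ≠ 0) (y : ℝ) :
    Tendsto (fun t => Real.exp (-γ * |y + w * t|)) atTop (𝓝 0) := by
  refine Real.tendsto_exp_atBot.comp ?_
  refine Tendsto.const_mul_atTop_of_neg (neg_lt_zero.2 hγ) ?_
  rcases lt_or_gt_of_ne hw with h | h
  · exact tendsto_abs_atBot_atTop.comp
      (tendsto_atBot_add_const_left _ y (tendsto_id.const_mul_atTop_of_neg h))
  · exact tendsto_abs_atTop_atTop.comp
      (tendsto_atTop_add_const_left _ y (tendsto_id.const_mul_atTop h))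

/-- Dominated convergence in a moving frame. -/
theorem tendsto_integral_of_localized {F : ℝ → ℝ → ℝ} {v γ K : ℝ} (hγ : 0 < γ)
    (hm : ∀ t, AEStronglyMeasurable (F t))
    (hb : ∀ t x, |F t x| ≤ K * Real.exp (-γ * |x - v * t|))
    (hl : ∀ y, Tendsto (fun t => F t (y + v * t)) atTop (𝓝 0)) :
    Tendsto (fun t => ∫ x, F t x) atTop (𝓝 0) := by
  have e : ∀ t, ∫ x, F t x = ∫ y, F t (y + v * t) := fun t =>
    (integral_add_right_eq_self (F t) (v * t)).symm
  simp only [e]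
  rw [show (0 : ℝ) = ∫ _ : ℝ, (0 : ℝ) by simp]
  refine tendsto_integral_filter_of_dominated_convergence
    (fun y => K * Real.exp (-γ * |y|)) (Eventually.of_forall fun t => ?_)
    (Eventually.of_forall fun t => Eventually.of_forall fun y => ?_) ?_
    (Eventually.of_forall hl)
  · exact (hm t).comp_quasiMeasurePreserving
      (measurePreserving_add_right volume (v * t)).quasiMeasurePreserving
  · simpa using hb t (y + v * t)
  · simpa using (integrable_exp_neg_mul_abs hγ 0).const_mul K

namespace IsWaveTriple

variable {v γ : ℝ} {p p₁ p₂ : ℝ → ℝ → ℝ}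

theorem mono (h : IsWaveTriple v γ p p₁ p₂) {γ' : ℝ} (hγ : γ' ≤ γ) :
    IsWaveTriple v γ' p p₁ p₂ := by
  obtain ⟨K, hK, hb⟩ := h.bound
  have e : ∀ t x, K * Real.exp (-γ * |x - v * t|) ≤ K * Real.exp (-γ' * |x - v * t|) :=
    fun t x => by
      have := abs_nonneg (x - v * t)
      gcongr
  exact { h with bound := ⟨K, hK, fun t x => ⟨(hb t x).1.trans (e t x), (hb t x).2.1.trans (e t x),
    (hb t x).2.2.trans (e t x)⟩⟩ }

theorem memLp_two_of_exp_le {f : ℝ → ℝ} (hf : Continuous f) {K c : ℝ} (hγ : 0 < γ)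
    (hb : ∀ x, |f x| ≤ K * Real.exp (-γ * |x - c|)) :
    MemLp f 2 ∧ l2sq f ≤ K ^ 2 * ∫ x : ℝ, Real.exp (-(2 * γ) * |x|) := by
  have hi := (integrable_exp_neg_mul_abs (γ := 2 * γ) (by positivity) c).const_mul (K ^ 2)
  have hle : ∀ x, f x ^ 2 ≤ K ^ 2 * Real.exp (-(2 * γ) * |x - c|) := fun x => by
    rw [← sq_abs, show -(2 * γ) * |x - c| = -γ * |x - c| + -γ * |x - c| by ring, Real.exp_add,
      ← sq, ← mul_pow]
    exact pow_le_pow_left₀ (abs_nonneg _) (hb x) 2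
  have hfi : Integrable fun x => f x ^ 2 := hi.mono' (hf.pow 2).aestronglyMeasurable
    (Eventually.of_forall fun x => by
      rw [Real.norm_of_nonneg (sq_nonneg _)]; exact hle x)
  refine ⟨(memLp_two_iff_integrable_sq hf.aestronglyMeasurable).2 hfi, ?_⟩
  refine (integral_mono hfi hi hle).trans (le_of_eq ?_)
  rw [integral_const_mul, integral_sub_right_eq_self (fun x => Real.exp (-(2 * γ) * |x|)) c]

theorem triple (h : IsWaveTriple v γ p p₁ p₂) (hγ : 0 < γ) (t : ℝ) :
    IsH2Triple (p t) (p₁ t) (p₂ t) := by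
  obtain ⟨K, hK, hb⟩ := h.bound
  have c0 : Continuous (p t) := h.cont.comp (Continuous.prodMk_right t)
  have c1 : Continuous (p₁ t) := h.cont₁.comp (Continuous.prodMk_right t)
  have c2 : Continuous (p₂ t) := h.cont₂.comp (Continuous.prodMk_right t)
  exact .of_hasDerivAt (h.hasDerivAt t) (h.hasDerivAt₁ t) c2
    (memLp_two_of_exp_le c0 hγ fun x => (hb t x).1).1
    (memLp_two_of_exp_le c1 hγ fun x => (hb t x).2.1).1
    (memLp_two_of_exp_le c2 hγ fun x => (hb t x).2.2).1

theorem exists_h2sq_le (h : IsWaveTriple v γ p p₁ p₂) (hγ : 0 < γ) :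
    ∃ H : ℝ, ∀ t, h2sq (p t) (p₁ t) (p₂ t) ≤ H := by
  obtain ⟨K, hK, hb⟩ := h.bound
  refine ⟨3 * (K ^ 2 * ∫ x : ℝ, Real.exp (-(2 * γ) * |x|)), fun t => ?_⟩
  have c0 : Continuous (p t) := h.cont.comp (Continuous.prodMk_right t)
  have c1 : Continuous (p₁ t) := h.cont₁.comp (Continuous.prodMk_right t)
  have c2 : Continuous (p₂ t) := h.cont₂.comp (Continuous.prodMk_right t)
  have l0 := (memLp_two_of_exp_le c0 hγ fun x => (hb t x).1).2
  have l1 := (memLp_two_of_exp_le c1 hγ fun x => (hb t x).2.1).2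
  have l2 := (memLp_two_of_exp_le c2 hγ fun x => (hb t x).2.2).2
  unfold h2sq
  linarith

theorem exists_abs_dens_le (h : IsWaveTriple v γ p p₁ p₂) (hγ : 0 < γ) (A D : ℝ) :
    ∃ K : ℝ, 0 ≤ K ∧
      ∀ t x, |dens A D (p t x) (p₁ t x) (p₂ t x)| ≤ K * Real.exp (-γ * |x - v * t|) := by
  obtain ⟨K, hK, hb⟩ := h.bound
  have le1 : ∀ t x, Real.exp (-γ * |x - v * t|) ≤ 1 := fun t x => by
    rw [Real.exp_le_one_iff]; have := abs_nonneg (x - v * t); nlinarith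
  have hd := densConst_nonneg A D K
  refine ⟨densConst A D K * (5 * (3 * K ^ 2)), by positivity, fun t x => ?_⟩
  refine (IsH2Triple.abs_dens_le (f := p t) (f' := p₁ t) (f'' := p₂ t) (B := K)
    (fun x => (hb t x).1.trans (mul_le_of_le_one_right hK (le1 t x))) A D x).trans ?_
  rw [mul_assoc, mul_assoc 5]
  refine mul_le_mul_of_nonneg_left (mul_le_mul_of_nonneg_left ?_ (by norm_num)) hd
  have hs : ∀ y : ℝ, |y| ≤ K * Real.exp (-γ * |x - v * t|) →
      y ^ 2 ≤ K ^ 2 * Real.exp (-γ * |x - v * t|) := fun y hy => by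
    rw [← sq_abs]
    refine (pow_le_pow_left₀ (abs_nonneg _) hy 2).trans ?_
    rw [mul_pow]
    have := mul_le_mul_of_nonneg_left (le1 t x) (Real.exp_pos (-γ * |x - v * t|)).le
    nlinarith [sq_nonneg K]
  linarith [hs _ (hb t x).1, hs _ (hb t x).2.1, hs _ (hb t x).2.2]

theorem continuous_dens (h : IsWaveTriple v γ p p₁ p₂) (A D : ℝ) :
    Continuous fun q : ℝ × ℝ => dens A D (p q.1 q.2) (p₁ q.1 q.2) (p₂ q.1 q.2) := by
  have h0 := h.cont
  have h1 := h.cont₁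
  have h2 := h.cont₂
  unfold dens
  fun_prop

/-- The functional of a wave is a continuous function of time. -/
theorem continuous_integral_dens (h : IsWaveTriple v γ p p₁ p₂) (hγ : 0 < γ) (A D : ℝ) :
    Continuous fun t => ∫ x, dens A D (p t x) (p₁ t x) (p₂ t x) := by
  obtain ⟨K, hK, hb⟩ := h.exists_abs_dens_le hγ A D
  have e : ∀ t, ∫ x, dens A D (p t x) (p₁ t x) (p₂ t x) =
      ∫ y, dens A D (p t (y + v * t)) (p₁ t (y + v * t)) (p₂ t (y + v * t)) := fun t =>
    (integral_add_right_eq_self (fun x => dens A D (p t x) (p₁ t x) (p₂ t x)) (v * t)).symm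
  simp only [e]
  have hc := h.continuous_dens A D
  refine continuous_of_dominated (bound := fun y => K * Real.exp (-γ * |y|)) (fun t => ?_)
    (fun t => Eventually.of_forall fun y => ?_) ?_ (Eventually.of_forall fun y => ?_)
  · exact (hc.comp (f := fun y : ℝ => (t, y + v * t)) (by fun_prop)).aestronglyMeasurable
  · simpa using hb t (y + v * t)
  · simpa using (integrable_exp_neg_mul_abs hγ 0).const_mul K
  · exact hc.comp (f := fun t : ℝ => (t, y + v * t)) (by fun_prop)

/-- The functional of a wave is a periodic function of time. -/
theorem exists_periodic_integral_dens (h : IsWaveTriple v γ p p₁ p₂) (A D : ℝ) :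
    ∃ τ : ℝ, 0 < τ ∧
      Function.Periodic (fun t => ∫ x, dens A D (p t x) (p₁ t x) (p₂ t x)) τ := by
  obtain ⟨τ, hτ, hp⟩ := h.period
  refine ⟨τ, hτ, fun t => ?_⟩
  refine (integral_add_right_eq_self (fun x => dens A D (p (t + τ) x) (p₁ (t + τ) x)
    (p₂ (t + τ) x)) (v * τ)).symm.trans ?_
  exact integral_congr_ae (Eventually.of_forall fun x => by
    simp only [(hp t x).1, (hp t x).2.1, (hp t x).2.2])

end IsWaveTriple

/-- Pure terms cancel, and each remaining monomial contains a factor from either family; the other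
factors are bounded by `B`. The interaction of two waves is therefore controlled by the product of
their sizes. -/
theorem abs_dens_add_sub_le {A D B a₀ a₁ a₂ b₀ b₁ b₂ : ℝ} (ha₀ : |a₀| ≤ B) (hb₀ : |b₀| ≤ B)
    (ha₁ : |a₁| ≤ B) (hb₁ : |b₁| ≤ B) :
    |dens A D (a₀ + b₀) (a₁ + b₁) (a₂ + b₂) - dens A D a₀ a₁ a₂ - dens A D b₀ b₁ b₂| ≤
      (1 + 35 * B ^ 2 + 16 * B ^ 4 + |A| * (1 + 4 * B ^ 2) + |D|) *
        ((|a₀| + |a₁| + |a₂|) * (|b₀| + |b₁| + |b₂|)) := by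
  set X := |a₀| + |a₁| + |a₂| with hX
  set Y := |b₀| + |b₁| + |b₂| with hY
  have n4 := abs_nonneg a₀
  have n5 := abs_nonneg a₁
  have n6 := abs_nonneg a₂
  have n7 := abs_nonneg b₀
  have n8 := abs_nonneg b₁
  have n9 := abs_nonneg b₂
  have hB : 0 ≤ B := n4.trans ha₀
  have cr : ∀ x y : ℝ, |x| ≤ X → |y| ≤ Y → |x * y| ≤ X * Y := fun x y hx hy => by
    rw [abs_mul]; exact mul_le_mul hx hy (abs_nonneg _) ((abs_nonneg _).trans hx)
  have bb : ∀ x y : ℝ, |x| ≤ B → |y| ≤ B → |x * y| ≤ B ^ 2 := fun x y hx hy => by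
    rw [abs_mul, sq]; exact mul_le_mul hx hy (abs_nonneg _) hB
  have c00 := cr a₀ b₀ (by linarith) (by linarith)
  have c11 := cr a₁ b₁ (by linarith) (by linarith)
  have c22 := cr a₂ b₂ (by linarith) (by linarith)
  have c01 := cr a₀ b₁ (by linarith) (by linarith)
  have c10 := cr a₁ b₀ (by linarith) (by linarith)
  have hXY : 0 ≤ X * Y := (abs_nonneg _).trans c00
  have pr : ∀ x y M : ℝ, |x| ≤ M → |y| ≤ X * Y → |x * y| ≤ M * (X * Y) := fun x y M hx hy => by
    rw [abs_mul]; exact mul_le_mul hx hy (abs_nonneg _) ((abs_nonneg _).trans hx)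
  have d4 : |4 * (a₀ * a₀) + 6 * (a₀ * b₀) + 4 * (b₀ * b₀)| ≤ 14 * B ^ 2 := by
    have h1 := abs_le.1 (bb a₀ a₀ ha₀ ha₀)
    have h2 := abs_le.1 (bb a₀ b₀ ha₀ hb₀)
    have h3 := abs_le.1 (bb b₀ b₀ hb₀ hb₀)
    rw [abs_le]; constructor <;> linarith
  have b4 : ∀ x y : ℝ, |x| ≤ B ^ 2 → |y| ≤ B ^ 2 → |x * y| ≤ B ^ 4 := fun x y hx hy => by
    rw [abs_mul, show B ^ 4 = B ^ 2 * B ^ 2 by ring]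
    exact mul_le_mul hx hy (abs_nonneg _) (by positivity)
  have d6 : |6 * ((a₀ * a₀) * (a₀ * a₀)) + 15 * ((a₀ * a₀) * (a₀ * b₀)) +
      20 * ((a₀ * a₀) * (b₀ * b₀)) + 15 * ((b₀ * b₀) * (a₀ * b₀)) +
      6 * ((b₀ * b₀) * (b₀ * b₀))| ≤ 62 * B ^ 4 := by
    have h1 := bb a₀ a₀ ha₀ ha₀
    have h2 := bb a₀ b₀ ha₀ hb₀
    have h3 := bb b₀ b₀ hb₀ hb₀
    have e1 := abs_le.1 (b4 _ _ h1 h1)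
    have e2 := abs_le.1 (b4 _ _ h1 h2)
    have e3 := abs_le.1 (b4 _ _ h1 h3)
    have e4 := abs_le.1 (b4 _ _ h3 h2)
    have e5 := abs_le.1 (b4 _ _ h3 h3)
    rw [abs_le]; constructor <;> linarith
  have m4 := pr _ _ _ d4 c00
  have m6 := pr _ _ _ d6 c00
  have w1 : |a₀ * b₁ + a₁ * b₀| ≤ 2 * (X * Y) := (abs_add_le _ _).trans (by linarith)
  have w2 : |2 * (a₀ * a₁) + 2 * (b₀ * b₁) + (a₀ * b₁ + a₁ * b₀)| ≤ 6 * B ^ 2 := by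
    have h1 := abs_le.1 (bb a₀ a₁ ha₀ ha₁)
    have h2 := abs_le.1 (bb b₀ b₁ hb₀ hb₁)
    have h3 := abs_le.1 (bb a₀ b₁ ha₀ hb₁)
    have h4 := abs_le.1 (bb a₁ b₀ ha₁ hb₀)
    rw [abs_le]; constructor <;> linarith
  have m22 : |2 * ((a₁ * b₁) * (a₀ * b₀)) + (2 * (a₀ * a₁) + 2 * (b₀ * b₁) +
      (a₀ * b₁ + a₁ * b₀)) * (a₀ * b₁ + a₁ * b₀)| ≤ 14 * B ^ 2 * (X * Y) := by
    have h1 := pr _ _ _ (bb a₁ b₁ ha₁ hb₁) c00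
    have h2 : |(2 * (a₀ * a₁) + 2 * (b₀ * b₁) + (a₀ * b₁ + a₁ * b₀)) * (a₀ * b₁ + a₁ * b₀)| ≤
        6 * B ^ 2 * (2 * (X * Y)) := by
      rw [abs_mul]; exact mul_le_mul w2 w1 (abs_nonneg _) (by positivity)
    refine (abs_add_le _ _).trans ?_
    rw [abs_mul 2, abs_of_pos (by norm_num : (0 : ℝ) < 2)]
    linarith
  have e : dens A D (a₀ + b₀) (a₁ + b₁) (a₂ + b₂) - dens A D a₀ a₁ a₂ - dens A D b₀ b₁ b₂ =
      a₂ * b₂ - 5 / 2 * (2 * ((a₁ * b₁) * (a₀ * b₀)) + (2 * (a₀ * a₁) + 2 * (b₀ * b₁) +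
      (a₀ * b₁ + a₁ * b₀)) * (a₀ * b₁ + a₁ * b₀)) + 1 / 4 * ((6 * ((a₀ * a₀) * (a₀ * a₀)) +
      15 * ((a₀ * a₀) * (a₀ * b₀)) +
      20 * ((a₀ * a₀) * (b₀ * b₀)) + 15 * ((b₀ * b₀) * (a₀ * b₀)) +
      6 * ((b₀ * b₀) * (b₀ * b₀))) * (a₀ * b₀)) + A * (a₁ * b₁)
      - (1 / 4 * A) * ((4 * (a₀ * a₀) + 6 * (a₀ * b₀) + 4 * (b₀ * b₀)) * (a₀ * b₀))
      - (-D) * (a₀ * b₀) := by unfold dens; ring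
  rw [e]
  refine (abs_six_le _ _ _ _ _ _).trans ?_
  simp only [abs_mul (5 / 2 : ℝ), abs_mul (1 / 4 * A), abs_mul (1 / 4 : ℝ), abs_mul A,
    abs_mul (-D), abs_neg D]
  rw [show |(5 / 2 : ℝ)| = 5 / 2 by norm_num, show |(1 / 4 : ℝ)| = 1 / 4 by norm_num]
  have r1 : |A| * |a₁ * b₁| ≤ |A| * (X * Y) := by gcongr
  have r2 := mul_le_mul_of_nonneg_left m4 (by positivity : 0 ≤ 1 / 4 * |A|)
  have r3 : |D| * |a₀ * b₀| ≤ |D| * (X * Y) := by gcongr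
  have r4 : 0 ≤ |A| * B ^ 2 * (X * Y) := by positivity
  have r5 : 0 ≤ B ^ 4 * (X * Y) := by positivity
  linarith

section Sum

variable {ι : Type*} {s : Finset ι} {v : ι → ℝ} {γ : ℝ} {p p₁ p₂ : ι → ℝ → ℝ → ℝ}

theorem isH2Triple_sum (hγ : 0 < γ)
    (h : ∀ i ∈ s, IsWaveTriple (v i) γ (p i) (p₁ i) (p₂ i)) (t : ℝ) :
    IsH2Triple (fun x => ∑ i ∈ s, p i t x) (fun x => ∑ i ∈ s, p₁ i t x)
      (fun x => ∑ i ∈ s, p₂ i t x) :=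
  IsH2Triple.sum s (F := fun i => p i t) (F' := fun i => p₁ i t) (F'' := fun i => p₂ i t)
    fun i hi => (h i hi).triple hγ t

theorem exists_sum_bound (h : ∀ i ∈ s, IsWaveTriple (v i) γ (p i) (p₁ i) (p₂ i)) :
    ∃ K : ℝ, 0 ≤ K ∧ ∀ t x,
      |∑ i ∈ s, p i t x| ≤ K * ∑ i ∈ s, Real.exp (-γ * |x - v i * t|) ∧
      |∑ i ∈ s, p₁ i t x| ≤ K * ∑ i ∈ s, Real.exp (-γ * |x - v i * t|) ∧
      |∑ i ∈ s, p₂ i t x| ≤ K * ∑ i ∈ s, Real.exp (-γ * |x - v i * t|) := by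
  choose! K hK hb using fun i (hi : i ∈ s) => (h i hi).bound
  have hle : ∀ i ∈ s, K i ≤ ∑ j ∈ s, K j := fun i hi =>
    Finset.single_le_sum (f := K) (fun j hj => hK j hj) hi
  refine ⟨∑ i ∈ s, K i, Finset.sum_nonneg hK, fun t x => ⟨?_, ?_, ?_⟩⟩ <;>
  · refine (Finset.abs_sum_le_sum_abs _ _).trans ?_
    rw [Finset.mul_sum]
    refine Finset.sum_le_sum fun i hi => ?_
    first
    | exact (hb i hi t x).1.trans (mul_le_mul_of_nonneg_right (hle i hi) (Real.exp_pos _).le)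
    | exact (hb i hi t x).2.1.trans (mul_le_mul_of_nonneg_right (hle i hi) (Real.exp_pos _).le)
    | exact (hb i hi t x).2.2.trans (mul_le_mul_of_nonneg_right (hle i hi) (Real.exp_pos _).le)

theorem h2sq_add_le {f f₁ f₂ g g₁ g₂ : ℝ → ℝ} (hf : IsH2Triple f f₁ f₂) (hg : IsH2Triple g g₁ g₂) :
    h2sq (fun x => f x + g x) (fun x => f₁ x + g₁ x) (fun x => f₂ x + g₂ x) ≤
      2 * h2sq f f₁ f₂ + 2 * h2sq g g₁ g₂ := by
  have h0 := l2sq_add_le hf.memLp₀ hg.memLp₀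
  have h1 := l2sq_add_le hf.memLp₁ hg.memLp₁
  have h2 := l2sq_add_le hf.memLp₂ hg.memLp₂
  unfold h2sq
  linarith

theorem exists_h2sq_sum_le (hγ : 0 < γ)
    (h : ∀ i ∈ s, IsWaveTriple (v i) γ (p i) (p₁ i) (p₂ i)) :
    ∃ H : ℝ, ∀ t, h2sq (fun x => ∑ i ∈ s, p i t x) (fun x => ∑ i ∈ s, p₁ i t x)
      (fun x => ∑ i ∈ s, p₂ i t x) ≤ H := by
  classical
  induction s using Finset.induction_on with
  | empty => exact ⟨0, fun t => by simp [h2sq, l2sq]⟩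
  | insert k s hk ih =>
    obtain ⟨H, hH⟩ := ih fun i hi => h i (Finset.mem_insert_of_mem hi)
    obtain ⟨H', hH'⟩ := (h k (Finset.mem_insert_self _ _)).exists_h2sq_le hγ
    refine ⟨2 * H' + 2 * H, fun t => ?_⟩
    simp only [Finset.sum_insert hk]
    have := h2sq_add_le ((h k (Finset.mem_insert_self _ _)).triple hγ t)
      (isH2Triple_sum hγ (fun i hi => h i (Finset.mem_insert_of_mem hi)) t)
    linarith [hH t, hH' t]

/-- The interaction terms of waves with distinct velocities vanish in the limit. -/
theorem tendsto_integral_dens_sum_sub (A D : ℝ) (hγ : 0 < γ)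
    (h : ∀ i ∈ s, IsWaveTriple (v i) γ (p i) (p₁ i) (p₂ i)) (hv : Set.InjOn v s)
    {Φ : ℝ → ℝ → ℝ} (hΦ : ∀ t, AEStronglyMeasurable (Φ t)) (hΦ1 : ∀ t x, |Φ t x| ≤ 1) :
    Tendsto (fun t => (∫ x, dens A D (∑ i ∈ s, p i t x) (∑ i ∈ s, p₁ i t x) (∑ i ∈ s, p₂ i t x) *
      Φ t x) - ∑ i ∈ s, ∫ x, dens A D (p i t x) (p₁ i t x) (p₂ i t x) * Φ t x) atTop (𝓝 0) := by
  classical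
  induction s using Finset.induction_on with
  | empty => simp [dens]
  | insert k s hk ih =>
    have hs : ∀ i ∈ s, IsWaveTriple (v i) γ (p i) (p₁ i) (p₂ i) := fun i hi =>
      h i (Finset.mem_insert_of_mem hi)
    have hw := h k (Finset.mem_insert_self _ _)
    have ih' := ih hs (hv.mono (by simp))
    have T1 := fun t => isH2Triple_sum hγ hs t
    have T2 := fun t => hw.triple hγ t
    obtain ⟨K, hK, hb⟩ := hw.bound
    obtain ⟨L, hL, hsb⟩ := exists_sum_bound hs
    have le1 : ∀ z : ℝ, Real.exp (-γ * |z|) ≤ 1 := fun z => by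
      rw [Real.exp_le_one_iff]; have := abs_nonneg z; nlinarith
    have hcard : ∀ t x, L * ∑ i ∈ s, Real.exp (-γ * |x - v i * t|) ≤ L * s.card := fun t x => by
      refine mul_le_mul_of_nonneg_left ?_ hL
      simpa using Finset.sum_le_card_nsmul s _ 1 fun i _ => le1 (x - v i * t)
    set B := K + L * s.card with hB
    have hB0 : 0 ≤ B := by positivity
    have kB : ∀ t x, K * Real.exp (-γ * |x - v k * t|) ≤ B := fun t x => by
      have := mul_le_of_le_one_right hK (le1 (x - v k * t))
      have : 0 ≤ L * s.card := by positivity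
      linarith
    have sB : ∀ t x, L * ∑ i ∈ s, Real.exp (-γ * |x - v i * t|) ≤ B := fun t x => by
      linarith [hcard t x]
    set C := 1 + 35 * B ^ 2 + 16 * B ^ 4 + |A| * (1 + 4 * B ^ 2) + |D| with hC
    have hC0 : 0 ≤ C := by positivity
    set E : ℝ → ℝ → ℝ := fun t x => dens A D (p k t x + ∑ i ∈ s, p i t x)
      (p₁ k t x + ∑ i ∈ s, p₁ i t x) (p₂ k t x + ∑ i ∈ s, p₂ i t x) -
      dens A D (p k t x) (p₁ k t x) (p₂ k t x) -
      dens A D (∑ i ∈ s, p i t x) (∑ i ∈ s, p₁ i t x) (∑ i ∈ s, p₂ i t x) with hE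
    have hEb : ∀ t x, |E t x| ≤ C * (3 * (K * Real.exp (-γ * |x - v k * t|)) *
        (3 * (L * ∑ i ∈ s, Real.exp (-γ * |x - v i * t|)))) := fun t x => by
      obtain ⟨k0, k1, k2⟩ := hb t x
      obtain ⟨s0, s1, s2⟩ := hsb t x
      refine (abs_dens_add_sub_le (k0.trans (kB t x)) (s0.trans (sB t x)) (k1.trans (kB t x))
        (s1.trans (sB t x))).trans (mul_le_mul_of_nonneg_left ?_ hC0)
      exact mul_le_mul (by linarith) (by linarith) (by positivity) (by positivity)
    have T3 := fun t => (T2 t).add (T1 t)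
    -- In the frame of the new wave the interaction is dominated by the decay of that wave, and at
    -- each fixed point it tends to zero because the others have different velocities.
    have main : Tendsto (fun t => ∫ x, E t x * Φ t x) atTop (𝓝 0) := by
      refine tendsto_integral_of_localized (v := v k) (K := C * (3 * K * (3 * (L * s.card)))) hγ
        (fun t => ?_) (fun t x => ?_) fun y => ?_
      · exact ((((T3 t).aestronglyMeasurable_dens A D).sub
          ((T2 t).aestronglyMeasurable_dens A D)).sub
          ((T1 t).aestronglyMeasurable_dens A D)).mul (hΦ t)
      · rw [abs_mul]
        refine (mul_le_of_le_one_right (abs_nonneg _) (hΦ1 t x)).trans ((hEb t x).trans ?_)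
        have e1 : C * (3 * K * (3 * (L * s.card))) * Real.exp (-γ * |x - v k * t|) =
          C * (3 * (K * Real.exp (-γ * |x - v k * t|)) * (3 * (L * s.card))) := by ring
        rw [e1]
        have := hcard t x
        gcongr
      · have l1 : Tendsto (fun t => C * (3 * K * (3 * (L * ∑ i ∈ s,
            Real.exp (-γ * |y + (v k - v i) * t|))))) atTop (𝓝 0) := by
          have : Tendsto (fun t => ∑ i ∈ s, Real.exp (-γ * |y + (v k - v i) * t|)) atTop
              (𝓝 (∑ i ∈ s, 0)) := tendsto_finsetSum _ fun i hi => by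
            refine tendsto_exp_neg_mul_abs hγ (sub_ne_zero.2 fun e => hk ?_) y
            rwa [hv (by simp) (by simp [hi]) e]
          simpa using (((this.const_mul L).const_mul 3).const_mul (3 * K)).const_mul C
        refine squeeze_zero_norm (fun t => ?_) l1
        rw [Real.norm_eq_abs, abs_mul]
        refine (mul_le_of_le_one_right (abs_nonneg _) (hΦ1 _ _)).trans ((hEb _ _).trans ?_)
        have e1 : ∀ i, y + v k * t - v i * t = y + (v k - v i) * t := fun i => by ring
        simp only [e1]
        have := mul_le_of_le_one_right hK (le1 (y + (v k - v k) * t))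
        gcongr
    have := main.add ih'
    rw [add_zero] at this
    refine this.congr fun t => ?_
    simp only [Finset.sum_insert hk]
    have i1 := (T1 t).integrable_dens_mul A D (hΦ t) (hΦ1 t)
    have i2 := (T2 t).integrable_dens_mul A D (hΦ t) (hΦ1 t)
    have i3 := (T3 t).integrable_dens_mul A D (hΦ t) (hΦ1 t)
    have e : ∫ x, E t x * Φ t x = (∫ x, dens A D (p k t x + ∑ i ∈ s, p i t x)
      (p₁ k t x + ∑ i ∈ s, p₁ i t x) (p₂ k t x + ∑ i ∈ s, p₂ i t x) * Φ t x) -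
      (∫ x, dens A D (p k t x) (p₁ k t x) (p₂ k t x) * Φ t x) -
      ∫ x, dens A D (∑ i ∈ s, p i t x) (∑ i ∈ s, p₁ i t x) (∑ i ∈ s, p₂ i t x) * Φ t x := by
      refine Eq.trans (integral_congr_ae (Eventually.of_forall fun x => ?_))
        ((integral_sub (i3.sub i2) i1).trans (congrArg₂ _ (integral_sub i3 i2) rfl))
      simp only [hE, Pi.sub_apply]
      ring
    rw [e]
    ring

/-- The functional of a wave, localized by a weight with a limit in the moving frame. -/
theorem IsWaveTriple.tendsto_integral_dens_mul {v : ℝ} {p p₁ p₂ : ℝ → ℝ → ℝ}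
    (h : IsWaveTriple v γ p p₁ p₂) (A D : ℝ) (hγ : 0 < γ)
    {Φ : ℝ → ℝ → ℝ} (hΦ : ∀ t, AEStronglyMeasurable (Φ t)) (hΦ1 : ∀ t x, |Φ t x| ≤ 1) {χ : ℝ}
    (hlim : ∀ y, Tendsto (fun t => Φ t (y + v * t)) atTop (𝓝 χ)) :
    Tendsto (fun t => (∫ x, dens A D (p t x) (p₁ t x) (p₂ t x) * Φ t x) -
      χ * ∫ x, dens A D (p t x) (p₁ t x) (p₂ t x)) atTop (𝓝 0) := by
  obtain ⟨K, hK, hb⟩ := h.exists_abs_dens_le hγ A D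
  have main : Tendsto (fun t => ∫ x, dens A D (p t x) (p₁ t x) (p₂ t x) * (Φ t x - χ)) atTop
      (𝓝 0) := by
    refine tendsto_integral_of_localized (v := v) (K := K * (1 + |χ|)) hγ (fun t => ?_)
      (fun t x => ?_) fun y => ?_
    · exact ((h.triple hγ t).aestronglyMeasurable_dens A D).mul
        ((hΦ t).sub aestronglyMeasurable_const)
    · rw [abs_mul, mul_right_comm]
      refine mul_le_mul (hb t x) ?_ (abs_nonneg _) (by positivity)
      exact (abs_sub _ _).trans (by linarith [hΦ1 t x])
    · have l1 : Tendsto (fun t => K * |Φ t (y + v * t) - χ|) atTop (𝓝 0) := by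
        have := (((hlim y).sub_const χ).abs).const_mul K
        simpa using this
      refine squeeze_zero_norm (fun t => ?_) l1
      rw [Real.norm_eq_abs, abs_mul]
      refine mul_le_mul_of_nonneg_right ((hb _ _).trans (mul_le_of_le_one_right hK ?_))
        (abs_nonneg _)
      -- In the moving frame only the bound 1 on the exponential is used; the decay in `x` has
      -- already served for domination.
      rw [Real.exp_le_one_iff]
      have := abs_nonneg (y + v * t - v * t)
      nlinarith
  refine main.congr fun t => ?_
  have i1 := (h.triple hγ t).integrable_dens_mul A D (hΦ t) (hΦ1 t)
  have i2 := ((h.triple hγ t).integrable_dens A D).const_mul χ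
  rw [← integral_const_mul, ← integral_sub i1 i2]
  refine integral_congr_ae (Eventually.of_forall fun x => ?_)
  simp only
  ring

theorem tendsto_integral_dens_sum (A D : ℝ) (hγ : 0 < γ)
    (h : ∀ i ∈ s, IsWaveTriple (v i) γ (p i) (p₁ i) (p₂ i)) (hv : Set.InjOn v s)
    {Φ : ℝ → ℝ → ℝ} (hΦ : ∀ t, AEStronglyMeasurable (Φ t)) (hΦ1 : ∀ t x, |Φ t x| ≤ 1) {χ : ι → ℝ}
    (hlim : ∀ i ∈ s, ∀ y, Tendsto (fun t => Φ t (y + v i * t)) atTop (𝓝 (χ i))) :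
    Tendsto (fun t => (∫ x, dens A D (∑ i ∈ s, p i t x) (∑ i ∈ s, p₁ i t x) (∑ i ∈ s, p₂ i t x) *
      Φ t x) - ∑ i ∈ s, χ i * ∫ x, dens A D (p i t x) (p₁ i t x) (p₂ i t x)) atTop (𝓝 0) := by
  have h1 := tendsto_integral_dens_sum_sub A D hγ h hv hΦ hΦ1
  have h2 := tendsto_finsetSum s fun i hi =>
    (h i hi).tendsto_integral_dens_mul A D hγ hΦ hΦ1 (hlim i hi)
  have := h1.add h2
  simp only [Finset.sum_const_zero, add_zero, Finset.sum_sub_distrib] at this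
  exact this.congr fun t => by ring

end Sum

/-- A finite sum of continuous periodic functions is recurrent. -/
theorem exists_recurrence {ι : Type*} (s : Finset ι) {f : ι → ℝ → ℝ}
    (hf : ∀ i ∈ s, Continuous (f i)) (hp : ∀ i ∈ s, ∃ τ : ℝ, 0 < τ ∧ Function.Periodic (f i) τ)
    (t N : ℝ) {η : ℝ} (hη : 0 < η) :
    ∃ r : ℝ, N ≤ r ∧ |∑ i ∈ s, f i (t + r) - ∑ i ∈ s, f i t| < η := by
  choose τ hτ hper using fun i : s => hp i i.2
  have : ∀ i : s, Fact (0 < τ i) := fun i => ⟨hτ i⟩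
  -- Translation of time by 1 acts on the product of the circles of lengths `τ i`, a compact group;
  -- the powers of any element of a compact group accumulate at the identity.
  have hcl := mapClusterPt_one_atTop_pow
    (Multiplicative.ofAdd (fun i : s => ((1 : ℝ) : AddCircle (τ i))))
  set G : (∀ i : s, AddCircle (τ i)) → ℝ := fun z => ∑ i : s, (hper i).lift ((t : AddCircle (τ i)) +
    z i) with hG
  have hGc : Continuous G := by
    refine continuous_finsetSum _ fun i _ => ?_
    have : Continuous (hper i).lift := continuous_coinduced_dom.2 (hf i i.2)
    fun_prop
  have hGn : ∀ r : ℝ, G (fun i : s => ((r : ℝ) : AddCircle (τ i))) = ∑ i ∈ s, f i (t + r) :=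
    fun r => by
      rw [← Finset.sum_coe_sort s]
      refine Finset.sum_congr rfl fun i _ => ?_
      rw [← AddCircle.coe_add]
      exact (hper i).lift_coe _
  have hnh : {z : Multiplicative (∀ i : s, AddCircle (τ i)) | |G z.toAdd - G 0| < η} ∈
      𝓝 (1 : Multiplicative (∀ i : s, AddCircle (τ i))) := by
    have : Continuous fun z : Multiplicative (∀ i : s, AddCircle (τ i)) =>
      |G z.toAdd - G 0| := ((hGc.comp continuous_toAdd).sub continuous_const).abs
    exact (isOpen_lt this continuous_const).mem_nhds (by simpa using hη)
  have hfr := hcl.frequently hnh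
  obtain ⟨n, hn1, hn2⟩ := (hfr.and_eventually (eventually_ge_atTop ⌈N⌉₊)).exists
  refine ⟨n, (Nat.le_ceil N).trans (by exact_mod_cast hn2), ?_⟩
  have e0 := hGn 0
  have e1 := hGn n
  rw [← e1]
  have : G 0 = ∑ i ∈ s, f i t := by
    rw [show (0 : ∀ i : s, AddCircle (τ i)) = fun i : s => ((0 : ℝ) : AddCircle (τ i)) from rfl, e0]
    simp
  rw [← this]
  convert hn1 using 4
  funext i
  simp only [toAdd_pow, toAdd_ofAdd, Pi.smul_apply]
  rw [← AddCircle.coe_nsmul]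
  simp

/-! ### The bound on the localized functionals of a multi-breather -/

theorem integral_exp_neg_le {l t₁ t₂ : ℝ} (hl : 0 < l) :
    ∫ t in t₁..t₂, Real.exp (-l * t) ≤ Real.exp (-l * t₁) / l := by
  have h : ∀ t ∈ Set.uIcc t₁ t₂, HasDerivAt (fun t => -(Real.exp (-l * t) / l))
      (Real.exp (-l * t)) t := fun t _ => by
    have := (((hasDerivAt_id t).const_mul (-l)).exp.div_const l).fun_neg
    refine this.congr_deriv ?_
    simp only [id]
    field_simp
  rw [intervalIntegral.integral_eq_sub_of_hasDerivAt h
    ((by fun_prop : Continuous fun t => Real.exp (-l * t)).intervalIntegrable _ _)]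
  have : 0 ≤ Real.exp (-l * t₂) / l := by positivity
  linarith

/-- The localized functional of a solution that approaches a sum of waves exceeds its limit by an
exponentially small quantity at most. -/
theorem exists_integral_dens_sub_le {ι : Type*} {s : Finset ι} {v : ι → ℝ}
    {p₀ p₁ p₂ : ι → ℝ → ℝ → ℝ} {U U₁ U₂ : ℝ → ℝ → ℝ} {P q q₁ q₂ : ℝ → ℝ} {χ : ι → ℝ}
    {A D T γ κ μ c m l L : ℝ} (hγ : 0 < γ)
    (h : ∀ i ∈ s, IsWaveTriple (v i) γ (p₀ i) (p₁ i) (p₂ i)) (hv : Set.InjOn v s)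
    (hU : IsH2Flow T U U₁ U₂)
    (hlim : Tendsto (fun t => h2sq (fun x => U t x - ∑ i ∈ s, p₀ i t x)
      (fun x => U₁ t x - ∑ i ∈ s, p₁ i t x) (fun x => U₂ t x - ∑ i ∈ s, p₂ i t x)) atTop (𝓝 0))
    (hw : IsWeight κ P q q₁ q₂) (hc : 0 < c) (hcoer : ∀ x, Coercive c κ A D m μ ∨ q x = 0)
    (hχ : ∀ i ∈ s, ∀ y, Tendsto (fun t => P (y + v i * t - m * t)) atTop (𝓝 (χ i)))
    (hl : 0 < l) (hL : 0 ≤ L)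
    (hq : ∀ i ∈ s, ∀ t x, 0 ≤ t →
      Real.exp (-γ * |x - v i * t|) * q (x - m * t) ≤ L * Real.exp (-l * t)) :
    ∃ T₄ C : ℝ, T ≤ T₄ ∧ 0 < C ∧ ∀ t, T₄ ≤ t →
      (∫ x, dens A D (U t x) (U₁ t x) (U₂ t x) * P (x - m * t)) -
        ∑ i ∈ s, χ i * ∫ x, dens A D (p₀ i t x) (p₁ i t x) (p₂ i t x) ≤ C * Real.exp (-l * t) := by
  have hΦ : ∀ t, AEStronglyMeasurable (fun x => P (x - m * t)) := fun t =>
    (hw.comp_sub (m * t)).bounded.cont.aestronglyMeasurable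
  have hΦ1 : ∀ t x, |P (x - m * t)| ≤ 1 := fun t x => by
    rw [abs_of_nonneg (hw.nonneg _)]; exact hw.le_one _
  have hS := fun t => isH2Triple_sum hγ h t
  obtain ⟨K, hK, hsb⟩ := exists_sum_bound h
  obtain ⟨H₀, hH₀⟩ := exists_h2sq_sum_le hγ h
  -- Since ‖U‖² ≤ 2 ‖U - S‖² + 2 ‖S‖², this bounds the squared norm as soon as the distance to the
  -- sum of waves is at most 1. Then B² ≥ 2H gives the pointwise bounds.
  set H := 2 + 2 * |H₀| with hHdef
  have hH0 : 0 ≤ H := by positivity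
  set B := 1 + 2 * H with hBdef
  have hB : 1 ≤ B := by linarith
  have hB2 : 2 * H ≤ B ^ 2 := by rw [hBdef]; nlinarith
  have hfc := fluxConst_nonneg (A := A) (D := D) (m := m) hB
  set δ := c / (2 * fluxConst A D m B + 1) with hδdef
  have hδ0 : 0 < δ := by positivity
  have hδ : 2 * fluxConst A D m B * δ ≤ c := by
    rw [hδdef, mul_div_assoc', div_le_iff₀ (by positivity)]
    nlinarith
  -- By the Sobolev bound, a squared H² distance below δ²/2 makes the remainder and its derivative
  -- at most δ everywhere.
  obtain ⟨T₀, hT₀⟩ := eventually_atTop.1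
    (hlim.eventually_lt_const (show 0 < min 1 (δ ^ 2 / 2) by positivity))
  have hbd : ∀ t, T₀ ≤ t → T ≤ t → h2sq (U t) (U₁ t) (U₂ t) ≤ H := fun t h1 h2 => by
    have a := h2sq_add_le ((hU.triple t h2).sub (hS t)) (hS t)
    simp only [sub_add_cancel] at a
    have b := (hT₀ t h1).trans_le (min_le_left _ _)
    have d := (hH₀ t).trans (le_abs_self _)
    change h2sq (fun x => U t x) (fun x => U₁ t x) (fun x => U₂ t x) ≤ H
    linarith
  obtain ⟨C₀, hC₀, key⟩ := exists_integral_dens_le (A := A) (D := D) (m := m) (H := H) hB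
  set T₄ := max (T + 1) (max T₀ 0) with hT₄
  have t1 : ∀ t, T₄ ≤ t → T < t := fun t ht => by linarith [(le_max_left (T + 1) _).trans ht]
  have t2 : ∀ t, T₄ ≤ t → T₀ ≤ t := fun t ht =>
    ((le_max_left _ _).trans (le_max_right (T + 1) _)).trans ht
  have t3 : ∀ t, T₄ ≤ t → 0 ≤ t := fun t ht =>
    ((le_max_right _ _).trans (le_max_right (T + 1) _)).trans ht
  set M := K * Real.exp γ * (s.card * L) with hM
  have hM0 : 0 ≤ M := by positivity
  set I : ℝ → ℝ := fun t => ∫ x, dens A D (U t x) (U₁ t x) (U₂ t x) * P (x - m * t) with hI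
  set S : ℝ → ℝ := fun t =>
    ∑ i ∈ s, χ i * ∫ x, dens A D (p₀ i t x) (p₁ i t x) (p₂ i t x) with hSdef
  have mono : ∀ t t', T₄ ≤ t → t ≤ t' → I t ≤ I t' + C₀ * (M * (Real.exp (-l * t) / l)) := by
    intro t t' ht htt
    have hge : ∀ r ∈ Set.Icc t t', T₄ ≤ r := fun r hr => ht.trans hr.1
    -- Moving the point by at most 1, the range of the mollifier, costs a factor e^γ.
    have hclose : ∀ r, T₄ ≤ r → ∀ x y, |x - y| ≤ 1 →
        K * ∑ i ∈ s, Real.exp (-γ * |y - v i * r|) ≤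
          K * Real.exp γ * ∑ i ∈ s, Real.exp (-γ * |x - v i * r|) := fun r hr x y hxy => by
      rw [mul_assoc, Finset.mul_sum s _ (Real.exp γ)]
      refine mul_le_mul_of_nonneg_left (Finset.sum_le_sum fun i _ => ?_) hK
      rw [← Real.exp_add]
      refine Real.exp_le_exp.2 ?_
      have := abs_add_le (y - v i * r) (x - y)
      rw [show y - v i * r + (x - y) = x - v i * r by ring] at this
      nlinarith
    have hdiff : ∀ r, T₄ ≤ r → (∀ x, |U r x - ∑ i ∈ s, p₀ i r x| ≤ δ) ∧
        ∀ x, |U₁ r x - ∑ i ∈ s, p₁ i r x| ≤ δ := fun r hr => by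
      have a := (hU.triple r (t1 r hr).le).sub (hS r)
      have b := (hT₀ r (t2 r hr)).trans_le (min_le_right _ _)
      exact ⟨a.abs_le hδ0.le (by linarith), a.abs_deriv_le hδ0.le (by linarith)⟩
    -- The decomposition is |U| ≤ |U - S| + |S|: the first part is at most `δ`, and the second is
    -- the function `g`, a sum of exponentials that is small where the weight varies.
    have := key c κ μ δ T t t' U U₁ U₂
      (fun r x => K * Real.exp γ * ∑ i ∈ s, Real.exp (-γ * |x - v i * r|)) P q q₁ q₂
      (fun r => M * Real.exp (-l * r)) hU hw (t1 t ht) htt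
      (fun r hr => (hU.triple r (t1 r (hge r hr)).le).abs_le (by linarith)
        (by linarith [hbd r (t2 r (hge r hr)) (t1 r (hge r hr)).le]))
      (fun r hr => (hU.triple r (t1 r (hge r hr)).le).abs_deriv_le (by linarith)
        (by linarith [hbd r (t2 r (hge r hr)) (t1 r (hge r hr)).le]))
      (fun r hr => hbd r (t2 r (hge r hr)) (t1 r (hge r hr)).le)
      hcoer hδ (by fun_prop) (fun r => by positivity)
      (fun r hr x y hxy => by
        have a := (hdiff r (hge r hr)).1 y
        have b := (hsb r y).1.trans (hclose r (hge r hr) x y hxy)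
        have d := abs_add_le (U r y - ∑ i ∈ s, p₀ i r y) (∑ i ∈ s, p₀ i r y)
        rw [sub_add_cancel] at d
        linarith)
      (fun r hr x y hxy => by
        have a := (hdiff r (hge r hr)).2 y
        have b := (hsb r y).2.1.trans (hclose r (hge r hr) x y hxy)
        have d := abs_add_le (U₁ r y - ∑ i ∈ s, p₁ i r y) (∑ i ∈ s, p₁ i r y)
        rw [sub_add_cancel] at d
        linarith)
      (fun r hr x => by
        rw [hM, mul_assoc (K * Real.exp γ), mul_assoc (K * Real.exp γ)]
        refine mul_le_mul_of_nonneg_left ?_ (by positivity)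
        rw [Finset.sum_mul]
        refine (Finset.sum_le_card_nsmul s _ _ fun i hi =>
          hq i hi r x (t3 r (hge r hr))).trans (le_of_eq ?_)
        rw [nsmul_eq_mul]; ring)
    refine this.trans (add_le_add le_rfl (mul_le_mul_of_nonneg_left ?_ hC₀.le))
    rw [intervalIntegral.integral_const_mul]
    exact mul_le_mul_of_nonneg_left (integral_exp_neg_le hl) hM0
  have conv : Tendsto (fun t => I t - S t) atTop (𝓝 0) := by
    have a := tendsto_integral_dens_sum A D hγ h hv hΦ hΦ1 hχ
    have hTl : ∀ᶠ t in atTop, T₄ ≤ t := eventually_ge_atTop T₄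
    have b := IsH2Triple.tendsto_integral_dens_sub (l := atTop) (B := B) (H := H) A D
      (f := U) (f₁ := U₁) (f₂ := U₂) (g := fun t x => ∑ i ∈ s, p₀ i t x)
      (g₁ := fun t x => ∑ i ∈ s, p₁ i t x) (g₂ := fun t x => ∑ i ∈ s, p₂ i t x)
      (Φ := fun t x => P (x - m * t))
      (hTl.mono fun t ht => hU.triple t (t1 t ht).le) (Eventually.of_forall hS)
      (hTl.mono fun t ht => (hU.triple t (t1 t ht).le).abs_le (by linarith)
        (by linarith [hbd t (t2 t ht) (t1 t ht).le]))
      (Eventually.of_forall fun t => (hS t).abs_le (by linarith)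
        (by linarith [hH₀ t, le_abs_self H₀]))
      (Eventually.of_forall fun t => (hS t).abs_deriv_le (by linarith)
        (by linarith [hH₀ t, le_abs_self H₀]))
      (hTl.mono fun t ht => hbd t (t2 t ht) (t1 t ht).le)
      (Eventually.of_forall fun t => by linarith [hH₀ t, le_abs_self H₀, abs_nonneg H₀])
      (Eventually.of_forall hΦ) (Eventually.of_forall hΦ1) hlim
    have := b.add a
    rw [add_zero] at this
    exact this.congr fun t => by simp only [hI, hSdef]; ring
  -- The summand 1 keeps the constant positive when `M` vanishes, as it does for the constant
  -- weight.
  refine ⟨T₄, C₀ * (M / l) + 1, by linarith [le_max_left (T + 1) (max T₀ 0)], by positivity,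
    fun t ht => ?_⟩
  have main : I t ≤ S t + C₀ * (M * (Real.exp (-l * t) / l)) := by
    -- Almost monotonicity is applied between t and a late time t + r at which the functional of the
    -- solution is close to that of the waves, while the latter has returned close to its value at
    -- t.
    refine le_of_forall_pos_le_add fun η hη => ?_
    obtain ⟨N, hN⟩ := eventually_atTop.1 (conv.eventually_lt_const (half_pos hη))
    obtain ⟨r, hr, hrS⟩ := exists_recurrence s
      (f := fun i t => χ i * ∫ x, dens A D (p₀ i t x) (p₁ i t x) (p₂ i t x))
      (fun i hi => ((h i hi).continuous_integral_dens hγ A D).const_mul (χ i))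
      (fun i hi => by
        obtain ⟨τ, hτ, hp⟩ := (h i hi).exists_periodic_integral_dens A D
        exact ⟨τ, hτ, fun t => congrArg _ (hp t)⟩) t (max 0 (N - t)) (half_pos hη)
    have r1 : t ≤ t + r := by linarith [(le_max_left 0 (N - t)).trans hr]
    have r2 : N ≤ t + r := by linarith [(le_max_right 0 (N - t)).trans hr]
    have a := mono t (t + r) ht r1
    have b := hN (t + r) r2
    have d : S (t + r) - S t < η / 2 := (abs_lt.1 hrS).2
    linarith
  have e : (C₀ * (M / l) + 1) * Real.exp (-l * t) =
      C₀ * (M * (Real.exp (-l * t) / l)) + Real.exp (-l * t) := by ring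
  have := Real.exp_pos (-l * t)
  rw [e]
  change I t - S t ≤ _
  linarith

/-! ### The cut-off functions -/

theorem hasDerivAt_cutoffShape (σ x : ℝ) :
    HasDerivAt (cutoffShape σ) (-(√σ / 2 / Real.pi * (Real.cosh (√σ / 2 * x))⁻¹)) x := by
  have l : HasDerivAt (fun x => -√σ * x / 2) (-√σ / 2) x := by
    simpa using ((hasDerivAt_id x).const_mul (-√σ)).div_const 2
  refine (l.exp.arctan.const_mul (2 / Real.pi)).congr_deriv ?_
  have e : Real.exp (-√σ * x / 2) = (Real.exp (√σ / 2 * x))⁻¹ := by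
    rw [← Real.exp_neg]; congr 1; ring
  rw [Real.cosh_eq, Real.exp_neg, e]
  have h := Real.exp_pos (√σ / 2 * x)
  have hpi := Real.pi_pos
  generalize Real.exp (√σ / 2 * x) = z at *
  field_simp

/-- Each derivative of the hyperbolic secant of s x costs a factor s = √σ/2, whence κ = s² = σ/4.
The condition σ ≤ 4 is s ≤ 1, which gives |p₁| ≤ s p ≤ p. -/
theorem isWeight_cutoffShape {σ : ℝ} (h0 : 0 < σ) (h4 : σ ≤ 4) :
    IsWeight (σ / 4) (cutoffShape σ) (fun x => √σ / 2 / Real.pi * (Real.cosh (√σ / 2 * x))⁻¹)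
      (fun x => -((√σ / 2) ^ 2 / Real.pi *
        (Real.sinh (√σ / 2 * x) * (Real.cosh (√σ / 2 * x))⁻¹ ^ 2)))
      (fun x => (√σ / 2) ^ 3 / Real.pi *
        ((Real.sinh (√σ / 2 * x) ^ 2 - 1) * (Real.cosh (√σ / 2 * x))⁻¹ ^ 3)) := by
  have hs0 : 0 < √σ / 2 := by positivity
  have hs1 : √σ / 2 ≤ 1 := by
    have : √σ ≤ 2 := (Real.sqrt_le_left (by norm_num)).2 (by linarith)
    linarith
  have hs2 : (√σ / 2) ^ 2 = σ / 4 := by rw [div_pow, Real.sq_sqrt h0.le]; norm_num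
  have hpi := Real.pi_pos
  have hpi1 : 1 ≤ Real.pi := by linarith [Real.pi_gt_three]
  rw [← hs2]
  generalize hs : √σ / 2 = s at *
  have hc : ∀ x, 0 < Real.cosh (s * x) := fun x => Real.cosh_pos _
  have hc1 : ∀ x, (Real.cosh (s * x))⁻¹ ≤ 1 := fun x => inv_le_one_of_one_le₀ (Real.one_le_cosh _)
  have lin : ∀ x, HasDerivAt (fun x => s * x) s x := fun x => by
    simpa using (hasDerivAt_id x).const_mul s
  have dS : ∀ x, HasDerivAt (fun x => (Real.cosh (s * x))⁻¹)
      (-(Real.sinh (s * x) * s) / Real.cosh (s * x) ^ 2) x := fun x =>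
    (lin x).cosh.fun_inv (hc x).ne'
  refine ⟨fun x => hs ▸ hasDerivAt_cutoffShape σ x, fun x => ?_, fun x => ?_, ?_, fun x => ?_,
    fun x => ?_, fun x => ?_, fun x => ?_, fun x => ?_, fun x => ?_⟩
  · refine ((dS x).const_mul (s / Real.pi)).congr_deriv ?_
    have := (hc x).ne'
    field_simp
  · refine (((lin x).sinh.fun_mul ((dS x).fun_pow 2)).const_mul (s ^ 2 / Real.pi)).fun_neg.congr_deriv ?_
    have h1 := (hc x).ne'
    have h2 := Real.cosh_sq (s * x)
    rw [show 2 - 1 = 1 from rfl, pow_one, Nat.cast_ofNat]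
    field_simp
    linear_combination -h2
  · have c1 : Continuous fun x => Real.sinh (s * x) := Real.continuous_sinh.comp (by fun_prop)
    have c2 : Continuous fun x => (Real.cosh (s * x))⁻¹ :=
      (Real.continuous_cosh.comp (by fun_prop)).inv₀ fun x => (hc x).ne'
    fun_prop
  · have := Real.arctan_pos.2 (Real.exp_pos (-√σ * x / 2))
    unfold cutoffShape; positivity
  · have := Real.arctan_lt_pi_div_two (Real.exp (-√σ * x / 2))
    unfold cutoffShape
    rw [div_mul_eq_mul_div, div_le_one hpi]
    linarith
  · have := hc x
    positivity
  · have h1 : s / Real.pi ≤ 1 := (div_le_one hpi).2 (hs1.trans hpi1)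
    exact mul_le_one₀ h1 (inv_nonneg.2 (hc x).le) (hc1 x)
  · have hsh : |Real.sinh (s * x)| ≤ Real.cosh (s * x) := by
      refine abs_le_of_sq_le_sq ?_ (hc x).le
      linarith [Real.cosh_sq (s * x)]
    have hcx := hc x
    have h1 : |Real.sinh (s * x)| * (Real.cosh (s * x))⁻¹ ^ 2 ≤ (Real.cosh (s * x))⁻¹ := by
      calc _ ≤ Real.cosh (s * x) * (Real.cosh (s * x))⁻¹ ^ 2 := by gcongr
        _ = _ := by field_simp
    rw [abs_neg, abs_mul, abs_mul, abs_of_nonneg (by positivity : 0 ≤ s ^ 2 / Real.pi),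
      abs_of_nonneg (by positivity : 0 ≤ (Real.cosh (s * x))⁻¹ ^ 2)]
    have h2 : s ^ 2 ≤ s := by nlinarith
    exact mul_le_mul (by gcongr) h1 (by positivity) (by positivity)
  · have hcx := hc x
    have hsh : |Real.sinh (s * x) ^ 2 - 1| ≤ Real.cosh (s * x) ^ 2 := by
      rw [abs_le]; constructor <;> nlinarith [Real.cosh_sq (s * x), sq_nonneg (Real.sinh (s * x))]
    have h1 : |Real.sinh (s * x) ^ 2 - 1| * (Real.cosh (s * x))⁻¹ ^ 3 ≤ (Real.cosh (s * x))⁻¹ := by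
      calc _ ≤ Real.cosh (s * x) ^ 2 * (Real.cosh (s * x))⁻¹ ^ 3 := by gcongr
        _ = _ := by field_simp
    rw [abs_mul, abs_mul, abs_of_nonneg (by positivity : 0 ≤ s ^ 3 / Real.pi),
      abs_of_nonneg (by positivity : 0 ≤ (Real.cosh (s * x))⁻¹ ^ 3)]
    calc _ ≤ s ^ 3 / Real.pi * (Real.cosh (s * x))⁻¹ := by gcongr
      _ = _ := by ring

theorem isWeight_one : IsWeight 0 (fun _ => 1) (fun _ => 0) (fun _ => 0) (fun _ => 0) where
  hasDerivAt x := by simpa using hasDerivAt_const x (1 : ℝ)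
  hasDerivAt₁ x := hasDerivAt_const x 0
  hasDerivAt₂ x := hasDerivAt_const x 0
  cont := continuous_const
  nonneg _ := zero_le_one
  le_one _ := le_rfl
  nonneg₁ _ := le_rfl
  le_one₁ _ := zero_le_one
  abs_le₁ _ := by simp
  abs_le₂ _ := by simp

theorem tendsto_cutoffShape_of_lt {σ v m : ℝ} (hσ : 0 < σ) (h : v < m) (y : ℝ) :
    Tendsto (fun t => cutoffShape σ (y + v * t - m * t)) atTop (𝓝 1) := by
  have h1 : Tendsto (fun t => -√σ * (y + v * t - m * t) / 2) atTop atTop := by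
    have e : ∀ t, -√σ * (y + v * t - m * t) / 2 = -√σ * y / 2 + √σ * (m - v) / 2 * t :=
      fun t => by ring
    simp only [e]
    have : 0 < √σ * (m - v) / 2 := by
      have := Real.sqrt_pos.2 hσ
      have := sub_pos.2 h
      positivity
    exact tendsto_atTop_add_const_left _ _ (tendsto_id.const_mul_atTop this)
  have h2 : Tendsto (fun t => Real.arctan (Real.exp (-√σ * (y + v * t - m * t) / 2))) atTop
      (𝓝 (Real.pi / 2)) :=
    (tendsto_nhdsWithin_iff.1 Real.tendsto_arctan_atTop).1.comp (Real.tendsto_exp_atTop.comp h1)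
  have h3 := h2.const_mul (2 / Real.pi)
  rwa [show 2 / Real.pi * (Real.pi / 2) = 1 by field_simp] at h3

theorem tendsto_cutoffShape_of_gt {σ v m : ℝ} (hσ : 0 < σ) (h : m < v) (y : ℝ) :
    Tendsto (fun t => cutoffShape σ (y + v * t - m * t)) atTop (𝓝 0) := by
  have h1 : Tendsto (fun t => -√σ * (y + v * t - m * t) / 2) atTop atBot := by
    have e : ∀ t, -√σ * (y + v * t - m * t) / 2 = -√σ * y / 2 + -(√σ * (v - m) / 2) * t :=
      fun t => by ring
    simp only [e]
    have : 0 < √σ * (v - m) / 2 := by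
      have := Real.sqrt_pos.2 hσ
      have := sub_pos.2 h
      positivity
    exact tendsto_atBot_add_const_left _ _ (tendsto_id.const_mul_atTop_of_neg (neg_lt_zero.2 this))
  have h2 : Tendsto (fun t => Real.arctan (Real.exp (-√σ * (y + v * t - m * t) / 2))) atTop
      (𝓝 (Real.arctan 0)) :=
    (Real.continuous_arctan.tendsto 0).comp (Real.tendsto_exp_atBot.comp h1)
  have h3 := h2.const_mul (2 / Real.pi)
  rwa [Real.arctan_zero, mul_zero] at h3

/-- Waves do not see the transition of a cut-off that moves with a different velocity. -/
theorem exp_mul_cutoffDeriv_le {σ γ γ' l v m t x : ℝ} (hσ : 0 < σ) (h4 : σ ≤ 4) (hγ' : 0 < γ')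
    (hγ : γ' ≤ γ) (hγσ : γ' ≤ √σ / 2) (hl : l ≤ γ' * |v - m|) (ht : 0 ≤ t) :
    Real.exp (-γ * |x - v * t|) * (√σ / 2 / Real.pi * (Real.cosh (√σ / 2 * (x - m * t)))⁻¹) ≤
      2 * Real.exp (-l * t) := by
  have hs1 : √σ / 2 ≤ 1 := by
    have : √σ ≤ 2 := (Real.sqrt_le_left (by norm_num)).2 (by linarith)
    linarith
  have hs0 : 0 ≤ √σ / 2 := by positivity
  have hpi1 : 1 ≤ Real.pi := by linarith [Real.pi_gt_three]
  have h1 : √σ / 2 / Real.pi ≤ 1 := (div_le_one Real.pi_pos).2 (hs1.trans hpi1)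
  have h2 : √σ / 2 / Real.pi * (Real.cosh (√σ / 2 * (x - m * t)))⁻¹ ≤
      2 * Real.exp (-γ' * |x - m * t|) := by
    refine (mul_le_of_le_one_left (inv_nonneg.2 (Real.cosh_pos _).le) h1).trans
      ((inv_cosh_le _).trans ?_)
    rw [abs_mul, abs_of_nonneg hs0]
    gcongr
    have := mul_le_mul_of_nonneg_right hγσ (abs_nonneg (x - m * t))
    linarith
  calc _ ≤ Real.exp (-γ' * |x - v * t|) * (2 * Real.exp (-γ' * |x - m * t|)) := by
        refine mul_le_mul ?_ h2 (mul_nonneg (by positivity) (inv_nonneg.2 (Real.cosh_pos _).le))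
          (Real.exp_pos _).le
        gcongr
    _ = 2 * Real.exp (-γ' * |x - v * t| + -γ' * |x - m * t|) := by rw [Real.exp_add]; ring
    _ ≤ _ := by
        gcongr
        -- The wave and the transition are |v - m| t apart, so every x is far from at least one of
        -- them: |v - m| t ≤ |x - v t| + |x - m t|.
        have h3 := abs_sub (x - m * t) (x - v * t)
        rw [show x - m * t - (x - v * t) = (v - m) * t by ring, abs_mul, abs_of_nonneg ht] at h3
        have h4 := mul_le_mul_of_nonneg_right hl ht
        have h5 := mul_le_mul_of_nonneg_left h3 hγ'.le
        linarith

/-! ### The localized functionals as integrals of the density -/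

theorem localFunctional_eq {u U U₁ U₂ Φ : ℝ → ℝ} (h : IsH2Triple U U₁ U₂) (hu : u =ᵐ[volume] U)
    (hΦ : AEStronglyMeasurable Φ) (hΦ1 : ∀ x, |Φ x| ≤ 1) (A D : ℝ) :
    localSecondEnergy Φ u + A * localEnergy Φ u + D * localMass Φ u =
      ∫ x, dens A D (U x) (U₁ x) (U₂ x) * Φ x := by
  have w1 : weakDeriv u =ᵐ[volume] U₁ := by rw [weakDeriv_congr hu]; exact h.weakDeriv_ae
  have w2 : weakDeriv (weakDeriv u) =ᵐ[volume] U₂ := by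
    rw [weakDeriv_congr hu]; exact h.weakDeriv₂_ae
  have i00 := h.integrable_dens_mul 0 0 hΦ hΦ1
  -- Energy and mass are obtained as differences of densities with parameters 0 and 1, so that one
  -- integrability lemma serves all three functionals.
  have i10 := (h.integrable_dens_mul 1 0 hΦ hΦ1).sub i00
  have i01 := (h.integrable_dens_mul 0 1 hΦ hΦ1).sub i00
  have eF : localSecondEnergy Φ u = ∫ x, dens 0 0 (U x) (U₁ x) (U₂ x) * Φ x := by
    refine integral_congr_ae ?_
    filter_upwards [hu, w1, w2] with x a b c
    rw [a, b, c]; unfold dens; ring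
  have eE : localEnergy Φ u = ∫ x, ((fun x => dens 1 0 (U x) (U₁ x) (U₂ x) * Φ x) -
      fun x => dens 0 0 (U x) (U₁ x) (U₂ x) * Φ x) x := by
    refine integral_congr_ae ?_
    filter_upwards [hu, w1] with x a b
    simp only [Pi.sub_apply]
    rw [a, b]; unfold dens; ring
  have eM : localMass Φ u = ∫ x, ((fun x => dens 0 1 (U x) (U₁ x) (U₂ x) * Φ x) -
      fun x => dens 0 0 (U x) (U₁ x) (U₂ x) * Φ x) x := by
    unfold localMass
    rw [← integral_const_mul]
    refine integral_congr_ae ?_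
    filter_upwards [hu] with x a
    simp only [Pi.sub_apply]
    rw [a]; unfold dens; ring
  rw [eF, eE, eM, ← integral_const_mul, ← integral_const_mul,
    ← integral_add i00 (i10.const_mul A)]
  refine (integral_add (i00.add (i10.const_mul A)) (i01.const_mul D)).symm.trans
    (integral_congr_ae (Eventually.of_forall fun x => ?_))
  simp only [Pi.sub_apply, Pi.add_apply]
  unfold dens
  ring

/-! ### Parameters -/

/-- Strict positivity of the coefficients at κ = 0 and D = D₀ survives small κ, and increasing D
only helps. The coefficient of w₀² needs m > 0. -/
theorem exists_coercive {A D₀ m μ : ℝ} (hμ : 0 ≤ μ) (hD : 0 < D₀) (hm : 0 < m)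
    (h2 : 0 < m / 2 + 3 / 2 * A + 3 * μ) (h1 : 0 < m * A / 2 + 3 / 2 * D₀ - 3 / 2 * μ ^ 2) :
    ∃ κ₀ c : ℝ, 0 < κ₀ ∧ 0 < c ∧ ∀ κ D : ℝ, 0 ≤ κ → κ ≤ κ₀ → D₀ ≤ D → Coercive c κ A D m μ := by
  set X := m / 2 + 3 / 2 * A + 3 * μ with hX
  set Y := m * A / 2 + 3 / 2 * D₀ - 3 / 2 * μ ^ 2 with hY
  set N := |A| / 2 + 3 / 2 * μ + 1 with hN
  have hN0 : 0 < N := by positivity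
  refine ⟨min (m / 2) (min X (Y / 2 / N)), min (X / 2) (min (Y / 2) (D₀ * m / 4)),
    by positivity, by positivity, fun κ D hκ hκ0 hDD => ?_⟩
  have k1 : κ ≤ m / 2 := hκ0.trans (min_le_left _ _)
  have k2 : κ ≤ X := hκ0.trans ((min_le_right _ _).trans (min_le_left _ _))
  have k3 : κ ≤ Y / 2 / N := hκ0.trans ((min_le_right _ _).trans (min_le_right _ _))
  have k3' : κ * N ≤ Y / 2 := (le_div_iff₀ hN0).1 k3
  refine ⟨hμ, by linarith, ?_, ?_, ?_⟩
  · exact (min_le_left _ _).trans (by linarith)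
  · refine ((min_le_right _ _).trans (min_le_left _ _)).trans ?_
    rw [hN] at k3'
    linarith
  · refine ((min_le_right _ _).trans (min_le_right _ _)).trans ?_
    nlinarith [mul_nonneg (sub_nonneg.2 hDD) (by linarith : 0 ≤ m - κ),
      mul_nonneg hD.le (by linarith : 0 ≤ m / 2 - κ)]

theorem exists_pos_forall_le {ι : Type*} (s : Finset ι) {f : ι → ℝ} (h : ∀ i ∈ s, 0 < f i) :
    ∃ ε : ℝ, 0 < ε ∧ ∀ i ∈ s, ε ≤ f i := by
  have : ∀ᶠ ε in 𝓝[>] (0 : ℝ), ∀ i ∈ s, ε ≤ f i := (Finset.eventually_all s).2 fun i hi =>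
    nhdsWithin_le_nhds (eventually_le_nhds (h i hi))
  obtain ⟨ε, h1, h2⟩ := (this.and self_mem_nhdsWithin).exists
  exact ⟨ε, h2, h1⟩

theorem Wave.sq_a_lt_sq_b {w : Wave} (h : 0 < w.velocity) : w.a ^ 2 < w.b ^ 2 := by
  cases w with
  | soliton c κ x₀ hc hκ =>
    simp only [Wave.a, Wave.b, Real.sq_sqrt hc.le]
    simpa using hc
  | breather α β x₁ x₂ hα hβ =>
    simp only [Wave.velocity] at h
    simp only [Wave.a, Wave.b]
    nlinarith [sq_nonneg α]

theorem velocity_le {J : ℕ} {P : ℕ → Wave}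
    (hmono : ∀ i j, 1 ≤ i → i < j → j ≤ J → (P i).velocity < (P j).velocity) {i j : ℕ}
    (hi : 1 ≤ i) (hij : i ≤ j) (hj : j ≤ J) : (P i).velocity ≤ (P j).velocity := by
  rcases hij.eq_or_lt with rfl | h
  · exact le_rfl
  · exact (hmono i j hi h hj).le

theorem velocity_pos {J : ℕ} {P : ℕ → Wave}
    (hmono : ∀ i j, 1 ≤ i → i < j → j ≤ J → (P i).velocity < (P j).velocity)
    (hpos : 2 ≤ J → 0 < (P 2).velocity) {j : ℕ} (h2 : 2 ≤ j) (hj : j ≤ J) :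
    0 < (P j).velocity :=
  (hpos (h2.trans hj)).trans_le (velocity_le hmono (by norm_num) h2 hj)

theorem cutoffVelocity_bounds {J : ℕ} {P : ℕ → Wave} {m₁ : ℝ}
    (hmono : ∀ i j, 1 ≤ i → i < j → j ≤ J → (P i).velocity < (P j).velocity)
    (hpos : 2 ≤ J → 0 < (P 2).velocity)
    (hm₁ : 2 ≤ J → max 0 (P 1).velocity < m₁ ∧ m₁ < (P 2).velocity) {j : ℕ} (h1 : 1 ≤ j)
    (hj : j < J) :
    (P j).velocity < cutoffVelocity P m₁ j ∧ cutoffVelocity P m₁ j < (P (j + 1)).velocity ∧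
      0 < cutoffVelocity P m₁ j := by
  unfold cutoffVelocity
  split_ifs with h
  · subst h
    obtain ⟨a, b⟩ := hm₁ hj
    exact ⟨(le_max_right _ _).trans_lt a, b, (le_max_left _ _).trans_lt a⟩
  · have a := hmono j (j + 1) h1 (Nat.lt_succ_self j) hj
    have b := velocity_pos hmono hpos (by omega : 2 ≤ j) hj.le
    refine ⟨?_, ?_, ?_⟩ <;> linarith

/-- This is where the conditions on `ν₁` and `m₁` enter. For j ≥ 2 positive velocity gives b_j >
a_j, and every coefficient is positive with μ = 0. For j = 1 the square has to help. -/
theorem exists_coercive_cutoff {J : ℕ} {P : ℕ → Wave} {ν₁ m₁ : ℝ}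
    (hmono : ∀ i j, 1 ≤ i → i < j → j ≤ J → (P i).velocity < (P j).velocity)
    (hpos : 2 ≤ J → 0 < (P 2).velocity) (hν₁ : 0 < ν₁ ∧ ν₁ < 1)
    (hν₁' : 0 < ((P 1).b ^ 2 - (P 1).a ^ 2) + ν₁ * ((P 1).a ^ 2 + (P 1).b ^ 2))
    (hm₁ : 2 ≤ J → max 0 (P 1).velocity < m₁ ∧ m₁ < (P 2).velocity)
    (hm₁' : 2 ≤ J → 1 / 2 * (ν₁ - 1) * ((P 1).a ^ 2 + (P 1).b ^ 2) ^ 2 <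
      m₁ * ((P 1).b ^ 2 - (P 1).a ^ 2)) {j : ℕ} (h1 : 1 ≤ j) (hj : j < J) :
    ∃ κ₀ c μ : ℝ, 0 < κ₀ ∧ 0 < c ∧ ∀ κ ν : ℝ, 0 ≤ κ → κ ≤ κ₀ → ν₁ ^ 2 + (1 - ν₁) / 3 ≤ ν →
      Coercive c κ (2 * ((P j).b ^ 2 - (P j).a ^ 2)) (ν * ((P j).a ^ 2 + (P j).b ^ 2) ^ 2)
        (cutoffVelocity P m₁ j) μ := by
  obtain ⟨-, -, hm⟩ := cutoffVelocity_bounds hmono hpos hm₁ h1 hj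
  have hb := (P j).b_pos
  have hs : 0 < (P j).a ^ 2 + (P j).b ^ 2 := by positivity
  obtain ⟨n0, n1⟩ := hν₁
  have hν0 : 0 < ν₁ ^ 2 + (1 - ν₁) / 3 := by
    have : 0 < 1 - ν₁ := sub_pos.2 n1
    positivity
  have hD₀ : 0 < (ν₁ ^ 2 + (1 - ν₁) / 3) * ((P j).a ^ 2 + (P j).b ^ 2) ^ 2 := by positivity
  have hex : ∃ μ : ℝ, 0 ≤ μ ∧ 0 < cutoffVelocity P m₁ j / 2 + 3 / 2 *
      (2 * ((P j).b ^ 2 - (P j).a ^ 2)) + 3 * μ ∧ 0 < cutoffVelocity P m₁ j *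
      (2 * ((P j).b ^ 2 - (P j).a ^ 2)) / 2 + 3 / 2 * ((ν₁ ^ 2 + (1 - ν₁) / 3) *
      ((P j).a ^ 2 + (P j).b ^ 2) ^ 2) - 3 / 2 * μ ^ 2 := by
    rcases h1.eq_or_lt with rfl | h2
    · have e : cutoffVelocity P m₁ 1 = m₁ := by simp [cutoffVelocity]
      rw [e] at hm ⊢
      have := hm₁' hj
      -- The w₂² coefficient becomes m₁/2 + 3[(b² - a²) + ν₁(a² + b²)]. In the w₁² coefficient the
      -- terms in ν₁² cancel and leave m₁(b² - a²) + (1 - ν₁)(a² + b²)²/2, positive by the choice of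
      -- m₁.
      refine ⟨ν₁ * ((P 1).a ^ 2 + (P 1).b ^ 2), by positivity, by linarith, by linarith⟩
    · have hab := Wave.sq_a_lt_sq_b (velocity_pos hmono hpos h2 hj.le)
      have hab' : 0 < (P j).b ^ 2 - (P j).a ^ 2 := sub_pos.2 hab
      refine ⟨0, le_rfl, by positivity, ?_⟩
      have : 0 < cutoffVelocity P m₁ j * (2 * ((P j).b ^ 2 - (P j).a ^ 2)) / 2 := by positivity
      linarith
  obtain ⟨μ, hμ, c2, c1⟩ := hex
  obtain ⟨κ₀, c, hκ₀, hc, hco⟩ := exists_coercive hμ hD₀ hm c2 c1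
  exact ⟨κ₀, c, μ, hκ₀, hc, fun κ ν h h' hν => hco κ _ h h' (by gcongr)⟩

theorem sum_ite_Icc {J j : ℕ} (hj : j ≤ J) (f : ℕ → ℝ) :
    ∑ i ∈ Finset.Icc 1 J, (if i ≤ j then (1 : ℝ) else 0) * f i = ∑ i ∈ Finset.Icc 1 j, f i := by
  simp only [ite_mul, one_mul, zero_mul]
  rw [← Finset.sum_filter]
  refine Finset.sum_congr (Finset.ext fun i => ?_) fun _ _ => rfl
  simp only [Finset.mem_filter, Finset.mem_Icc]
  omega

/-- The upper bound for a multi-breather and a general moving weight. -/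
theorem IsMultiBreather.exists_functional_sub_le {J : ℕ} {P : ℕ → Wave} {T : ℝ} {u : ℝ → ℝ → ℝ}
    (hu : IsMultiBreather J P T u)
    (hmono : ∀ i j, 1 ≤ i → i < j → j ≤ J → (P i).velocity < (P j).velocity)
    {W q q₁ q₂ : ℝ → ℝ} {A D γ κ μ c m l L : ℝ} (hγ : 0 < γ) {j : ℕ} (hj : j ≤ J)
    (hγb : ∀ i ∈ Finset.Icc 1 J, γ ≤ (P i).b)
    (hw : IsWeight κ W q q₁ q₂) (hc : 0 < c) (hcoer : ∀ x, Coercive c κ A D m μ ∨ q x = 0)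
    (hχ : ∀ i ∈ Finset.Icc 1 J, ∀ y, Tendsto (fun t => W (y + (P i).velocity * t - m * t)) atTop
      (𝓝 (if i ≤ j then 1 else 0)))
    (hl : 0 < l) (hL : 0 ≤ L)
    (hq : ∀ i ∈ Finset.Icc 1 J, ∀ t x, 0 ≤ t →
      Real.exp (-γ * |x - (P i).velocity * t|) * q (x - m * t) ≤ L * Real.exp (-l * t)) :
    ∃ T₄ C : ℝ, T ≤ T₄ ∧ 0 < C ∧ ∀ t, T₄ ≤ t →
      localSecondEnergy (fun x => W (x - m * t)) (u t) +
        A * localEnergy (fun x => W (x - m * t)) (u t) +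
        D * localMass (fun x => W (x - m * t)) (u t) -
        ∑ i ∈ Finset.Icc 1 j, secondEnergy ((P i).profile t) -
        A * ∑ i ∈ Finset.Icc 1 j, energy ((P i).profile t) -
        D * ∑ i ∈ Finset.Icc 1 j, mass ((P i).profile t) ≤ C * Real.exp (-l * t) := by
  obtain ⟨U, U₁, U₂, hU, hae⟩ := hu.solution.exists_flow
  choose p₁ p₂ hp using fun i => (P i).exists_triple
  have hp' : ∀ i ∈ Finset.Icc 1 J, IsWaveTriple (P i).velocity γ (P i).profile (p₁ i) (p₂ i) :=
    fun i hi => (hp i).mono (hγb i hi)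
  have hS := fun t => isH2Triple_sum hγ hp' t
  have hv : Set.InjOn (fun i => (P i).velocity) (Finset.Icc 1 J : Finset ℕ) := by
    intro i hi k hk hik
    simp only [Finset.coe_Icc, Set.mem_Icc] at hi hk
    rcases lt_trichotomy i k with h | h | h
    · exact absurd hik (hmono i k hi.1 h hk.2).ne
    · exact h
    · exact absurd hik (hmono k i hk.1 h hi.2).ne'
  have hTl : ∀ᶠ t in atTop, T ≤ t := eventually_ge_atTop T
  have hlim := tendsto_h2sq (hTl.mono fun t ht => (hU.triple t ht).sub (hS t))
    (hTl.mono fun t ht => (hae t ht).mono fun x hx => by rw [hx, sumProfile]) hu.tendsto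
  obtain ⟨T₄, C, hT, hC, hmain⟩ := exists_integral_dens_sub_le (A := A) (D := D) hγ hp' hv hU hlim
    hw hc hcoer hχ hl hL hq
  refine ⟨T₄, C, hT, hC, fun t ht => ?_⟩
  have hΦ : AEStronglyMeasurable (fun x => W (x - m * t)) :=
    (hw.comp_sub (m * t)).bounded.cont.aestronglyMeasurable
  have hΦ1 : ∀ x, |W (x - m * t)| ≤ 1 := fun x => by
    rw [abs_of_nonneg (hw.nonneg _)]; exact hw.le_one _
  have e1 := localFunctional_eq (hU.triple t (hT.trans ht)) (hae t (hT.trans ht)) hΦ hΦ1 A D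
  have e2 : ∀ i ∈ Finset.Icc 1 j, secondEnergy ((P i).profile t) + A * energy ((P i).profile t) +
      D * mass ((P i).profile t) =
      ∫ x, dens A D ((P i).profile t x) (p₁ i t x) (p₂ i t x) := fun i _ => by
    have := localFunctional_eq (((hp i).triple (P i).b_pos) t) (ae_eq_refl ((P i).profile t))
      (Φ := fun _ => 1) aestronglyMeasurable_const (fun x => by simp) A D
    simp only [mul_one] at this
    exact this
  have h := hmain t ht
  rw [sum_ite_Icc hj, ← Finset.sum_congr rfl e2, ← e1, Finset.sum_add_distrib,
    Finset.sum_add_distrib, ← Finset.mul_sum, ← Finset.mul_sum] at h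
  linarith

end MKdV

/-! ### Choice of the constants and conclusion. -/

theorem mainTheorem3
    -- the objects `P 1, …, P J`, ordered by velocity, all velocities but the first being positive
    (J : ℕ) (P : ℕ → MKdV.Wave)
    (hmono : ∀ i j, 1 ≤ i → i < j → j ≤ J → (P i).velocity < (P j).velocity)
    (hpos : 2 ≤ J → 0 < (P 2).velocity)
    -- the choice of `ν₁`, and of the velocity `m₁` of the first cut-off
    (ν₁ : ℝ) (hν₁ : 0 < ν₁ ∧ ν₁ < 1)
    (hν₁' : 0 < ((P 1).b ^ 2 - (P 1).a ^ 2) + ν₁ * ((P 1).a ^ 2 + (P 1).b ^ 2))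
    (m₁ : ℝ)
    (hm₁ : 2 ≤ J → max 0 (P 1).velocity < m₁ ∧ m₁ < (P 2).velocity)
    (hm₁' : 2 ≤ J → 1 / 2 * (ν₁ - 1) * ((P 1).a ^ 2 + (P 1).b ^ 2) ^ 2 <
      m₁ * ((P 1).b ^ 2 - (P 1).a ^ 2)) :
    ∃ ν₀ : ℝ, 0 < ν₀ ∧ ν₀ < 1 ∧ ∃ σ₀ : ℝ, 0 < σ₀ ∧ ∀ σ : ℝ, 0 < σ → σ ≤ σ₀ →
      ∃ ϖ₀ : ℝ, 0 < ϖ₀ ∧ ∀ ϖ : ℝ, 0 < ϖ → ϖ ≤ ϖ₀ →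
        ∀ (T : ℝ) (u : ℝ → ℝ → ℝ), MKdV.IsMultiBreather J P T u →
          ∀ ν : ℝ, ν₀ ≤ ν → ν < 1 → ∀ j : ℕ, 1 ≤ j → j ≤ J →
            ∃ T₄ C : ℝ, T ≤ T₄ ∧ 0 < C ∧ ∀ t : ℝ, T₄ ≤ t →
              MKdV.weakFunctional J P m₁ σ ν u j t
                - ∑ i ∈ Finset.Icc 1 j, MKdV.secondEnergy ((P i).profile t)
                - 2 * ((P j).b ^ 2 - (P j).a ^ 2) *
                    ∑ i ∈ Finset.Icc 1 j, MKdV.energy ((P i).profile t)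
                - ν * ((P j).a ^ 2 + (P j).b ^ 2) ^ 2 *
                    ∑ i ∈ Finset.Icc 1 j, MKdV.mass ((P i).profile t)
              ≤ C * Real.exp (-2 * ϖ * t) := by
  obtain ⟨n0, n1⟩ := hν₁
  have hν0 : 0 < ν₁ ^ 2 + (1 - ν₁) / 3 := by
    have : 0 < 1 - ν₁ := sub_pos.2 n1
    positivity
  -- This ν₀ solves 3/2 (ν₀ - ν₁²) = (1 - ν₁)/2, the margin that the condition on m₁ provides.
  refine ⟨ν₁ ^ 2 + (1 - ν₁) / 3, hν0, by nlinarith, ?_⟩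
  choose! κ₀ c μ hκ₀ hc hco using fun j (h : 1 ≤ j ∧ j < J) =>
    MKdV.exists_coercive_cutoff hmono hpos ⟨n0, n1⟩ hν₁' hm₁ hm₁' h.1 h.2
  obtain ⟨κ, hκ, hκle⟩ := MKdV.exists_pos_forall_le (Finset.Ico 1 J) (f := κ₀) fun j hj =>
    hκ₀ j (Finset.mem_Ico.1 hj)
  -- The bound 4 makes the cut-off a weight; the bound 4κ makes the loss σ/4 in the second
  -- derivative small enough for coercivity at all j < J.
  refine ⟨min 4 (4 * κ), by positivity, fun σ hσ hσ0 => ?_⟩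
  have hσ4 : σ ≤ 4 := hσ0.trans (min_le_left _ _)
  have hσκ : σ / 4 ≤ κ := by linarith [hσ0.trans (min_le_right _ _)]
  obtain ⟨γ, hγ, hγb⟩ := MKdV.exists_pos_forall_le (Finset.Icc 1 J) (f := fun i => (P i).b)
    fun i _ => (P i).b_pos
  -- No cut-off travels at the velocity of a wave; the least gap `d` governs the exponential rate.
  have hsep : ∀ r ∈ Finset.Icc 1 J ×ˢ Finset.Ico 1 J,
      0 < |(P r.1).velocity - MKdV.cutoffVelocity P m₁ r.2| := by
    rintro ⟨i, j⟩ hij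
    simp only [Finset.mem_product, Finset.mem_Icc, Finset.mem_Ico] at hij
    obtain ⟨⟨hi1, hiJ⟩, hj1, hjJ⟩ := hij
    obtain ⟨a, b, -⟩ := MKdV.cutoffVelocity_bounds hmono hpos hm₁ hj1 hjJ
    refine abs_pos.2 (sub_ne_zero.2 ?_)
    rcases le_or_gt i j with h | h
    · exact ((MKdV.velocity_le hmono hi1 h hjJ.le).trans_lt a).ne
    · exact (b.trans_le (MKdV.velocity_le hmono (by omega) h hiJ)).ne'
  obtain ⟨d, hd, hdle⟩ := MKdV.exists_pos_forall_le _ hsep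
  have hs : 0 < Real.sqrt σ / 2 := by positivity
  -- The slower of the two decay rates, of waves and of the transition, times the least velocity gap
  -- must be at least 2ϖ.
  refine ⟨min γ (Real.sqrt σ / 2) * d / 2, by positivity, fun ϖ hϖ hϖ0 T u hu ν hν hν1 j hj1 hjJ => ?_⟩
  have main : ∃ T₄ C : ℝ, T ≤ T₄ ∧ 0 < C ∧ ∀ t, T₄ ≤ t →
      MKdV.localSecondEnergy (MKdV.cutoff J P m₁ σ j t) (u t) +
        (2 * ((P j).b ^ 2 - (P j).a ^ 2)) * MKdV.localEnergy (MKdV.cutoff J P m₁ σ j t) (u t) +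
        (ν * ((P j).a ^ 2 + (P j).b ^ 2) ^ 2) *
          MKdV.localMass (MKdV.cutoff J P m₁ σ j t) (u t) -
        ∑ i ∈ Finset.Icc 1 j, MKdV.secondEnergy ((P i).profile t) -
        (2 * ((P j).b ^ 2 - (P j).a ^ 2)) *
          ∑ i ∈ Finset.Icc 1 j, MKdV.energy ((P i).profile t) -
        (ν * ((P j).a ^ 2 + (P j).b ^ 2) ^ 2) *
          ∑ i ∈ Finset.Icc 1 j, MKdV.mass ((P i).profile t) ≤
        C * Real.exp (-(2 * ϖ) * t) := by
    rcases hjJ.eq_or_lt with rfl | hlt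
    -- For j = J nothing is cut off: p vanishes, coercivity is replaced by its alternative, and `L =
    -- 0`, so any rate is allowed.
    · have e : ∀ t, MKdV.cutoff j P m₁ σ j t = fun _ => 1 := fun t => by
        ext x; simp [MKdV.cutoff]
      simp only [e]
      exact hu.exists_functional_sub_le (W := fun _ => 1) (m := 0) (μ := 0) (L := 0) hmono hγ le_rfl
        hγb MKdV.isWeight_one one_pos (fun _ => Or.inr rfl)
        (fun i hi y => by
          rw [if_pos (Finset.mem_Icc.1 hi).2]; exact tendsto_const_nhds)
        (by positivity) le_rfl (fun i _ t x _ => by simp)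
    · have e : ∀ t, MKdV.cutoff J P m₁ σ j t =
          fun x => MKdV.cutoffShape σ (x - MKdV.cutoffVelocity P m₁ j * t) := fun t => by
        ext x; simp [MKdV.cutoff, hlt.ne]
      simp only [e]
      obtain ⟨a, b, -⟩ := MKdV.cutoffVelocity_bounds hmono hpos hm₁ hj1 hlt
      refine hu.exists_functional_sub_le hmono hγ hjJ hγb (MKdV.isWeight_cutoffShape hσ hσ4)
        (hc j ⟨hj1, hlt⟩) (fun _ => Or.inl (hco j ⟨hj1, hlt⟩ (σ / 4) ν (by positivity)
          (hσκ.trans (hκle j (Finset.mem_Ico.2 ⟨hj1, hlt⟩))) hν))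
        (fun i hi y => ?_) (by positivity) (by norm_num : (0 : ℝ) ≤ 2) (fun i hi t x ht => ?_)
      · rw [Finset.mem_Icc] at hi
        split_ifs with h
        · exact MKdV.tendsto_cutoffShape_of_lt hσ
            ((MKdV.velocity_le hmono hi.1 h hjJ).trans_lt a) y
        · exact MKdV.tendsto_cutoffShape_of_gt hσ
            (b.trans_le (MKdV.velocity_le hmono (by omega) (not_le.1 h) hi.2)) y
      · refine MKdV.exp_mul_cutoffDeriv_le (γ' := min γ (Real.sqrt σ / 2)) hσ hσ4 (by positivity)
          (min_le_left _ _) (min_le_right _ _) ?_ ht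
        have h1 := hdle (i, j) (Finset.mem_product.2 ⟨hi, Finset.mem_Ico.2 ⟨hj1, hlt⟩⟩)
        have h2 : min γ (Real.sqrt σ / 2) * d ≤ min γ (Real.sqrt σ / 2) *
            |(P i).velocity - MKdV.cutoffVelocity P m₁ j| := by gcongr
        linarith
  obtain ⟨T₄, C, hT, hC, h⟩ := main
  refine ⟨T₄, C, hT, hC, fun t ht => ?_⟩
  have := h t ht
  rw [show -2 * ϖ * t = -(2 * ϖ) * t by ring]
  exact this
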